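/- **Setting.** Let $d\ge 1$, let $\Theta\subset\mathbb R^d$ be compact and convex, and let $\{f(\cdot;\theta)\}$ be a parametric family of probability densities of a nonnegative lifetime, $\theta\in\Theta$, with distribution functions $F(\cdot;\theta)$. A lifetime $T$ has density $f(\cdot;\theta_0)$ with $\theta_0$ in the interior of $\Theta$, and is independent of the pair (right-censoring time $c$, left-truncation time $a\le c$), whose law is arbitrary. A unit is observed only if $T>a$, and then the record is $x=(t,C,t_l)$ with $t=\min(T,c)$, $C=1$ if $c<T$ and $C=0$ otherwise, and $t_l=a$. The data $\mathcal D_n=(x_1,\dots,x_n)$ are independent copies of such a record. Put $$l(x,\theta)=(1-C)\log f(t;\theta)+C\log\{1-F(t;\theta)\}-\log\{1-F(t_l;\theta)\},$$ assumed to be well defined and, for almost every $x$, twice continuously differentiable at every $\theta\in\Theta$; write $l_i(\theta)=l(x_i,\theta)$, $\dot l$ for the gradient and $\ddot l$ for the Hessian in $\theta$. Let $\hat\theta=\hat\theta_n$ be a maximizer over $\Theta$ of $\frac1n\sum_{i=1}^n l_i(\theta)$. **Assumptions.** 1. $\hat\theta$ is the unique maximizer with probability tending to one, and $\mathbb E\,l(x,\theta)^2<\infty$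 for every $\theta\in\Theta$. 2. For every $\theta\in\Theta$, $-\mathbb E\,\ddot l(x,\theta)$ is positive definite and $\mathbb E\,\ddot l_{(jk)}(x,\theta)^2<\infty$ for all $j,k$; there is $\psi$ with $\mathbb E\,\psi(x)^2<\infty$ and $|\ddot l_{(jk)}(x,\theta_1)-\ddot l_{(jk)}(x,\theta_2)|\le\psi(x)\|\theta_1-\theta_2\|$ for all $\theta_1,\theta_2\in\Theta$, all $j,k$ and almost every $x$. 3. For every $\theta\in\Theta$, $\mathbb E\{\dot l(x,\theta)\dot l(x,\theta)^\top\}$ is finite and positive definite; and there is $\delta>0$ such that for every $\theta\in\Theta$, on the event $\|\theta-\hat\theta\|<\delta$, $\frac1n\sum_{i=1}^n\|\dot l_i(\theta)\|^4=O_p(1)$. **Algorithm.** Fix $\xi\in(0,1)$. (i) Draw $r_0$ indices uniformly with replacement from $\{1,\dots,n\}$, and let $\tilde\theta_p$ maximize over $\Theta$ the average of $l_i(\theta)$ over the drawn indices. (ii) Put $\pi_{\xi,i}(\theta)=(1-\xi)\,\dfrac{\|\dot l_i(\theta)\|}{\sum_{j=1}^n\|\dot l_j(\theta)\|}+\dfrac{\xi}{n}$.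 (iii) Draw $r$ indices $K_1,\dots,K_r$ independently, with replacement, with the probabilities $\pi_{\xi,i}(\tilde\theta_p)$, and let $\tilde\theta_{RDS}$ maximize over $\Theta$ the function $\frac1r\sum_{k=1}^r \pi_{\xi,K_k}(\tilde\theta_p)^{-1}\,l_{K_k}(\theta)$. **Claim.** Put $$M_g=\frac1n\sum_{i=1}^n\ddot l_i(\hat\theta),\qquad \Lambda_{RDS}=\frac1{n^2}\sum_{i=1}^n\frac{1}{\pi_{\xi,i}(\hat\theta)}\,\dot l_i(\hat\theta)\,\dot l_i(\hat\theta)^\top,\qquad V_{RDS}=M_g^{-1}\Lambda_{RDS}M_g^{-1}.$$ With probability tending to one as $n\to\infty$, $-M_g$ and $\Lambda_{RDS}$ are positive definite. As $r_0,r,n\to\infty$ (jointly, with no restriction on their relative rates), conditionally on $\mathcal D_n$ and $\tilde\theta_p$, $$\sqrt r\,V_{RDS}^{-1/2}\,(\tilde\theta_{RDS}-\hat\theta)\xrightarrow{d}N(0,I),$$ that is, the conditional law of the left side given $\mathcal D_n$ and $\tilde\theta_p$ converges weakly to $N(0,I)$ in probability. -/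

import Mathlib

open MeasureTheory ProbabilityTheory Filter Topology
open scoped BoundedContinuousFunction

noncomputable section

/-! Lifetime data with right censoring and left truncation -/

/-- The parameter space `ℝ^d` with its Euclidean norm. -/
abbrev Param (d : ℕ) : Type := EuclideanSpace ℝ (Fin d)

/-- One record `(t, C, t_l)`: observed time, censoring indicator (`true` means censored),
left-truncation time. -/
abbrev Obs : Type := ℝ × Bool × ℝ

/-- `g` is a probability density of a nonnegative lifetime. -/
structure IsLifetimeDensity (g : ℝ → ℝ) : Prop where
  measurable : Measurable g
  nonneg : ∀ u, 0 ≤ g u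
  eq_zero_of_neg : ∀ u, u < 0 → g u = 0
  lintegral_eq_one : ∫⁻ u, ENNReal.ofReal (g u) = 1

/-- The cumulative distribution function of the density `g`. -/
def lifetimeCDF (g : ℝ → ℝ) (t : ℝ) : ℝ := ∫ u in Set.Iic t, g u

/-- The lifetime distribution with density `g`. -/
def lifetimeLaw (g : ℝ → ℝ) : Measure ℝ := volume.withDensity fun u => ENNReal.ofReal (g u)

/-- The record produced by a lifetime `T`, a right-censoring time `c` (`⊤` if the unit is never
censored) and a left-truncation time `a`: the time `min T c`, whether `c < T`, and `a`. -/
def record (z : ℝ × EReal × ℝ) : Obs :=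
  if (z.1 : EReal) ≤ z.2.1 then (z.1, false, z.2.2) else (z.2.1.toReal, true, z.2.2)

/-- The law of one record: the lifetime has density `g` and is independent of the pair
(censoring time, truncation time), whose law is `ν`; a unit enters the data only if its lifetime
exceeds its truncation time. -/
def obsLaw (g : ℝ → ℝ) (ν : Measure (EReal × ℝ)) : Measure Obs :=
  (cond ((lifetimeLaw g).prod ν) {z : ℝ × EReal × ℝ | z.2.2 < z.1}).map record

instance (g : ℝ → ℝ) (ν : Measure (EReal × ℝ)) : IsFiniteMeasure (obsLaw g ν) := by
  unfold obsLaw; infer_instance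

/-- The law of the full data `D_n`: `n` independent records. -/
def dataLaw (g : ℝ → ℝ) (ν : Measure (EReal × ℝ)) (n : ℕ) : Measure (Fin n → Obs) :=
  Measure.pi fun _ => obsLaw g ν

instance (g : ℝ → ℝ) (ν : Measure (EReal × ℝ)) (n : ℕ) : IsFiniteMeasure (dataLaw g ν n) := by
  unfold dataLaw; infer_instance

section Likelihood

variable {d : ℕ} (f : Param d → ℝ → ℝ)

/-- The log-likelihood `l(x, θ)` of one record under the model with densities `f θ`. -/
def logLik (x : Obs) (θ : Param d) : ℝ :=
  (if x.2.1 then Real.log (1 - lifetimeCDF (f θ) x.1) else Real.log (f θ x.1))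
    - Real.log (1 - lifetimeCDF (f θ) x.2.2)

/-- All the quantities whose logarithms enter `l(x, θ)` are positive. -/
def LikPos (x : Obs) (θ : Param d) : Prop :=
  (if x.2.1 then 0 < 1 - lifetimeCDF (f θ) x.1 else 0 < f θ x.1)
    ∧ 0 < 1 - lifetimeCDF (f θ) x.2.2

/-- The gradient of `l(x, ·)` at `θ`. -/
def score (x : Obs) (θ : Param d) : Param d := gradient (logLik f x) θ

/-- The matrix of second partial derivatives of `l(x, ·)` at `θ`. -/
def hess (x : Obs) (θ : Param d) : Matrix (Fin d) (Fin d) ℝ :=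
  Matrix.of fun j k => fderiv ℝ (fderiv ℝ (logLik f x)) θ
    (EuclideanSpace.single j 1) (EuclideanSpace.single k 1)

/-- The full-data log-likelihood `l_f`. -/
def fullLogLik {n : ℕ} (x : Fin n → Obs) (θ : Param d) : ℝ :=
  (n : ℝ)⁻¹ * ∑ i, logLik f (x i) θ

/-- `M_g`, the average Hessian of the log-likelihood, as a function of `θ`. -/
def avgHess {n : ℕ} (x : Fin n → Obs) (θ : Param d) : Matrix (Fin d) (Fin d) ℝ :=
  (n : ℝ)⁻¹ • ∑ i, hess f (x i) θ

/-- The probabilities `π_i^{RDS}(θ)`, proportional to the norms of the individual scores. -/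
def piOpt {n : ℕ} (x : Fin n → Obs) (θ : Param d) (i : Fin n) : ℝ :=
  ‖score f (x i) θ‖ / ∑ j, ‖score f (x j) θ‖

/-- The mixed probabilities `(1 - ξ) π_i^{RDS}(θ) + ξ / n`. -/
def piMix (ξ : ℝ) {n : ℕ} (x : Fin n → Obs) (θ : Param d) (i : Fin n) : ℝ :=
  (1 - ξ) * piOpt f x θ i + ξ / n

/-- The pilot objective, for the subsample with indices `J 0, …, J (r₀ - 1)`. -/
def pilotLogLik {n r₀ : ℕ} (x : Fin n → Obs) (J : Fin r₀ → Fin n) (θ : Param d) : ℝ :=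
  (r₀ : ℝ)⁻¹ * ∑ k, logLik f (x (J k)) θ

/-- The inverse probability weighted objective, for the subsample with indices
`K 0, …, K (r - 1)`; the weights are computed at the pilot value `θp`. -/
def weightedLogLik (ξ : ℝ) {n r : ℕ} (x : Fin n → Obs) (θp : Param d) (K : Fin r → Fin n)
    (θ : Param d) : ℝ :=
  (r : ℝ)⁻¹ * ∑ k, (piMix f ξ x θp (K k))⁻¹ * logLik f (x (K k)) θ

/-- `Λ_{RDS}`, as a function of `θ`. -/
def lambdaRDS (ξ : ℝ) {n : ℕ} (x : Fin n → Obs) (θ : Param d) : Matrix (Fin d) (Fin d) ℝ :=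
  ((n : ℝ) ^ 2)⁻¹ • ∑ i, (piMix f ξ x θ i)⁻¹ •
    Matrix.vecMulVec (score f (x i) θ) (score f (x i) θ)

/-- `V_{RDS} = M_g⁻¹ Λ_{RDS} M_g⁻¹`, as a function of `θ`. -/
def covRDS (ξ : ℝ) {n : ℕ} (x : Fin n → Obs) (θ : Param d) : Matrix (Fin d) (Fin d) ℝ :=
  (avgHess f x θ)⁻¹ * lambdaRDS f ξ x θ * (avgHess f x θ)⁻¹

end Likelihood

/-- `θ` maximizes `h` over `Θ`. -/
def IsArgmax {d : ℕ} (Θ : Set (Param d)) (h : Param d → ℝ) (θ : Param d) : Prop :=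
  θ ∈ Θ ∧ IsMaxOn h Θ θ

/-- `A^{-1/2}` for a symmetric positive definite matrix `A`, by functional calculus. -/
def invSqrt {d : ℕ} (A : Matrix (Fin d) (Fin d) ℝ) : Matrix (Fin d) (Fin d) ℝ :=
  cfc (fun s : ℝ => (Real.sqrt s)⁻¹) A

/-! Subsampling with replacement -/

/-- The law on `Fin n` of one draw with probabilities `p`. -/
def drawLaw {n : ℕ} (p : Fin n → ℝ) : Measure (Fin n) :=
  ∑ i, ENNReal.ofReal (p i) • Measure.dirac i

instance {n : ℕ} (p : Fin n → ℝ) : IsFiniteMeasure (drawLaw p) := by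
  constructor
  simp only [drawLaw, Measure.finsetSum_apply, Measure.smul_apply, smul_eq_mul]
  exact ENNReal.sum_lt_top.2 fun i _ =>
    ENNReal.mul_lt_top ENNReal.ofReal_lt_top (measure_lt_top _ _)

/-- The law of `m` independent draws from `Fin n` with probabilities `p`. -/
def drawsLaw {n : ℕ} (m : ℕ) (p : Fin n → ℝ) : Measure (Fin m → Fin n) :=
  Measure.pi fun _ => drawLaw p

/-- The joint law of the full data and of the indices of a uniform pilot subsample. -/
def dataPilotLaw (g : ℝ → ℝ) (ν : Measure (EReal × ℝ)) (n r₀ : ℕ) :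
    Measure ((Fin n → Obs) × (Fin r₀ → Fin n)) :=
  (dataLaw g ν n).prod (drawsLaw r₀ fun _ => (n : ℝ)⁻¹)

/-- The conditional law, given the data `x` and the pilot estimate `θp`, of
`√r V_{RDS}^{-1/2} (θ̃ - θ̂)`: here `θh` is the full-data estimate, `est K` is the estimate `θ̃`
obtained from the subsample with indices `K`, and the indices are `r` independent draws with the
mixed probabilities at `θp`. -/
def condLawRDS {d : ℕ} (f : Param d → ℝ → ℝ) (ξ : ℝ) {n r : ℕ} (x : Fin n → Obs)
    (θh θp : Param d) (est : (Fin r → Fin n) → Param d) : Measure (Param d) :=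
  (drawsLaw r (piMix f ξ x θp)).map fun K =>
    Real.sqrt r • Matrix.toEuclideanCLM (𝕜 := ℝ) (invSqrt (covRDS f ξ x θh)) (est K - θh)

/-! Regularity conditions; `μ` is the law of one record. -/

/-- For almost every record, `l(x, ·)` is well defined and twice continuously differentiable
on `Θ`. -/
def SmoothLik {d : ℕ} (f : Param d → ℝ → ℝ) (Θ : Set (Param d)) (μ : Measure Obs) : Prop :=
  ∀ᵐ x ∂μ, ∀ θ ∈ Θ, LikPos f x θ ∧ ContDiffAt ℝ 2 (logLik f x) θ

/-- `-E l̈(x, θ)` is positive definite, the entries of `l̈(x, θ)` have second moments, and `l̈` is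
Lipschitz in `θ` with a square integrable Lipschitz constant. -/
structure HessCondition {d : ℕ} (f : Param d → ℝ → ℝ) (Θ : Set (Param d)) (μ : Measure Obs) :
    Prop where
  memLp : ∀ θ ∈ Θ, ∀ j k, MemLp (fun x => hess f x θ j k) 2 μ
  posDef : ∀ θ ∈ Θ, (-(Matrix.of fun j k => ∫ x, hess f x θ j k ∂μ)).PosDef
  lipschitz : ∃ ψ : Obs → ℝ, MemLp ψ 2 μ ∧ ∀ᵐ x ∂μ, ∀ θ₁ ∈ Θ, ∀ θ₂ ∈ Θ, ∀ j k,
    |hess f x θ₁ j k - hess f x θ₂ j k| ≤ ψ x * ‖θ₁ - θ₂‖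

/-- `Λ(θ) = E[l̇(x, θ) l̇(x, θ)ᵀ]` is (finite and) positive definite. -/
structure ScoreCondition {d : ℕ} (f : Param d → ℝ → ℝ) (Θ : Set (Param d)) (μ : Measure Obs) :
    Prop where
  memLp : ∀ θ ∈ Θ, MemLp (fun x => score f x θ) 2 μ
  posDef : ∀ θ ∈ Θ, (Matrix.of fun j k => ∫ x, score f x θ j * score f x θ k ∂μ).PosDef

/-- For some `δ > 0` and every `θ` with `‖θ - θ̂‖ < δ`, the average of `‖l̇_i(θ)‖ ^ 4` is bounded
in probability. -/
def FourthMomentCondition {d : ℕ} (f : Param d → ℝ → ℝ) (Θ : Set (Param d))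
    (P : (n : ℕ) → Measure (Fin n → Obs)) (θhat : (n : ℕ) → (Fin n → Obs) → Param d) : Prop :=
  ∃ δ > 0, ∀ θ ∈ Θ, ∀ η > 0, ∃ B : ℝ, ∀ᶠ n in atTop,
    P n {x | ‖θ - θhat n x‖ < δ ∧ B < (n : ℝ)⁻¹ * ∑ i, ‖score f (x i) θ‖ ^ 4}
      ≤ ENNReal.ofReal η

end

/-! The proof rests on uniform strong concavity. On `Θ` the first two derivatives of `l(x, ·)` and
their Lipschitz constants have a square integrable envelope `G` (`exists_smoothBound`), and by
compactness the expected Hessian is at most `-lam` (`exists_meanHess_le`). A uniform law of large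
numbers, `exists_measure_uniform_avg_le`, carries this over to the full-data objective and to both
subsample objectives. The distance from a point to the maximizer of a strongly concave function is
at most a constant times the norm of the gradient at that point (`IsArgmax.norm_sub_le`), so each
estimator is close to its target as soon as the gradient there is small. The target of `θ̂` is `θ₀`,
where the score has mean zero by the Kullback-Leibler inequality (`integral_logLik_le`,
`integral_score_eq_zero`). The target of the pilot and of the weighted estimator is `θ̂`, an
interior stationary point of the full-data objective, where the inverse probability weighted
gradient is conditionally centred.

What is needed of the data is collected in `GoodData`, which holds with probability tending to one
(`exists_highProb_goodData`). Given good data, what remains concerns draws from a finite population.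
The floor `ξ / n` bounds the weights `(n π_i)⁻¹` by `ξ⁻¹`, so the error bounds involve only fixed
constants and the subsample size, never `n`; hence no relation between the rates is required.

Expanding the gradient of the weighted objective at `θ̂` gives the leading term `linRDS` and a
negligible remainder (`exists_drawsLaw_remainder_le`). The leading term is a normalized sum of
independent centred vectors, treated by Lindeberg's bound `norm_integral_cexp_pow_sub_le`. In
direction `t` its variance would be exactly `‖t‖ ^ 2` if the weights were computed at `θ̂`. Moving
them to the pilot changes them by a multiple of `‖θ̃_p - θ̂‖ G(x_i)`; as only `G ^ 2` is known to be
integrable, the envelope is truncated at levels `κ j` (`GoodData.abs_avg_sub_le`).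

Since these estimates are uniform over good data, Lévy's continuity theorem along a hypothetical
sequence of counterexamples yields a uniform weak approximation
(`exists_abs_integral_condLawRDS_le`), and convergence in probability follows. -/

noncomputable section

/-! Second order calculus on a convex set -/

/-- The matrix of second partial derivatives. -/
def hessian {d : ℕ} (L : Param d → ℝ) (θ : Param d) : Matrix (Fin d) (Fin d) ℝ :=
  Matrix.of fun j k => fderiv ℝ (fderiv ℝ L) θ
    (EuclideanSpace.single j 1) (EuclideanSpace.single k 1)

/-- The continuous linear map of a square matrix. -/
abbrev matOp {d : ℕ} (A : Matrix (Fin d) (Fin d) ℝ) : Param d →L[ℝ] Param d :=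
  Matrix.toEuclideanCLM (𝕜 := ℝ) A

section Calculus

variable {d : ℕ}

lemma hessian_transpose {L : Param d → ℝ} {θ : Param d} (h : ContDiffAt ℝ 2 L θ) :
    (hessian L θ).transpose = hessian L θ := by
  ext j k
  exact (h.isSymmSndFDerivAt (by simp)) _ _

lemma fderiv_fderiv_apply_eq_inner (L : Param d → ℝ) (θ u v : Param d) :
    fderiv ℝ (fderiv ℝ L) θ u v = inner ℝ u (matOp (hessian L θ) v) := by
  have hu : u = ∑ j, u j • EuclideanSpace.single j (1 : ℝ) := by
    ext i; simp [Finset.sum_apply, Pi.single_apply]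
  have hv : v = ∑ j, v j • EuclideanSpace.single j (1 : ℝ) := by
    ext i; simp [Finset.sum_apply, Pi.single_apply]
  rw [Matrix.inner_toEuclideanCLM]
  conv_lhs => rw [hu, hv]
  simp only [map_sum, map_smul, _root_.sum_apply, _root_.smul_apply,
    smul_eq_mul, dotProduct, Matrix.mulVec, hessian, Matrix.of_apply, Finset.mul_sum]
  refine (Finset.sum_comm).trans ?_
  refine Finset.sum_congr rfl fun i _ => Finset.sum_congr rfl fun j _ => ?_
  ring

lemma hasFDerivAt_gradient {L : Param d → ℝ} {θ : Param d} (h : ContDiffAt ℝ 2 L θ) :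
    HasFDerivAt (gradient L) (matOp (hessian L θ)) θ := by
  have h1 : DifferentiableAt ℝ (fderiv ℝ L) θ :=
    (h.fderiv_right (m := 1) (by norm_num)).differentiableAt (by norm_num)
  have h2 := ((InnerProductSpace.toDual ℝ (Param d)).symm.toContinuousLinearEquiv.toContinuousLinearMap.hasFDerivAt
    (x := fderiv ℝ L θ)).comp θ h1.hasFDerivAt
  refine h2.congr_fderiv ?_
  ext1 v
  refine ext_inner_right ℝ fun u => ?_
  rw [real_inner_comm _ (matOp (hessian L θ) v), ← fderiv_fderiv_apply_eq_inner]
  -- Symmetry is needed because differentiating in direction `v` fills the first slot of the second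
  -- derivative, while `matOp (hessian L θ) v` fills the second.
  have h3 := h.isSymmSndFDerivAt (by simp) u v
  rw [h3]
  simp

/-- The form is at most `a` times the product of the two `ℓ¹` norms, and each `ℓ¹` norm costs a
factor `√d` by Cauchy-Schwarz. This lets all matrix estimates be made entry by entry. -/
lemma abs_inner_matOp_le {A : Matrix (Fin d) (Fin d) ℝ} {a : ℝ} (hA : ∀ j k, |A j k| ≤ a)
    (u v : Param d) : |inner ℝ u (matOp A v)| ≤ d * a * ‖u‖ * ‖v‖ := by
  rcases Nat.eq_zero_or_pos d with rfl | hd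
  · simp [Subsingleton.elim u 0]
  have ha : 0 ≤ a := (abs_nonneg _).trans (hA ⟨0, hd⟩ ⟨0, hd⟩)
  have key : ∀ w : Param d, ∑ j, |w j| ≤ Real.sqrt d * ‖w‖ := by
    intro w
    refine (pow_le_pow_iff_left₀ (by positivity) (by positivity) two_ne_zero).1 ?_
    rw [mul_pow, Real.sq_sqrt (by positivity), EuclideanSpace.real_norm_sq_eq]
    have := sq_sum_le_card_mul_sum_sq (s := Finset.univ) (f := fun j => |w j|)
    simpa using this
  rw [Matrix.inner_toEuclideanCLM]
  simp only [Matrix.mulVec, dotProduct]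
  calc |∑ j, u j * ∑ k, A j k * v k| ≤ ∑ j, |u j| * ∑ k, a * |v k| := by
        refine (Finset.abs_sum_le_sum_abs _ _).trans (Finset.sum_le_sum fun j _ => ?_)
        rw [abs_mul]
        refine mul_le_mul_of_nonneg_left ?_ (abs_nonneg _)
        refine (Finset.abs_sum_le_sum_abs _ _).trans (Finset.sum_le_sum fun k _ => ?_)
        rw [abs_mul]
        exact mul_le_mul_of_nonneg_right (hA j k) (abs_nonneg _)
    _ = a * ((∑ j, |u j|) * ∑ k, |v k|) := by
        rw [← Finset.sum_mul, ← Finset.mul_sum]; ring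
    _ ≤ a * ((Real.sqrt d * ‖u‖) * (Real.sqrt d * ‖v‖)) := by
        gcongr
        · exact key u
        · exact key v
    _ = a * (Real.sqrt d * Real.sqrt d) * ‖u‖ * ‖v‖ := by ring
    _ = d * a * ‖u‖ * ‖v‖ := by rw [Real.mul_self_sqrt (by positivity)]; ring

lemma norm_matOp_apply_le {A : Matrix (Fin d) (Fin d) ℝ} {a : ℝ} (hA : ∀ j k, |A j k| ≤ a)
    (v : Param d) : ‖matOp A v‖ ≤ d * a * ‖v‖ := by
  rcases eq_or_ne (matOp A v) 0 with h | h
  · rw [h, norm_zero]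
    rcases Nat.eq_zero_or_pos d with rfl | hd
    · simp
    have ha : 0 ≤ a := (abs_nonneg _).trans (hA ⟨0, hd⟩ ⟨0, hd⟩)
    positivity
  have h1 := abs_inner_matOp_le hA (matOp A v) v
  rw [real_inner_self_eq_norm_sq, abs_of_nonneg (by positivity)] at h1
  have h2 : 0 < ‖matOp A v‖ := norm_pos_iff.2 h
  refine le_of_mul_le_mul_left ?_ h2
  nlinarith

lemma norm_matOp_le {A : Matrix (Fin d) (Fin d) ℝ} {a : ℝ} (hA : ∀ j k, |A j k| ≤ a)
    (ha : 0 ≤ a) : ‖matOp A‖ ≤ d * a :=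
  ContinuousLinearMap.opNorm_le_bound _ (by positivity) fun v => norm_matOp_apply_le hA v

lemma hasGradientAt_of_contDiffAt {L : Param d → ℝ} {θ : Param d} (h : ContDiffAt ℝ 2 L θ) :
    HasGradientAt L (gradient L θ) θ :=
  (h.differentiableAt (by norm_num)).hasGradientAt

lemma hasDerivAt_line {L : Param d → ℝ} {θ v : Param d} {t : ℝ}
    (h : ContDiffAt ℝ 2 L (θ + t • v)) :
    HasDerivAt (fun s : ℝ => L (θ + s • v)) (inner ℝ (gradient L (θ + t • v)) v) t := by
  have h1 := (hasGradientAt_of_contDiffAt h).hasFDerivAt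
  have h2 : HasDerivAt (fun s : ℝ => θ + s • v) v t := by
    simpa using ((hasDerivAt_id t).smul_const v).const_add θ
  exact (h1.comp_hasDerivAt t h2).congr_deriv (by simp)

lemma hasDerivAt_inner_gradient_line {L : Param d → ℝ} {θ v : Param d} {t : ℝ}
    (h : ContDiffAt ℝ 2 L (θ + t • v)) :
    HasDerivAt (fun s : ℝ => inner ℝ (gradient L (θ + s • v)) v)
      (inner ℝ v (matOp (hessian L (θ + t • v)) v)) t := by
  have h1 := hasFDerivAt_gradient h
  have h2 : HasDerivAt (fun s : ℝ => θ + s • v) v t := by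
    simpa using ((hasDerivAt_id t).smul_const v).const_add θ
  have h3 := (h1.comp_hasDerivAt t h2).inner ℝ (hasDerivAt_const t v)
  simpa [real_inner_comm] using h3

lemma add_smul_sub_mem {Θ : Set (Param d)} (hΘ : Convex ℝ Θ) {θ₁ θ₂ : Param d} (h₁ : θ₁ ∈ Θ)
    (h₂ : θ₂ ∈ Θ) {t : ℝ} (ht : t ∈ Set.Icc (0 : ℝ) 1) : θ₁ + t • (θ₂ - θ₁) ∈ Θ :=
  hΘ.add_smul_sub_mem h₁ h₂ ht

/-- A function whose Hessian is at most `-lam` on a convex set lies below its tangent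
paraboloids. -/
lemma le_taylor_of_hessian_le {Θ : Set (Param d)} (hΘ : Convex ℝ Θ) {L : Param d → ℝ}
    (hL : ∀ θ ∈ Θ, ContDiffAt ℝ 2 L θ) {lam : ℝ}
    (hH : ∀ θ ∈ Θ, ∀ v, inner ℝ v (matOp (hessian L θ) v) ≤ -lam * ‖v‖ ^ 2)
    {θ₁ θ₂ : Param d} (h₁ : θ₁ ∈ Θ) (h₂ : θ₂ ∈ Θ) :
    L θ₂ ≤ L θ₁ + inner ℝ (gradient L θ₁) (θ₂ - θ₁) - lam / 2 * ‖θ₂ - θ₁‖ ^ 2 := by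
  set v := θ₂ - θ₁ with hv
  have mem : ∀ t ∈ Set.Icc (0 : ℝ) 1, ContDiffAt ℝ 2 L (θ₁ + t • v) := fun t ht =>
    hL _ (add_smul_sub_mem hΘ h₁ h₂ ht)
  have hd2 : ∀ t ∈ Set.Icc (0 : ℝ) 1,
      HasDerivAt (fun s : ℝ => inner ℝ (gradient L (θ₁ + s • v)) v + lam * ‖v‖ ^ 2 * s)
        (inner ℝ v (matOp (hessian L (θ₁ + t • v)) v) + lam * ‖v‖ ^ 2) t := fun t ht => by
    exact ((hasDerivAt_inner_gradient_line (mem t ht)).add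
      ((hasDerivAt_id t).const_mul (lam * ‖v‖ ^ 2))).congr_deriv (by simp)
  -- Two monotonicity arguments replace an integral remainder: the directional derivative corrected
  -- by `lam * ‖v‖ ^ 2 * s` decreases, hence so does `L` minus its tangent parabola along the
  -- segment.
  have hanti : AntitoneOn (fun s : ℝ => inner ℝ (gradient L (θ₁ + s • v)) v + lam * ‖v‖ ^ 2 * s)
      (Set.Icc 0 1) := by
    refine antitoneOn_of_hasDerivWithinAt_nonpos (convex_Icc 0 1)
      (fun t ht => (hd2 t ht).continuousAt.continuousWithinAt)
      (fun t ht => (hd2 t (interior_subset ht)).hasDerivWithinAt) fun t ht => ?_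
    have := hH _ (add_smul_sub_mem hΘ h₁ h₂ (interior_subset ht)) v
    linarith
  have hd1 : ∀ t ∈ Set.Icc (0 : ℝ) 1,
      HasDerivAt (fun s : ℝ => L (θ₁ + s • v) - inner ℝ (gradient L θ₁) v * s
          + lam / 2 * ‖v‖ ^ 2 * s ^ 2)
        (inner ℝ (gradient L (θ₁ + t • v)) v - inner ℝ (gradient L θ₁) v
          + lam * ‖v‖ ^ 2 * t) t := fun t ht => by
    refine (((hasDerivAt_line (mem t ht)).sub
      ((hasDerivAt_id t).const_mul (inner ℝ (gradient L θ₁) v))).add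
      (((hasDerivAt_id t).pow 2).const_mul (lam / 2 * ‖v‖ ^ 2))).congr_deriv ?_
    simp
    ring
  have hanti1 : AntitoneOn (fun s : ℝ => L (θ₁ + s • v) - inner ℝ (gradient L θ₁) v * s
          + lam / 2 * ‖v‖ ^ 2 * s ^ 2) (Set.Icc 0 1) := by
    refine antitoneOn_of_hasDerivWithinAt_nonpos (convex_Icc 0 1)
      (fun t ht => (hd1 t ht).continuousAt.continuousWithinAt)
      (fun t ht => (hd1 t (interior_subset ht)).hasDerivWithinAt) fun t ht => ?_
    have ht' := interior_subset ht
    have := hanti (Set.left_mem_Icc.2 zero_le_one) ht' ht'.1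
    simp only [zero_smul, add_zero, mul_zero] at this
    linarith
  have := hanti1 (Set.left_mem_Icc.2 zero_le_one) (Set.right_mem_Icc.2 zero_le_one) zero_le_one
  have hv1 : θ₁ + v = θ₂ := by rw [hv]; abel
  simp only [zero_smul, add_zero, mul_zero, one_smul, hv1, mul_one, one_pow, sub_zero,
    zero_pow two_ne_zero] at this
  linarith

/-- A maximizer of a strongly concave function is close to any point of small gradient. -/
lemma IsArgmax.norm_sub_le {Θ : Set (Param d)} (hΘ : Convex ℝ Θ) {L : Param d → ℝ}
    (hL : ∀ θ ∈ Θ, ContDiffAt ℝ 2 L θ) {lam : ℝ} (hlam : 0 < lam)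
    (hH : ∀ θ ∈ Θ, ∀ v, inner ℝ v (matOp (hessian L θ) v) ≤ -lam * ‖v‖ ^ 2)
    {θ₁ θ₂ : Param d} (h₁ : θ₁ ∈ Θ) (h₂ : IsArgmax Θ L θ₂) :
    ‖θ₂ - θ₁‖ ≤ 2 / lam * ‖gradient L θ₁‖ := by
  -- Only `L θ₁ ≤ L θ₂` is used, not a first order condition, so the maximizer may lie on the
  -- boundary of `Θ`. The quadratic loss cannot exceed the linear gain.
  have h := le_taylor_of_hessian_le hΘ hL hH h₁ h₂.1
  have h3 : L θ₁ ≤ L θ₂ := h₂.2 h₁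
  have h4 := real_inner_le_norm (gradient L θ₁) (θ₂ - θ₁)
  rcases (norm_nonneg (θ₂ - θ₁)).eq_or_lt with h0 | h0
  · rw [← h0]; positivity
  rw [div_mul_eq_mul_div, le_div_iff₀ hlam]
  refine le_of_mul_le_mul_left ?_ h0
  nlinarith

lemma IsArgmax.gradient_eq_zero {Θ : Set (Param d)} {L : Param d → ℝ} {θ : Param d}
    (h : IsArgmax Θ L θ) (hθ : Θ ∈ 𝓝 θ) : gradient L θ = 0 := by
  have := (h.2.isLocalMax hθ).fderiv_eq_zero
  rw [gradient, this, map_zero]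

/-- On `Θ` the function `L` is twice continuously differentiable, and its first two derivatives
and their Lipschitz constants are at most `G`. -/
structure SmoothBound (Θ : Set (Param d)) (L : Param d → ℝ) (G : ℝ) : Prop where
  contDiffAt : ∀ θ ∈ Θ, ContDiffAt ℝ 2 L θ
  norm_gradient_le : ∀ θ ∈ Θ, ‖gradient L θ‖ ≤ G
  abs_hessian_le : ∀ θ ∈ Θ, ∀ j k, |hessian L θ j k| ≤ G
  gradient_lip : ∀ θ₁ ∈ Θ, ∀ θ₂ ∈ Θ, ‖gradient L θ₁ - gradient L θ₂‖ ≤ G * ‖θ₁ - θ₂‖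
  hessian_lip : ∀ θ₁ ∈ Θ, ∀ θ₂ ∈ Θ, ∀ j k,
    |hessian L θ₁ j k - hessian L θ₂ j k| ≤ G * ‖θ₁ - θ₂‖

lemma norm_gradient_sub_le {Θ : Set (Param d)} (hΘ : Convex ℝ Θ) {L : Param d → ℝ}
    (hL : ∀ θ ∈ Θ, ContDiffAt ℝ 2 L θ) {a : ℝ} (ha : 0 ≤ a)
    (hH : ∀ θ ∈ Θ, ∀ j k, |hessian L θ j k| ≤ a)
    {θ₁ θ₂ : Param d} (h₁ : θ₁ ∈ Θ) (h₂ : θ₂ ∈ Θ) :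
    ‖gradient L θ₁ - gradient L θ₂‖ ≤ d * a * ‖θ₁ - θ₂‖ :=
  hΘ.norm_image_sub_le_of_norm_hasFDerivWithin_le
    (fun θ hθ => (hasFDerivAt_gradient (hL θ hθ)).hasFDerivWithinAt)
    (fun θ hθ => norm_matOp_le (hH θ hθ) ha) h₂ h₁

/-- The mean value inequality on the segment from `θ₁` to `θ₂`, whose points are no farther from
`θ₁` than `θ₂` is. This produces the remainder of the linearized score equation. -/
lemma norm_gradient_sub_sub_le {Θ : Set (Param d)} (hΘ : Convex ℝ Θ) {L : Param d → ℝ}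
    (hL : ∀ θ ∈ Θ, ContDiffAt ℝ 2 L θ) {M : Matrix (Fin d) (Fin d) ℝ} {θ₁ θ₂ : Param d}
    (h₁ : θ₁ ∈ Θ) (h₂ : θ₂ ∈ Θ) {a : ℝ} (ha : 0 ≤ a)
    (hM : ∀ θ ∈ Θ, ‖θ - θ₁‖ ≤ ‖θ₂ - θ₁‖ → ∀ j k, |hessian L θ j k - M j k| ≤ a) :
    ‖gradient L θ₂ - gradient L θ₁ - matOp M (θ₂ - θ₁)‖ ≤ d * a * ‖θ₂ - θ₁‖ := by
  have hseg : segment ℝ θ₁ θ₂ ⊆ Θ := hΘ.segment_subset h₁ h₂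
  refine (convex_segment (𝕜 := ℝ) θ₁ θ₂).norm_image_sub_le_of_norm_hasFDerivWithin_le'
    (f' := fun θ => matOp (hessian L θ))
    (fun θ hθ => (hasFDerivAt_gradient (hL θ (hseg hθ))).hasFDerivWithinAt)
    (fun θ hθ => ?_) (left_mem_segment ℝ θ₁ θ₂) (right_mem_segment ℝ θ₁ θ₂)
  rw [← map_sub]
  refine norm_matOp_le (hM θ (hseg hθ) ?_) ha
  rw [segment_eq_image'] at hθ
  obtain ⟨t, ht, rfl⟩ := hθ
  simp only [add_sub_cancel_left, norm_smul, Real.norm_eq_abs, abs_of_nonneg ht.1]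
  exact mul_le_of_le_one_left (norm_nonneg _) ht.2

namespace SmoothBound

variable {Θ : Set (Param d)} {L : Param d → ℝ} {G : ℝ}

lemma nonneg (h : SmoothBound Θ L G) (hne : Θ.Nonempty) : 0 ≤ G := by
  obtain ⟨θ, hθ⟩ := hne
  exact (norm_nonneg _).trans (h.norm_gradient_le θ hθ)

/-- The mean value theorem and the Lipschitz gradient; the constant `G` in place of `G / 2` is not
sharp but suffices for a limit along small steps. -/
lemma taylor_le (h : SmoothBound Θ L G) (hΘ : Convex ℝ Θ) {θ₁ θ₂ : Param d}
    (h₁ : θ₁ ∈ Θ) (h₂ : θ₂ ∈ Θ) :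
    L θ₁ + inner ℝ (gradient L θ₁) (θ₂ - θ₁) - G * ‖θ₂ - θ₁‖ ^ 2 ≤ L θ₂ := by
  have hG := h.nonneg ⟨θ₁, h₁⟩
  set v := θ₂ - θ₁ with hv
  have hd : ∀ t ∈ Set.Icc (0 : ℝ) 1,
      HasDerivAt (fun s : ℝ => L (θ₁ + s • v)) (inner ℝ (gradient L (θ₁ + t • v)) v) t :=
    fun t ht => hasDerivAt_line (h.contDiffAt _ (add_smul_sub_mem hΘ h₁ h₂ ht))
  obtain ⟨t, ht, hslope⟩ := exists_hasDerivAt_eq_slope (fun s : ℝ => L (θ₁ + s • v)) _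
    zero_lt_one (fun t ht => (hd t ht).continuousAt.continuousWithinAt)
    (fun t ht => hd t (Set.Ioo_subset_Icc_self ht))
  have ht' := Set.Ioo_subset_Icc_self ht
  have h3 := h.gradient_lip _ (add_smul_sub_mem hΘ h₁ h₂ ht') θ₁ h₁
  rw [← hv, add_sub_cancel_left, norm_smul, Real.norm_eq_abs, abs_of_nonneg ht'.1] at h3
  have h4 : ‖gradient L (θ₁ + t • v) - gradient L θ₁‖ ≤ G * ‖v‖ :=
    h3.trans (mul_le_mul_of_nonneg_left (mul_le_of_le_one_left (norm_nonneg _) ht'.2) hG)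
  have h5 := abs_le.1 (abs_real_inner_le_norm (gradient L (θ₁ + t • v) - gradient L θ₁) v)
  rw [inner_sub_left] at h5
  have hv1 : θ₁ + v = θ₂ := by rw [hv]; abel
  simp only [zero_smul, add_zero, one_smul, hv1, sub_zero, div_one] at hslope
  have := mul_le_mul_of_nonneg_right h4 (norm_nonneg v)
  nlinarith [h5.1]

end SmoothBound

/-! ### Derivatives and envelopes of weighted sums -/

section WeightedSum

variable {ι : Type*} [Fintype ι] {Θ : Set (Param d)} {L : ι → Param d → ℝ} (c : ι → ℝ)

lemma contDiffAt_weightedSum {θ : Param d} (h : ∀ i, ContDiffAt ℝ 2 (L i) θ) :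
    ContDiffAt ℝ 2 (fun θ => ∑ i, c i * L i θ) θ :=
  ContDiffAt.sum fun i _ => contDiffAt_const.mul (h i)

lemma fderiv_weightedSum {θ : Param d} (h : ∀ i, ContDiffAt ℝ 2 (L i) θ) :
    fderiv ℝ (fun θ => ∑ i, c i * L i θ) θ = ∑ i, c i • fderiv ℝ (L i) θ := by
  have := HasFDerivAt.fun_sum (u := Finset.univ) fun i _ =>
    (((h i).differentiableAt (by norm_num)).hasFDerivAt.const_mul (c i))
  exact this.fderiv

lemma gradient_weightedSum {θ : Param d} (h : ∀ i, ContDiffAt ℝ 2 (L i) θ) :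
    gradient (fun θ => ∑ i, c i * L i θ) θ = ∑ i, c i • gradient (L i) θ := by
  simp only [gradient, fderiv_weightedSum c h, map_sum, map_smul]

lemma hessian_weightedSum {θ : Param d} (h : ∀ i, ContDiffAt ℝ 2 (L i) θ) :
    hessian (fun θ => ∑ i, c i * L i θ) θ = ∑ i, c i • hessian (L i) θ := by
  -- A second derivative at `θ` needs the formula for the first one in a neighbourhood, which holds
  -- since being twice continuously differentiable at a point is an open condition.
  have h1 : ∀ᶠ θ' in 𝓝 θ, ∀ i, ContDiffAt ℝ 2 (L i) θ' :=
    eventually_all.2 fun i => (h i).eventually (by simp)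
  have h2 : fderiv ℝ (fun θ => ∑ i, c i * L i θ) =ᶠ[𝓝 θ] fun θ => ∑ i, c i • fderiv ℝ (L i) θ := by
    filter_upwards [h1] with θ' h' using fderiv_weightedSum c h'
  have h3 : fderiv ℝ (fun θ => ∑ i, c i • fderiv ℝ (L i) θ) θ
      = ∑ i, c i • fderiv ℝ (fderiv ℝ (L i)) θ := by
    have := HasFDerivAt.fun_sum (u := Finset.univ) fun i _ =>
      ((((h i).fderiv_right (m := 1) (by norm_num)).differentiableAt
        (by norm_num)).hasFDerivAt.const_smul (c i))
    exact this.fderiv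
  ext j k
  simp only [hessian, Matrix.of_apply, h2.fderiv_eq, h3, _root_.sum_apply,
    _root_.smul_apply, Matrix.sum_apply, Matrix.smul_apply]

lemma SmoothBound.weightedSum {G : ι → ℝ} (hc : ∀ i, 0 ≤ c i)
    (h : ∀ i, SmoothBound Θ (L i) (G i)) :
    SmoothBound Θ (fun θ => ∑ i, c i * L i θ) (∑ i, c i * G i) where
  contDiffAt θ hθ := contDiffAt_weightedSum c fun i => (h i).contDiffAt θ hθ
  norm_gradient_le θ hθ := by
    rw [gradient_weightedSum c fun i => (h i).contDiffAt θ hθ]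
    refine norm_sum_le_of_le _ fun i _ => ?_
    rw [norm_smul, Real.norm_eq_abs, abs_of_nonneg (hc i)]
    exact mul_le_mul_of_nonneg_left ((h i).norm_gradient_le θ hθ) (hc i)
  abs_hessian_le θ hθ j k := by
    rw [hessian_weightedSum c fun i => (h i).contDiffAt θ hθ, Matrix.sum_apply]
    refine (Finset.abs_sum_le_sum_abs _ _).trans (Finset.sum_le_sum fun i _ => ?_)
    rw [Matrix.smul_apply, smul_eq_mul, abs_mul, abs_of_nonneg (hc i)]
    exact mul_le_mul_of_nonneg_left ((h i).abs_hessian_le θ hθ j k) (hc i)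
  gradient_lip θ₁ h₁ θ₂ h₂ := by
    rw [gradient_weightedSum c fun i => (h i).contDiffAt θ₁ h₁,
      gradient_weightedSum c fun i => (h i).contDiffAt θ₂ h₂, ← Finset.sum_sub_distrib,
      Finset.sum_mul]
    refine norm_sum_le_of_le _ fun i _ => ?_
    rw [← smul_sub, norm_smul, Real.norm_eq_abs, abs_of_nonneg (hc i), mul_assoc]
    exact mul_le_mul_of_nonneg_left ((h i).gradient_lip θ₁ h₁ θ₂ h₂) (hc i)
  hessian_lip θ₁ h₁ θ₂ h₂ j k := by
    rw [hessian_weightedSum c fun i => (h i).contDiffAt θ₁ h₁,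
      hessian_weightedSum c fun i => (h i).contDiffAt θ₂ h₂, Matrix.sum_apply, Matrix.sum_apply,
      ← Finset.sum_sub_distrib, Finset.sum_mul]
    refine (Finset.abs_sum_le_sum_abs _ _).trans (Finset.sum_le_sum fun i _ => ?_)
    rw [Matrix.smul_apply, Matrix.smul_apply, smul_eq_mul, smul_eq_mul, ← mul_sub, abs_mul,
      abs_of_nonneg (hc i), mul_assoc]
    exact mul_le_mul_of_nonneg_left ((h i).hessian_lip θ₁ h₁ θ₂ h₂ j k) (hc i)

end WeightedSum

end Calculus

/-! Averages of independent copies -/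

section Averages

variable {X : Type*} [MeasurableSpace X] {Q : Measure X} [IsProbabilityMeasure Q]

lemma integral_avg_pi {Y : X → ℝ} (hY : Integrable Y Q) {m : ℕ} (hm : 0 < m) :
    ∫ ω, (m : ℝ)⁻¹ * ∑ i, Y (ω i) ∂(Measure.pi fun _ : Fin m => Q) = ∫ x, Y x ∂Q := by
  rw [integral_const_mul, integral_finsetSum _ fun i _ => integrable_comp_eval hY]
  have : ∀ i : Fin m, ∫ ω, Y (ω i) ∂(Measure.pi fun _ : Fin m => Q) = ∫ x, Y x ∂Q :=
    fun i => integral_comp_eval (μ := fun _ : Fin m => Q) hY.aestronglyMeasurable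
  simp only [this, Finset.sum_const, Finset.card_univ, Fintype.card_fin, nsmul_eq_mul]
  field_simp

lemma integrable_avg_pi {Y : X → ℝ} (hY : Integrable Y Q) (m : ℕ) :
    Integrable (fun ω => (m : ℝ)⁻¹ * ∑ i, Y (ω i)) (Measure.pi fun _ : Fin m => Q) :=
  (integrable_finsetSum _ fun _ _ => integrable_comp_eval hY).const_mul _

/-- Chebyshev's inequality with a bound that sees `Q` only through `C`. Later `Q` is a resampling
law that varies with the data, so this uniformity is essential. -/
lemma measure_abs_avg_sub_ge_le {Y : X → ℝ} (hY : MemLp Y 2 Q) {C : ℝ} (hC : ∫ x, Y x ^ 2 ∂Q ≤ C)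
    {m : ℕ} (hm : 0 < m) {η : ℝ} (hη : 0 < η) :
    (Measure.pi fun _ : Fin m => Q) {ω | η ≤ |(m : ℝ)⁻¹ * ∑ i, Y (ω i) - ∫ x, Y x ∂Q|}
      ≤ ENNReal.ofReal (C / (m * η ^ 2)) := by
  have hY1 : Integrable Y Q := hY.integrable (by norm_num)
  have hmem : MemLp (fun ω => (m : ℝ)⁻¹ * ∑ i, Y (ω i)) 2 (Measure.pi fun _ : Fin m => Q) :=
    (memLp_finsetSum _ fun i _ =>
      hY.comp_measurePreserving (measurePreserving_eval (fun _ : Fin m => Q) i)).const_mul _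
  have h := meas_ge_le_variance_div_sq hmem hη
  rw [integral_avg_pi hY1 hm] at h
  refine h.trans (ENNReal.ofReal_le_ofReal ?_)
  have hvar : Var[fun ω => (m : ℝ)⁻¹ * ∑ i, Y (ω i); Measure.pi fun _ : Fin m => Q]
      = (m : ℝ)⁻¹ * Var[Y; Q] := by
    rw [variance_const_mul]
    have := variance_sum_pi (μ := fun _ : Fin m => Q) (X := fun _ => Y) fun _ => hY
    have h2 : (∑ i, fun ω : Fin m → X => Y (ω i)) = fun ω => ∑ i, Y (ω i) := by
      ext ω; simp
    rw [h2] at this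
    rw [this]
    simp only [Finset.sum_const, Finset.card_univ, Fintype.card_fin, nsmul_eq_mul]
    field_simp
  rw [hvar]
  have h3 : Var[Y; Q] ≤ C := (variance_le_expectation_sq hY.aestronglyMeasurable).trans
    (by simpa using hC)
  have hm' : (0 : ℝ) < m := by exact_mod_cast hm
  rw [div_le_div_iff₀ (by positivity) (by positivity)]
  calc (m : ℝ)⁻¹ * Var[Y; Q] * (m * η ^ 2) = Var[Y; Q] * η ^ 2 := by field_simp
    _ ≤ C * η ^ 2 := by gcongr

lemma measure_avg_ge_le {Y : X → ℝ} (hY : Integrable Y Q) (hY0 : ∀ x, 0 ≤ Y x)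
    {m : ℕ} (hm : 0 < m) {a : ℝ} (ha : 0 < a) :
    (Measure.pi fun _ : Fin m => Q) {ω | a ≤ (m : ℝ)⁻¹ * ∑ i, Y (ω i)}
      ≤ ENNReal.ofReal ((∫ x, Y x ∂Q) / a) := by
  have h := mul_meas_ge_le_integral_of_nonneg
    (μ := Measure.pi fun _ : Fin m => Q) (f := fun ω => (m : ℝ)⁻¹ * ∑ i, Y (ω i))
    (ae_of_all _ fun ω => mul_nonneg (by positivity) (Finset.sum_nonneg fun i _ => hY0 _))
    (integrable_avg_pi hY m) a
  rw [integral_avg_pi hY hm] at h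
  rw [← ofReal_measureReal]
  exact ENNReal.ofReal_le_ofReal ((le_div_iff₀' ha).2 h)

/-- One half of the weak law of large numbers. -/
lemma tendsto_measure_avg_gt {Y : X → ℝ} (hY : Integrable Y Q) (hY0 : ∀ x, 0 ≤ Y x) {a : ℝ}
    (ha : ∫ x, Y x ∂Q < a) :
    Tendsto (fun m : ℕ => (Measure.pi fun _ : Fin m => Q) {ω | a < (m : ℝ)⁻¹ * ∑ i, Y (ω i)})
      atTop (𝓝 0) := by
  set e := (a - ∫ x, Y x ∂Q) / 2 with he
  have he0 : 0 < e := by simp only [he]; linarith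
  rw [ENNReal.tendsto_nhds_zero]
  intro δ' hδ'
  obtain ⟨δ, hδ, hδδ⟩ : ∃ δ : ℝ, 0 < δ ∧ ENNReal.ofReal δ ≤ δ' := by
    rcases eq_or_ne δ' ⊤ with rfl | h
    · exact ⟨1, one_pos, le_top⟩
    · exact ⟨δ'.toReal, ENNReal.toReal_pos hδ'.ne' h, ENNReal.ofReal_toReal_le⟩
  have hlim : Tendsto (fun K : ℕ => ∫ x, (Y x - min (Y x) K) ∂Q) atTop (𝓝 0) := by
    have := tendsto_integral_of_dominated_convergence (μ := Q)
      (F := fun (K : ℕ) x => Y x - min (Y x) K) (f := fun _ => 0) Y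
      (fun K => (hY.sub (hY.inf (integrable_const _))).aestronglyMeasurable) hY
      (fun K => ae_of_all _ fun x => by
        have h1 : min (Y x) (K : ℝ) ≤ Y x := min_le_left _ _
        have h2 : 0 ≤ min (Y x) (K : ℝ) := le_min (hY0 x) (by positivity)
        rw [Real.norm_eq_abs, abs_of_nonneg (by linarith)]
        linarith)
      (ae_of_all _ fun x => by
        refine tendsto_const_nhds.congr' ?_
        obtain ⟨N, hN⟩ := exists_nat_ge (Y x)
        filter_upwards [eventually_ge_atTop N] with K hK
        have : Y x ≤ K := hN.trans (by exact_mod_cast hK)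
        rw [min_eq_left this, sub_self])
    simpa using this
  -- Truncation, because `Y` need not have a variance (it will be a square `G ^ 2`). The discarded
  -- part has mean below `e * (δ / 2)`, so Markov bounds its event by `δ / 2`; the bounded part is
  -- left to Chebyshev.
  obtain ⟨K, hK⟩ := ((tendsto_order.1 hlim).2 (e * (δ / 2)) (by positivity)).exists
  have hmin : MemLp (fun x => min (Y x) (K : ℝ)) 2 Q := by
    refine MemLp.of_bound (hY.inf (integrable_const _)).aestronglyMeasurable (K : ℝ)
      (ae_of_all _ fun x => ?_)
    rw [Real.norm_eq_abs, abs_of_nonneg (le_min (hY0 x) (by positivity))]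
    exact min_le_right _ _
  set D := ∫ x, (min (Y x) (K : ℝ)) ^ 2 ∂Q with hD
  have hsmall : ∀ᶠ m : ℕ in atTop, D / (m * e ^ 2) ≤ δ / 2 := by
    have : Tendsto (fun m : ℕ => D / (m * e ^ 2)) atTop (𝓝 0) :=
      tendsto_const_nhds.div_atTop (tendsto_natCast_atTop_atTop.atTop_mul_const (by positivity))
    exact (this.eventually (gt_mem_nhds (show (0 : ℝ) < δ / 2 by positivity))).mono
      fun _ h => h.le
  filter_upwards [hsmall, eventually_gt_atTop 0] with m hm hm0
  have hint : Integrable (fun x => Y x - min (Y x) (K : ℝ)) Q :=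
    hY.sub (hmin.integrable (by norm_num))
  have hsub : {ω : Fin m → X | a < (m : ℝ)⁻¹ * ∑ i, Y (ω i)}
      ⊆ {ω | e ≤ (m : ℝ)⁻¹ * ∑ i, (Y (ω i) - min (Y (ω i)) (K : ℝ))}
        ∪ {ω | e ≤ |(m : ℝ)⁻¹ * ∑ i, min (Y (ω i)) (K : ℝ) - ∫ x, min (Y x) (K : ℝ) ∂Q|} := by
    intro ω hω
    by_contra hcon
    simp only [Set.mem_union, Set.mem_ofPred_eq, not_or, not_le, Finset.sum_sub_distrib,
      mul_sub] at hcon hω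
    have h1 := (abs_lt.1 hcon.2).2
    have h2 : ∫ x, min (Y x) (K : ℝ) ∂Q ≤ ∫ x, Y x ∂Q :=
      integral_mono (hmin.integrable (by norm_num)) hY fun x => min_le_left _ _
    linarith [hcon.1]
  refine (measure_mono hsub).trans ((measure_union_le _ _).trans ?_)
  refine le_trans ?_ hδδ
  rw [show δ = δ / 2 + δ / 2 by ring, ENNReal.ofReal_add (by positivity) (by positivity)]
  gcongr
  · refine (measure_avg_ge_le hint (fun x => sub_nonneg.2 (min_le_left _ _)) hm0 he0).trans ?_
    refine ENNReal.ofReal_le_ofReal ?_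
    rw [div_le_iff₀ he0]
    linarith
  · exact (measure_abs_avg_sub_ge_le hmin le_rfl hm0 he0).trans (ENNReal.ofReal_le_ofReal hm)

/-- Chebyshev's inequality for vector averages. -/
lemma measure_norm_avg_ge_le {d : ℕ} {s : X → Param d} {G : X → ℝ} (hG : MemLp G 2 Q) {C : ℝ}
    (hC : ∫ x, G x ^ 2 ∂Q ≤ C) (hs : AEStronglyMeasurable s Q) (hsG : ∀ᵐ x ∂Q, ‖s x‖ ≤ G x)
    (hs0 : ∫ x, s x ∂Q = 0) {m : ℕ} (hm : 0 < m) {η : ℝ} (hη : 0 < η) :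
    (Measure.pi fun _ : Fin m => Q) {ω | η < ‖(m : ℝ)⁻¹ • ∑ i, s (ω i)‖}
      ≤ ENNReal.ofReal (d ^ 2 * C / (m * η ^ 2)) := by
  rcases Nat.eq_zero_or_pos d with rfl | hd
  · have : {ω : Fin m → X | η < ‖(m : ℝ)⁻¹ • ∑ i, s (ω i)‖} = ∅ := by
      ext ω
      simp [Subsingleton.elim ((m : ℝ)⁻¹ • ∑ i, s (ω i)) 0, hη.le]
    rw [this]; simp
  have hd' : (0 : ℝ) < d := by exact_mod_cast hd
  have hsL : MemLp s 2 Q := hG.mono hs (hsG.mono fun x hx => hx.trans (le_abs_self _))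
  have hcoord : ∀ j, MemLp (fun x => s x j) 2 Q := fun j =>
    hG.mono ((EuclideanSpace.proj (𝕜 := ℝ) j).continuous.comp_aestronglyMeasurable hs)
      (hsG.mono fun x hx => ((PiLp.norm_apply_le (s x) j).trans hx).trans (le_abs_self _))
  have hcoord0 : ∀ j, ∫ x, s x j ∂Q = 0 := fun j => by
    have := (EuclideanSpace.proj (𝕜 := ℝ) j).integral_comp_comm (hsL.integrable (by norm_num))
    rw [hs0] at this
    simpa using this
  have hcoordC : ∀ j, ∫ x, (s x j) ^ 2 ∂Q ≤ C := fun j => by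
    refine le_trans (integral_mono_ae (hcoord j).integrable_sq hG.integrable_sq ?_) hC
    filter_upwards [hsG] with x hx
    have := (PiLp.norm_apply_le (s x) j).trans hx
    exact sq_le_sq' (neg_le_of_abs_le this) (le_of_abs_le this)
  -- If every coordinate is below `η / √d`, the norm is at most `η`. The union over `d` coordinates
  -- and the squared `√d` give the factor `d ^ 2`.
  have hsub : {ω : Fin m → X | η < ‖(m : ℝ)⁻¹ • ∑ i, s (ω i)‖}
      ⊆ ⋃ j ∈ (Finset.univ : Finset (Fin d)),
        {ω | η / Real.sqrt d ≤ |(m : ℝ)⁻¹ * ∑ i, s (ω i) j - ∫ x, s x j ∂Q|} := by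
    intro ω hω
    by_contra hcon
    simp only [Set.mem_iUnion, Set.mem_ofPred_eq, not_exists, not_le, Finset.mem_univ,
      hcoord0, sub_zero, forall_true_left] at hcon hω
    refine absurd hω (not_lt.2 ?_)
    refine (pow_le_pow_iff_left₀ (by positivity) hη.le two_ne_zero).1 ?_
    rw [EuclideanSpace.real_norm_sq_eq]
    have : ∀ j, (((m : ℝ)⁻¹ • ∑ i, s (ω i)) j) ^ 2 ≤ η ^ 2 / d := fun j => by
      have h1 := hcon j
      have h2 : ((m : ℝ)⁻¹ • ∑ i, s (ω i)) j = (m : ℝ)⁻¹ * ∑ i, s (ω i) j := by simp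
      rw [h2, ← sq_abs]
      calc _ ≤ (η / Real.sqrt d) ^ 2 := by gcongr
        _ = η ^ 2 / d := by rw [div_pow, Real.sq_sqrt hd'.le]
    refine (Finset.sum_le_sum fun j _ => this j).trans ?_
    simp only [Finset.sum_const, Finset.card_univ, Fintype.card_fin, nsmul_eq_mul]
    rw [mul_div_cancel₀ _ hd'.ne']
  refine (measure_mono hsub).trans ((measure_biUnion_finset_le _ _).trans ?_)
  refine (Finset.sum_le_sum fun j _ => measure_abs_avg_sub_ge_le (hcoord j) (hcoordC j) hm
    (by positivity)).trans ?_
  have hC0 : 0 ≤ C := le_trans (integral_nonneg fun x => sq_nonneg _) hC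
  rw [Finset.sum_const, Finset.card_univ, Fintype.card_fin, ← ENNReal.ofReal_nsmul]
  refine ENNReal.ofReal_le_ofReal (le_of_eq ?_)
  rw [div_pow, Real.sq_sqrt hd'.le, nsmul_eq_mul]
  field_simp

end Averages

/-- A uniform law of large numbers on a compact set, with a rate which depends on the class of
functions only through the second moment of its envelope. -/
lemma exists_measure_uniform_avg_le {T : Type*} [PseudoMetricSpace T] {S : Set T}
    (hS : IsCompact S) {C : ℝ} (hC : 0 ≤ C) {η : ℝ} (hη : 0 < η) :
    ∃ B : ℝ, ∀ {X : Type} [MeasurableSpace X] (Q : Measure X) [IsProbabilityMeasure Q]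
      (h : X → T → ℝ) (G : X → ℝ), MemLp G 2 Q → ∫ x, G x ^ 2 ∂Q ≤ C →
      (∀ θ ∈ S, AEStronglyMeasurable (fun x => h x θ) Q) →
      (∀ᵐ x ∂Q, (∀ θ ∈ S, |h x θ| ≤ G x) ∧
        ∀ θ₁ ∈ S, ∀ θ₂ ∈ S, |h x θ₁ - h x θ₂| ≤ G x * dist θ₁ θ₂) →
      ∀ m : ℕ, 0 < m →
        (Measure.pi fun _ : Fin m => Q)
          {ω | ∃ θ ∈ S, η < |(m : ℝ)⁻¹ * ∑ i, h (ω i) θ - ∫ x, h x θ ∂Q|}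
        ≤ ENNReal.ofReal (B / m) := by
  -- Off the exceptional events the empirical mean of `G` is below `C + 2` and its expectation is at
  -- most `C + 1`, so moving to a net point at distance below `ρ` costs at most `(2 * C + 3) * ρ = η
  -- / 2`.
  set ρ := η / (2 * (2 * C + 3)) with hρ
  have hρ0 : 0 < ρ := by positivity
  obtain ⟨t, htS, htf, hcov⟩ := hS.finite_cover_balls hρ0
  lift t to Finset T using htf
  -- One Chebyshev bound at level `η / 2` for each net point, and one at level `1` for the average
  -- of `G`. The net depends on `S`, `C` and `η` only, so the constant is fixed before the law and
  -- the functions.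
  refine ⟨t.card * (C / (η / 2) ^ 2) + C, ?_⟩
  intro X _ Q _ h G hG hGC hmeas hreg m hm
  have hm' : (0 : ℝ) < m := by exact_mod_cast hm
  have hG1 : Integrable G Q := hG.integrable (by norm_num)
  have hLp : ∀ θ ∈ S, MemLp (fun x => h x θ) 2 Q := fun θ hθ =>
    hG.mono (hmeas θ hθ) (hreg.mono fun x hx => (hx.1 θ hθ).trans (le_abs_self _))
  have hsq : ∀ θ ∈ S, ∫ x, h x θ ^ 2 ∂Q ≤ C := fun θ hθ => by
    refine le_trans (integral_mono_ae (hLp θ hθ).integrable_sq hG.integrable_sq ?_) hGC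
    filter_upwards [hreg] with x hx
    exact sq_le_sq' (neg_le_of_abs_le (hx.1 θ hθ)) (le_of_abs_le (hx.1 θ hθ))
  have hEG : ∫ x, G x ∂Q ≤ C + 1 := by
    calc ∫ x, G x ∂Q ≤ ∫ x, (G x ^ 2 + 1) ∂Q :=
          integral_mono hG1 (hG.integrable_sq.add (integrable_const _)) fun x => by
            dsimp only; nlinarith [sq_nonneg (G x - 1)]
      _ = ∫ x, G x ^ 2 ∂Q + 1 := by
          rw [integral_add hG.integrable_sq (integrable_const _)]; simp
      _ ≤ C + 1 := by linarith
  have hae : ∀ᵐ ω ∂(Measure.pi fun _ : Fin m => Q), ∀ i, (∀ θ ∈ S, |h (ω i) θ| ≤ G (ω i)) ∧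
        ∀ θ₁ ∈ S, ∀ θ₂ ∈ S, |h (ω i) θ₁ - h (ω i) θ₂| ≤ G (ω i) * dist θ₁ θ₂ :=
    ae_all_iff.2 fun i => (measurePreserving_eval (fun _ : Fin m => Q) i).quasiMeasurePreserving.ae
      hreg
  have hsub : ∀ᵐ ω ∂(Measure.pi fun _ : Fin m => Q),
      ω ∈ {ω : Fin m → X | ∃ θ ∈ S, η < |(m : ℝ)⁻¹ * ∑ i, h (ω i) θ - ∫ x, h x θ ∂Q|} →
      ω ∈ (⋃ θ ∈ t, {ω | η / 2 ≤ |(m : ℝ)⁻¹ * ∑ i, h (ω i) θ - ∫ x, h x θ ∂Q|})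
        ∪ {ω | 1 ≤ |(m : ℝ)⁻¹ * ∑ i, G (ω i) - ∫ x, G x ∂Q|} := by
    filter_upwards [hae] with ω hω
    rintro ⟨θ, hθ, hlt⟩
    by_contra hcon
    simp only [Set.mem_union, Set.mem_iUnion, Set.mem_ofPred_eq, not_or, not_exists,
      not_le] at hcon
    obtain ⟨θ', hθ', hdist⟩ : ∃ θ' ∈ t, dist θ θ' < ρ := by
      simpa using hcov hθ
    have hθS : θ' ∈ S := htS hθ'
    have hA := hcon.1 θ' hθ'
    have hGavg : (m : ℝ)⁻¹ * ∑ i, G (ω i) < C + 2 := by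
      have := (abs_lt.1 hcon.2).2
      linarith
    have h1 : |(m : ℝ)⁻¹ * ∑ i, h (ω i) θ - (m : ℝ)⁻¹ * ∑ i, h (ω i) θ'|
        ≤ ((m : ℝ)⁻¹ * ∑ i, G (ω i)) * dist θ θ' := by
      rw [← mul_sub, ← Finset.sum_sub_distrib, abs_mul, abs_of_pos (inv_pos.2 hm'), mul_assoc,
        Finset.sum_mul]
      refine mul_le_mul_of_nonneg_left ?_ (by positivity)
      exact (Finset.abs_sum_le_sum_abs _ _).trans
        (Finset.sum_le_sum fun i _ => (hω i).2 θ hθ θ' hθS)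
    have h2 : |∫ x, h x θ ∂Q - ∫ x, h x θ' ∂Q| ≤ (∫ x, G x ∂Q) * dist θ θ' := by
      rw [← integral_sub ((hLp θ hθ).integrable (by norm_num))
        ((hLp θ' hθS).integrable (by norm_num)), ← integral_mul_const]
      rw [← Real.norm_eq_abs]
      refine norm_integral_le_of_norm_le (hG1.mul_const _) ?_
      exact hreg.mono fun x hx => hx.2 θ hθ θ' hθS
    have hd0 := dist_nonneg (x := θ) (y := θ')
    have h3 : ((m : ℝ)⁻¹ * ∑ i, G (ω i)) * dist θ θ' ≤ (C + 2) * ρ :=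
      mul_le_mul hGavg.le hdist.le hd0 (by linarith)
    have h4 : (∫ x, G x ∂Q) * dist θ θ' ≤ (C + 1) * ρ :=
      mul_le_mul hEG hdist.le hd0 (by linarith)
    have h5 : (C + 2) * ρ + (C + 1) * ρ = η / 2 := by
      rw [hρ]; field_simp; ring
    have e1 := abs_le.1 (h1.trans h3)
    have e2 := abs_le.1 (h2.trans h4)
    have e3 := abs_lt.1 hA
    refine absurd hlt (not_lt.2 (abs_le.2 ⟨?_, ?_⟩)) <;> linarith [e1.1, e1.2, e2.1, e2.2, e3.1, e3.2]
  refine (measure_mono_ae hsub).trans ((measure_union_le _ _).trans ?_)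
  rw [add_div, ENNReal.ofReal_add (by positivity) (by positivity)]
  gcongr
  · refine (measure_biUnion_finset_le _ _).trans ?_
    refine (Finset.sum_le_sum fun θ hθ => measure_abs_avg_sub_ge_le (hLp θ (htS hθ))
      (hsq θ (htS hθ)) hm (half_pos hη)).trans ?_
    rw [Finset.sum_const, ← ENNReal.ofReal_nsmul, nsmul_eq_mul]
    refine ENNReal.ofReal_le_ofReal (le_of_eq ?_)
    field_simp
  · refine (measure_abs_avg_sub_ge_le hG hGC hm one_pos).trans (le_of_eq ?_)
    simp

/-! Weighted subsampling from a finite population -/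

/-- `p` is a probability vector whose entries are at least `ξ / n`. -/
structure IsMixedProb (ξ : ℝ) {n : ℕ} (p : Fin n → ℝ) : Prop where
  le : ∀ i, ξ / n ≤ p i
  sum_eq_one : ∑ i, p i = 1

/-- The average of the functions `L i`. -/
def avgObj {d n : ℕ} (L : Fin n → Param d → ℝ) (θ : Param d) : ℝ := ∑ i, (n : ℝ)⁻¹ * L i θ

/-- The inverse probability weighted average of the functions `L i` over a subsample. -/
def subObj {d n r : ℕ} (p : Fin n → ℝ) (L : Fin n → Param d → ℝ) (K : Fin r → Fin n)
    (θ : Param d) : ℝ :=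
  ∑ k, ((r : ℝ)⁻¹ * (n * p (K k))⁻¹) * L (K k) θ

section Draw

variable {n : ℕ} {p : Fin n → ℝ}

lemma isProbabilityMeasure_drawLaw (hp : ∀ i, 0 ≤ p i) (h : ∑ i, p i = 1) :
    IsProbabilityMeasure (drawLaw p) := by
  constructor
  simp only [drawLaw, Measure.finsetSum_apply, Measure.smul_apply, smul_eq_mul, measure_univ,
    mul_one]
  rw [← ENNReal.ofReal_sum_of_nonneg fun i _ => hp i, h, ENNReal.ofReal_one]

lemma integral_drawLaw {E : Type*} [NormedAddCommGroup E] [NormedSpace ℝ E] [CompleteSpace E]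
    (hp : ∀ i, 0 ≤ p i) (f : Fin n → E) : ∫ i, f i ∂(drawLaw p) = ∑ i, p i • f i := by
  have : ∀ i, IsFiniteMeasure (ENNReal.ofReal (p i) • Measure.dirac i) := fun i =>
    Measure.smul_finite _ ENNReal.ofReal_ne_top
  rw [drawLaw, integral_finsetSum_measure fun i _ => Integrable.of_finite]
  refine Finset.sum_congr rfl fun i _ => ?_
  rw [integral_smul_measure, integral_dirac, ENNReal.toReal_ofReal (hp i)]

namespace IsMixedProb

variable {ξ : ℝ}

lemma pos (h : IsMixedProb ξ p) (hξ : 0 < ξ) (i : Fin n) : 0 < p i :=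
  lt_of_lt_of_le (div_pos hξ (by exact_mod_cast i.pos)) (h.le i)

lemma isProbabilityMeasure (h : IsMixedProb ξ p) (hξ : 0 < ξ) :
    IsProbabilityMeasure (drawLaw p) :=
  isProbabilityMeasure_drawLaw (fun i => (h.pos hξ i).le) h.sum_eq_one

lemma mul_pos (h : IsMixedProb ξ p) (hξ : 0 < ξ) (i : Fin n) : 0 < n * p i :=
  _root_.mul_pos (by exact_mod_cast i.pos) (h.pos hξ i)

lemma inv_le (h : IsMixedProb ξ p) (hξ : 0 < ξ) (i : Fin n) : (n * p i)⁻¹ ≤ ξ⁻¹ := by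
  have hn : (0 : ℝ) < n := by exact_mod_cast i.pos
  refine inv_anti₀ hξ ?_
  have := h.le i
  rwa [div_le_iff₀' hn] at this

lemma mul_inv (h : IsMixedProb ξ p) (hξ : 0 < ξ) (i : Fin n) :
    p i * (n * p i)⁻¹ = (n : ℝ)⁻¹ := by
  have hn : (0 : ℝ) < n := by exact_mod_cast i.pos
  have := (h.pos hξ i).ne'
  field_simp

/-- Inverse probability weighting is unbiased, whatever the probabilities: `p i` cancels in `p i *
(n * p i)⁻¹`. -/
lemma integral_weighted {E : Type*} [NormedAddCommGroup E] [NormedSpace ℝ E] [CompleteSpace E]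
    (h : IsMixedProb ξ p) (hξ : 0 < ξ) (f : Fin n → E) :
    ∫ i, (n * p i)⁻¹ • f i ∂(drawLaw p) = ∑ i, (n : ℝ)⁻¹ • f i := by
  rw [integral_drawLaw fun i => (h.pos hξ i).le]
  exact Finset.sum_congr rfl fun i _ => by rw [smul_smul, h.mul_inv hξ]

/-- Of the two weight factors in the square, one is cancelled by `p i`; the other is at most `ξ⁻¹`
thanks to the floor `ξ / n`. This is where mixing with the uniform distribution pays off. -/
lemma integral_weighted_sq_le (h : IsMixedProb ξ p) (hξ : 0 < ξ) {G : Fin n → ℝ} {C : ℝ}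
    (hG : (n : ℝ)⁻¹ * ∑ i, G i ^ 2 ≤ C) :
    ∫ i, ((n * p i)⁻¹ * G i) ^ 2 ∂(drawLaw p) ≤ ξ⁻¹ * C := by
  rw [integral_drawLaw fun i => (h.pos hξ i).le]
  refine le_trans ?_ (mul_le_mul_of_nonneg_left hG (inv_nonneg.2 hξ.le))
  rw [Finset.mul_sum, Finset.mul_sum]
  refine Finset.sum_le_sum fun i _ => ?_
  calc p i • ((n * p i)⁻¹ * G i) ^ 2 = (p i * (n * p i)⁻¹) * (n * p i)⁻¹ * G i ^ 2 := by
        rw [smul_eq_mul]; ring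
    _ = (n : ℝ)⁻¹ * (n * p i)⁻¹ * G i ^ 2 := by rw [h.mul_inv hξ]
    _ ≤ (n : ℝ)⁻¹ * ξ⁻¹ * G i ^ 2 := by
        have := h.inv_le hξ i
        gcongr
    _ = ξ⁻¹ * ((n : ℝ)⁻¹ * G i ^ 2) := by ring

end IsMixedProb

/-- With this the uniform pilot subsample is a special case of weighted subsampling, and no separate
argument is needed for it. -/
lemma isMixedProb_uniform {ξ : ℝ} (hξ : ξ ≤ 1) (hn : 0 < n) :
    IsMixedProb ξ fun _ : Fin n => (n : ℝ)⁻¹ where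
  le i := by rw [div_eq_mul_inv]; exact mul_le_of_le_one_left (by positivity) hξ
  sum_eq_one := by
    have : (n : ℝ) ≠ 0 := by exact_mod_cast hn.ne'
    simp [this]

end Draw

/-! ### Subsample objectives: Hessians, gradients and maximizers -/

section Population

variable {d n r : ℕ} {Θ : Set (Param d)} {L : Fin n → Param d → ℝ} {G : Fin n → ℝ}
  {p : Fin n → ℝ} {ξ : ℝ}

lemma gradient_avgObj (hL : ∀ i, SmoothBound Θ (L i) (G i)) {θ : Param d} (hθ : θ ∈ Θ) :
    gradient (avgObj L) θ = ∑ i, (n : ℝ)⁻¹ • gradient (L i) θ :=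
  gradient_weightedSum _ fun i => (hL i).contDiffAt θ hθ

lemma hessian_avgObj (hL : ∀ i, SmoothBound Θ (L i) (G i)) {θ : Param d} (hθ : θ ∈ Θ) :
    hessian (avgObj L) θ = ∑ i, (n : ℝ)⁻¹ • hessian (L i) θ :=
  hessian_weightedSum _ fun i => (hL i).contDiffAt θ hθ

lemma gradient_subObj (hL : ∀ i, SmoothBound Θ (L i) (G i)) {θ : Param d} (hθ : θ ∈ Θ)
    (K : Fin r → Fin n) :
    gradient (subObj p L K) θ
      = (r : ℝ)⁻¹ • ∑ k, (n * p (K k))⁻¹ • gradient (L (K k)) θ := by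
  simp only [Finset.smul_sum, smul_smul]
  exact gradient_weightedSum _ fun k => (hL (K k)).contDiffAt θ hθ

lemma hessian_subObj (hL : ∀ i, SmoothBound Θ (L i) (G i)) {θ : Param d} (hθ : θ ∈ Θ)
    (K : Fin r → Fin n) (j k : Fin d) :
    hessian (subObj p L K) θ j k
      = (r : ℝ)⁻¹ * ∑ l, (n * p (K l))⁻¹ * hessian (L (K l)) θ j k := by
  have := hessian_weightedSum (fun l => (r : ℝ)⁻¹ * (n * p (K l))⁻¹)
    (fun l => (hL (K l)).contDiffAt θ hθ)
  change hessian (fun θ => ∑ l, ((r : ℝ)⁻¹ * (n * p (K l))⁻¹) * L (K l) θ) θ j k = _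
  rw [this, Matrix.sum_apply, Finset.mul_sum]
  exact Finset.sum_congr rfl fun l _ => by rw [Matrix.smul_apply, smul_eq_mul, mul_assoc]

/-- The uniform law of large numbers for the law of one draw, applied to each matrix entry. `B`
precedes the population and its size `n`, so the bound requires no link between `r` and `n`. -/
lemma exists_drawsLaw_hessian_le (hΘ : IsCompact Θ) {C η : ℝ} (hC : 0 ≤ C) (hξ : 0 < ξ)
    (hη : 0 < η) :
    ∃ B : ℝ, ∀ {n : ℕ} {L : Fin n → Param d → ℝ} {G : Fin n → ℝ} {p : Fin n → ℝ},
      IsMixedProb ξ p → (∀ i, SmoothBound Θ (L i) (G i)) → (n : ℝ)⁻¹ * ∑ i, G i ^ 2 ≤ C →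
      ∀ r : ℕ, 0 < r →
        drawsLaw r p {K | ∃ θ ∈ Θ, ∃ j k,
          η < |hessian (subObj p L K) θ j k - hessian (avgObj L) θ j k|} ≤ ENNReal.ofReal (B / r) := by
  obtain ⟨B, hB⟩ := exists_measure_uniform_avg_le hΘ
    (mul_nonneg (inv_nonneg.2 hξ.le) hC) hη
  refine ⟨(d * d : ℕ) * B, fun {n L G p} hp hL hG r hr => ?_⟩
  have := hp.isProbabilityMeasure hξ
  have hsub : {K : Fin r → Fin n | ∃ θ ∈ Θ, ∃ j k,
      η < |hessian (subObj p L K) θ j k - hessian (avgObj L) θ j k|}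
      ⊆ ⋃ q ∈ (Finset.univ : Finset (Fin d × Fin d)), {K | ∃ θ ∈ Θ,
        η < |(r : ℝ)⁻¹ * ∑ l, (n * p (K l))⁻¹ * hessian (L (K l)) θ q.1 q.2
          - ∫ i, (n * p i)⁻¹ * hessian (L i) θ q.1 q.2 ∂(drawLaw p)|} := by
    rintro K ⟨θ, hθ, j, k, h⟩
    simp only [Set.mem_iUnion, Finset.mem_univ, exists_true_left]
    refine ⟨(j, k), θ, hθ, ?_⟩
    have h2 := hp.integral_weighted hξ fun i => hessian (L i) θ j k
    simp only [smul_eq_mul] at h2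
    rw [hessian_subObj hL hθ, hessian_avgObj hL hθ, Matrix.sum_apply] at h
    simp only [Matrix.smul_apply, smul_eq_mul] at h
    rw [h2]
    exact h
  refine (measure_mono hsub).trans ((measure_biUnion_finset_le _ _).trans ?_)
  have key : ∀ q : Fin d × Fin d, drawsLaw r p {K | ∃ θ ∈ Θ,
        η < |(r : ℝ)⁻¹ * ∑ l, (n * p (K l))⁻¹ * hessian (L (K l)) θ q.1 q.2
          - ∫ i, (n * p i)⁻¹ * hessian (L i) θ q.1 q.2 ∂(drawLaw p)|} ≤ ENNReal.ofReal (B / r) := by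
    intro q
    refine hB (drawLaw p) (fun i θ => (n * p i)⁻¹ * hessian (L i) θ q.1 q.2)
      (fun i => (n * p i)⁻¹ * G i) MemLp.of_discrete (hp.integral_weighted_sq_le hξ hG)
      (fun θ _ => (measurable_of_finite _).aestronglyMeasurable)
      (ae_of_all _ fun i => ⟨fun θ hθ => ?_, fun θ₁ h₁ θ₂ h₂ => ?_⟩) r hr
    · rw [abs_mul, abs_of_nonneg (inv_nonneg.2 (hp.mul_pos hξ i).le)]
      exact mul_le_mul_of_nonneg_left ((hL i).abs_hessian_le θ hθ _ _)
        (inv_nonneg.2 (hp.mul_pos hξ i).le)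
    · rw [← mul_sub, abs_mul, abs_of_nonneg (inv_nonneg.2 (hp.mul_pos hξ i).le), mul_assoc,
        dist_eq_norm]
      exact mul_le_mul_of_nonneg_left ((hL i).hessian_lip θ₁ h₁ θ₂ h₂ _ _)
        (inv_nonneg.2 (hp.mul_pos hξ i).le)
  refine (Finset.sum_le_sum fun q _ => key q).trans ?_
  rw [Finset.sum_const, ← ENNReal.ofReal_nsmul, nsmul_eq_mul, Finset.card_univ,
    Fintype.card_prod, Fintype.card_fin, mul_div_assoc]

/-- At a stationary point of the full objective the weighted gradients are centred by unbiasedness,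
so Chebyshev gives size `r ^ (-1/2)`. -/
lemma drawsLaw_gradient_le {C η : ℝ} (hξ : 0 < ξ) (hη : 0 < η) (hp : IsMixedProb ξ p)
    (hL : ∀ i, SmoothBound Θ (L i) (G i)) (hG : (n : ℝ)⁻¹ * ∑ i, G i ^ 2 ≤ C) {θ : Param d}
    (hθ : θ ∈ Θ) (h0 : gradient (avgObj L) θ = 0) (hr : 0 < r) :
    drawsLaw r p {K | η < ‖gradient (subObj p L K) θ‖}
      ≤ ENNReal.ofReal (d ^ 2 * (ξ⁻¹ * C) / (r * η ^ 2)) := by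
  have := hp.isProbabilityMeasure hξ
  have h := measure_norm_avg_ge_le (Q := drawLaw p) (s := fun i => (n * p i)⁻¹ • gradient (L i) θ)
    (G := fun i => (n * p i)⁻¹ * G i) MemLp.of_discrete (hp.integral_weighted_sq_le hξ hG)
    (measurable_of_finite _).aestronglyMeasurable
    (ae_of_all _ fun i => ?_) (by
      rw [hp.integral_weighted hξ, ← h0, gradient_avgObj hL hθ]) hr hη
  · simpa only [gradient_subObj hL hθ, drawsLaw] using h
  · rw [norm_smul, Real.norm_eq_abs, abs_of_nonneg (inv_nonneg.2 (hp.mul_pos hξ i).le)]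
    exact mul_le_mul_of_nonneg_left ((hL i).norm_gradient_le θ hθ)
        (inv_nonneg.2 (hp.mul_pos hξ i).le)

/-- A matrix with entries close to those of a negative definite one is negative definite. -/
lemma inner_matOp_le_of_abs_sub_le {A B : Matrix (Fin d) (Fin d) ℝ} {lam : ℝ} (hd : 0 < d)
    (hB : ∀ v, inner ℝ v (matOp B v) ≤ -lam * ‖v‖ ^ 2)
    (hAB : ∀ j k, |A j k - B j k| ≤ lam / (2 * d)) (v : Param d) :
    inner ℝ v (matOp A v) ≤ -(lam / 2) * ‖v‖ ^ 2 := by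
  have h := abs_inner_matOp_le (A := A - B) (a := lam / (2 * d)) hAB v v
  have hd' : (0 : ℝ) < d := by exact_mod_cast hd
  rw [show (d : ℝ) * (lam / (2 * d)) * ‖v‖ * ‖v‖ = lam / 2 * ‖v‖ ^ 2 by field_simp,
    show matOp (A - B) = matOp A - matOp B from map_sub _ _ _, _root_.sub_apply,
    inner_sub_right] at h
  have := hB v
  linarith [(abs_le.1 h).2]

/-- The maximizer of the weighted subsample objective is within a constant times the gradient of
the objective, outside an event of small probability. -/
lemma exists_drawsLaw_argmax_le (hd : 0 < d) (hΘ : IsCompact Θ) (hconv : Convex ℝ Θ) {C lam ε : ℝ}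
    (hC : 0 ≤ C) (hξ : 0 < ξ) (hlam : 0 < lam) (hε : 0 < ε) :
    ∃ B : ℝ, ∀ {n : ℕ} {L : Fin n → Param d → ℝ} {G : Fin n → ℝ} {p : Fin n → ℝ} {θ : Param d},
      IsMixedProb ξ p → (∀ i, SmoothBound Θ (L i) (G i)) → (n : ℝ)⁻¹ * ∑ i, G i ^ 2 ≤ C →
      (∀ θ ∈ Θ, ∀ v, inner ℝ v (matOp (hessian (avgObj L) θ) v) ≤ -lam * ‖v‖ ^ 2) →
      θ ∈ Θ → gradient (avgObj L) θ = 0 →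
      ∀ r : ℕ, 0 < r → ∀ est : (Fin r → Fin n) → Param d,
        (∀ K, IsArgmax Θ (subObj p L K) (est K)) →
        drawsLaw r p {K | ε < ‖est K - θ‖} ≤ ENNReal.ofReal (B / r) := by
  obtain ⟨B, hB⟩ := exists_drawsLaw_hessian_le (d := d) hΘ (η := lam / (2 * d)) hC hξ
    (by positivity)
  -- The subsample objective is only `lam / 2`-concave, so a gradient of norm `η` allows an error of
  -- `2 / (lam / 2) * η = ε`.
  set η := ε * (lam / 4) with hη
  have hη0 : 0 < η := by positivity
  refine ⟨|B| + d ^ 2 * (ξ⁻¹ * C) / η ^ 2, ?_⟩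
  intro n L G p θ hp hL hG hH hθ h0 r hr est hest
  have hsub : {K : Fin r → Fin n | ε < ‖est K - θ‖} ⊆
      {K | ∃ θ ∈ Θ, ∃ j k, lam / (2 * d) <
        |hessian (subObj p L K) θ j k - hessian (avgObj L) θ j k|}
      ∪ {K | η < ‖gradient (subObj p L K) θ‖} := by
    intro K hK
    by_contra hcon
    simp only [Set.mem_union, Set.mem_ofPred_eq, not_or, not_exists, not_and, not_lt] at hcon hK
    have : ‖est K - θ‖ ≤ 2 / (lam / 2) * ‖gradient (subObj p L K) θ‖ :=
      (hest K).norm_sub_le hconv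
      (fun θ hθ => contDiffAt_weightedSum _ fun k => (hL (K k)).contDiffAt θ hθ)
      (by positivity)
      (fun θ' hθ' v => inner_matOp_le_of_abs_sub_le hd (hH θ' hθ')
        (fun j k => hcon.1 θ' hθ' j k) v) hθ
    have h2 : 2 / (lam / 2) * ‖gradient (subObj p L K) θ‖ ≤ 2 / (lam / 2) * η :=
      mul_le_mul_of_nonneg_left hcon.2 (by positivity)
    have h3 : 2 / (lam / 2) * η = ε := by rw [hη]; field_simp; norm_num
    linarith
  refine (measure_mono hsub).trans ((measure_union_le _ _).trans ?_)
  rw [add_div, ENNReal.ofReal_add (by positivity) (by positivity)]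
  gcongr
  · refine (hB hp hL hG r hr).trans (ENNReal.ofReal_le_ofReal ?_)
    gcongr
    exact le_abs_self B
  · refine (drawsLaw_gradient_le hξ hη0 hp hL hG hθ h0 hr).trans (le_of_eq ?_)
    congr 1
    field_simp

end Population

/-! The Kullback-Leibler inequality for censored and truncated lifetimes -/

section Lifetime

variable {g g₀ : ℝ → ℝ} {ν : Measure (EReal × ℝ)}

lemma IsLifetimeDensity.isProbabilityMeasure (hg : IsLifetimeDensity g) :
    IsProbabilityMeasure (lifetimeLaw g) := by
  constructor
  rw [lifetimeLaw, withDensity_apply _ MeasurableSet.univ, Measure.restrict_univ,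
    hg.lintegral_eq_one]

/-- The probability that a lifetime with density `g` exceeds `c`. -/
def survival (g : ℝ → ℝ) (c : EReal) : ENNReal := lifetimeLaw g {T : ℝ | c < (T : EReal)}

lemma measurableSet_lt_coe (c : EReal) : MeasurableSet {T : ℝ | c < (T : EReal)} :=
  measurableSet_lt measurable_const measurable_coe_real_ereal

lemma IsLifetimeDensity.measurable_survival (hg : IsLifetimeDensity g) :
    Measurable (survival g) := by
  have := hg.isProbabilityMeasure
  exact measurable_measure_prodMk_left (ν := lifetimeLaw g)
    (s := {q : EReal × ℝ | q.1 < (q.2 : EReal)})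
    (measurableSet_lt measurable_fst (measurable_coe_real_ereal.comp measurable_snd))

lemma IsLifetimeDensity.one_sub_lifetimeCDF (hg : IsLifetimeDensity g) (t : ℝ) :
    ENNReal.ofReal (1 - lifetimeCDF g t) = survival g t := by
  have := hg.isProbabilityMeasure
  have h1 : lifetimeCDF g t = (lifetimeLaw g).real (Set.Iic t) := by
    rw [lifetimeCDF, integral_eq_lintegral_of_nonneg_ae (ae_of_all _ hg.nonneg)
      hg.measurable.aestronglyMeasurable, lifetimeLaw, measureReal_def,
      withDensity_apply _ measurableSet_Iic]
  have h2 : {T : ℝ | (t : EReal) < (T : EReal)} = (Set.Iic t)ᶜ := by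
    ext T; simp
  rw [h1, survival, h2, ← probReal_compl_eq_one_sub measurableSet_Iic, ofReal_measureReal]

lemma measurable_record : Measurable record := by
  refine Measurable.ite (measurableSet_le (measurable_coe_real_ereal.comp measurable_fst)
    measurable_snd.fst) ?_ ?_
  · exact measurable_fst.prodMk (measurable_const.prodMk measurable_snd.snd)
  · exact (measurable_ereal_toReal.comp measurable_snd.fst).prodMk
      (measurable_const.prodMk measurable_snd.snd)

lemma measurableSet_observed : MeasurableSet {z : ℝ × EReal × ℝ | z.2.2 < z.1} :=
  measurableSet_lt measurable_snd.snd measurable_fst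

/-- The likelihood ratio of one record. -/
def likRatio (g g₀ : ℝ → ℝ) (x : Obs) : ENNReal :=
  (if x.2.1 then survival g x.1 / survival g₀ x.1
    else ENNReal.ofReal (g x.1) / ENNReal.ofReal (g₀ x.1))
    * (survival g₀ x.2.2 / survival g x.2.2)

lemma measurable_likRatio (hg : IsLifetimeDensity g) (hg₀ : IsLifetimeDensity g₀) :
    Measurable (likRatio g g₀) := by
  have hS := hg.measurable_survival.comp measurable_coe_real_ereal
  have hS₀ := hg₀.measurable_survival.comp measurable_coe_real_ereal
  refine Measurable.mul (Measurable.ite ?_ ?_ ?_) ?_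
  · exact measurable_snd.fst (measurableSet_singleton true)
  · exact (hS.comp measurable_fst).div (hS₀.comp measurable_fst)
  · exact (hg.measurable.comp measurable_fst).ennreal_ofReal.div
      (hg₀.measurable.comp measurable_fst).ennreal_ofReal
  · exact (hS₀.comp measurable_snd.snd).div (hS.comp measurable_snd.snd)

/-- With `(c, a)` fixed, failures in `(a, c]` contribute at most their probability under `g`, and
censored units at most the probability under `g` of exceeding `c`. Together these make `survival g
a`, which the truncation factor converts into `survival g₀ a`. Only inequalities hold, since
denominators may vanish. -/
lemma lintegral_likRatio_record_le (hg : IsLifetimeDensity g) (hg₀ : IsLifetimeDensity g₀)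
    {c : EReal} {a : ℝ} (hac : (a : EReal) ≤ c) :
    ∫⁻ T in {T : ℝ | (a : EReal) < T}, likRatio g g₀ (record (T, c, a)) ∂(lifetimeLaw g₀)
      ≤ survival g₀ a := by
  have := hg.isProbabilityMeasure
  have hset : {T : ℝ | (a : EReal) < T} = {T : ℝ | (a : EReal) < T ∧ (T : EReal) ≤ c}
      ∪ {T : ℝ | c < T} := by
    ext T
    simp only [Set.mem_union, Set.mem_ofPred_eq]
    constructor
    · intro h
      rcases le_or_gt (T : EReal) c with h2 | h2
      · exact Or.inl ⟨h, h2⟩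
      · exact Or.inr h2
    · rintro (h | h)
      · exact h.1
      · exact hac.trans_lt h
  have hdisj : Disjoint {T : ℝ | (a : EReal) < T ∧ (T : EReal) ≤ c} {T : ℝ | c < T} :=
    Set.disjoint_left.2 fun T h h' => absurd h' (not_lt.2 h.2)
  have hm1 : MeasurableSet {T : ℝ | (a : EReal) < T ∧ (T : EReal) ≤ c} :=
    (measurableSet_lt_coe _).inter (measurableSet_le measurable_coe_real_ereal measurable_const)
  set κ := survival g₀ a / survival g a with hκ
  have h1 : ∫⁻ T in {T : ℝ | (a : EReal) < T ∧ (T : EReal) ≤ c},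
      likRatio g g₀ (record (T, c, a)) ∂(lifetimeLaw g₀)
      ≤ lifetimeLaw g {T : ℝ | (a : EReal) < T ∧ (T : EReal) ≤ c} * κ := by
    calc _ = ∫⁻ T in {T : ℝ | (a : EReal) < T ∧ (T : EReal) ≤ c},
          ENNReal.ofReal (g T) / ENNReal.ofReal (g₀ T) * κ ∂(lifetimeLaw g₀) := by
          refine setLIntegral_congr_fun hm1 fun T hT => ?_
          simp [record, likRatio, hT.2, hκ]
      _ = (∫⁻ T in {T : ℝ | (a : EReal) < T ∧ (T : EReal) ≤ c},
          ENNReal.ofReal (g T) / ENNReal.ofReal (g₀ T) ∂(lifetimeLaw g₀)) * κ :=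
          lintegral_mul_const _
            (hg.measurable.ennreal_ofReal.div hg₀.measurable.ennreal_ofReal)
      _ ≤ _ := by
          gcongr
          rw [lifetimeLaw, restrict_withDensity hm1, lifetimeLaw, withDensity_apply _ hm1]
          refine (lintegral_withDensity_eq_lintegral_mul _ hg₀.measurable.ennreal_ofReal
            (hg.measurable.ennreal_ofReal.div hg₀.measurable.ennreal_ofReal)).trans_le ?_
          refine lintegral_mono fun T => ?_
          exact ENNReal.mul_div_le
  have h2 : ∫⁻ T in {T : ℝ | c < T}, likRatio g g₀ (record (T, c, a)) ∂(lifetimeLaw g₀)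
      ≤ survival g c * κ := by
    calc _ = ∫⁻ T in {T : ℝ | c < T}, survival g c / survival g₀ c * κ ∂(lifetimeLaw g₀) := by
          refine setLIntegral_congr_fun (measurableSet_lt_coe _) fun T hT => ?_
          have hT' : ¬ (T : EReal) ≤ c := not_le.2 hT
          -- `c < T` excludes `⊤` and `a ≤ c` excludes `⊥`, so the real censoring time in the record
          -- loses nothing.
          have hc : (c.toReal : EReal) = c :=
            EReal.coe_toReal (ne_top_of_lt hT) (ne_bot_of_le_ne_bot (EReal.coe_ne_bot a) hac)
          simp [record, likRatio, hT', hκ, hc]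
      _ = survival g c / survival g₀ c * κ * survival g₀ c := by
          rw [setLIntegral_const]; rfl
      _ = (survival g₀ c * (survival g c / survival g₀ c)) * κ := by ring
      _ ≤ _ := by gcongr; exact ENNReal.mul_div_le
  rw [hset, lintegral_union (measurableSet_lt_coe _) hdisj]
  calc _ ≤ _ := add_le_add h1 h2
    _ = survival g a * κ := by
        rw [← add_mul, survival, survival, ← measure_union hdisj (measurableSet_lt_coe _), ← hset]
    _ ≤ survival g₀ a := ENNReal.mul_div_le

/-- Independence allows the lifetime to be integrated out first, with `(c, a)` fixed; the remaining
integral of `survival g₀ a` is the probability of being observed, which the conditioning divides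
out. -/
lemma lintegral_likRatio_le_one (hg : IsLifetimeDensity g) (hg₀ : IsLifetimeDensity g₀)
    [IsProbabilityMeasure ν] (hν : ∀ᵐ z ∂ν, (z.2 : EReal) ≤ z.1) :
    ∫⁻ x, likRatio g g₀ x ∂(obsLaw g₀ ν) ≤ 1 := by
  have := hg₀.isProbabilityMeasure
  have hR := measurable_likRatio hg hg₀
  set A := {z : ℝ × EReal × ℝ | z.2.2 < z.1} with hA
  have hAm : MeasurableSet A := measurableSet_observed
  rw [obsLaw, lintegral_map hR measurable_record, ProbabilityTheory.cond, lintegral_smul_measure,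
    smul_eq_mul]
  have key : ∫⁻ z in A, likRatio g g₀ (record z) ∂((lifetimeLaw g₀).prod ν)
      ≤ ((lifetimeLaw g₀).prod ν) A := by
    have hm : Measurable (A.indicator fun z => likRatio g g₀ (record z)) :=
      (hR.comp measurable_record).indicator hAm
    rw [← lintegral_indicator hAm, lintegral_prod_symm _ hm.aemeasurable, Measure.prod_apply_symm hAm]
    refine lintegral_mono_ae ?_
    filter_upwards [hν] with y hy
    have hsec : (fun T : ℝ => (T, y)) ⁻¹' A = {T : ℝ | ((y.2 : ℝ) : EReal) < T} := by
      ext T; simp [hA]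
    calc _ = ∫⁻ T in {T : ℝ | ((y.2 : ℝ) : EReal) < T}, likRatio g g₀ (record (T, y.1, y.2))
          ∂(lifetimeLaw g₀) := by
          rw [← lintegral_indicator (measurableSet_lt_coe _)]
          refine lintegral_congr fun T => ?_
          by_cases hT : y.2 < T
          · simp [Set.indicator, hA, hT]
          · simp [Set.indicator, hA, hT]
      _ ≤ survival g₀ y.2 := lintegral_likRatio_record_le hg hg₀ hy
      _ = _ := by rw [hsec]; rfl
  calc _ ≤ (((lifetimeLaw g₀).prod ν) A)⁻¹ * ((lifetimeLaw g₀).prod ν) A := by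
        gcongr
    _ ≤ 1 := ENNReal.inv_mul_le_one _

/-- `LikPos` keeps every logarithm away from its default value at nonpositive arguments, so the
exponential of the difference is the genuine likelihood ratio. -/
lemma ofReal_exp_logLik_sub {d : ℕ} {f : Param d → ℝ → ℝ} {θ θ₀ : Param d}
    (hg : IsLifetimeDensity (f θ)) (hg₀ : IsLifetimeDensity (f θ₀)) {x : Obs}
    (h : LikPos f x θ) (h₀ : LikPos f x θ₀) :
    ENNReal.ofReal (Real.exp (logLik f x θ - logLik f x θ₀)) = likRatio (f θ) (f θ₀) x := by
  obtain ⟨t, C, tl⟩ := x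
  have key : ∀ a b a' b' : ℝ, 0 < a → 0 < b → 0 < a' → 0 < b' →
      ENNReal.ofReal (Real.exp ((Real.log a - Real.log b) - (Real.log a' - Real.log b')))
        = ENNReal.ofReal a / ENNReal.ofReal a' * (ENNReal.ofReal b' / ENNReal.ofReal b) := by
    intro a b a' b' ha hb ha' hb'
    rw [← ENNReal.ofReal_div_of_pos ha', ← ENNReal.ofReal_div_of_pos hb,
      ← ENNReal.ofReal_mul (by positivity), Real.exp_sub, Real.exp_sub, Real.exp_sub,
      Real.exp_log ha, Real.exp_log hb, Real.exp_log ha', Real.exp_log hb']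
    congr 1
    field_simp
  rcases C with _ | _
  · simp only [LikPos, Bool.false_eq_true, if_false] at h h₀
    simp only [logLik, likRatio, Bool.false_eq_true, if_false, ← hg.one_sub_lifetimeCDF,
      ← hg₀.one_sub_lifetimeCDF]
    exact key _ _ _ _ h.1 h.2 h₀.1 h₀.2
  · simp only [LikPos, if_true] at h h₀
    simp only [logLik, likRatio, if_true, ← hg.one_sub_lifetimeCDF,
      ← hg₀.one_sub_lifetimeCDF]
    exact key _ _ _ _ h.1 h.2 h₀.1 h₀.2

/-- The Kullback-Leibler inequality. -/
lemma integral_logLik_le {d : ℕ} {f : Param d → ℝ → ℝ} {θ θ₀ : Param d} [IsProbabilityMeasure ν]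
    (hν : ∀ᵐ z ∂ν, (z.2 : EReal) ≤ z.1) [IsProbabilityMeasure (obsLaw (f θ₀) ν)]
    (hg : IsLifetimeDensity (f θ)) (hg₀ : IsLifetimeDensity (f θ₀))
    (hpos : ∀ᵐ x ∂(obsLaw (f θ₀) ν), LikPos f x θ ∧ LikPos f x θ₀)
    (hint : Integrable (fun x => logLik f x θ) (obsLaw (f θ₀) ν))
    (hint₀ : Integrable (fun x => logLik f x θ₀) (obsLaw (f θ₀) ν)) :
    ∫ x, (logLik f x θ - logLik f x θ₀) ∂(obsLaw (f θ₀) ν) ≤ 0 := by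
  set μ := obsLaw (f θ₀) ν with hμ
  have hle : ∫⁻ x, ENNReal.ofReal (Real.exp (logLik f x θ - logLik f x θ₀)) ∂μ ≤ 1 := by
    refine le_trans (le_of_eq (lintegral_congr_ae ?_)) (lintegral_likRatio_le_one hg hg₀ hν)
    filter_upwards [hpos] with x hx using ofReal_exp_logLik_sub hg hg₀ hx.1 hx.2
  have hmeas : AEStronglyMeasurable (fun x => Real.exp (logLik f x θ - logLik f x θ₀)) μ :=
    Real.continuous_exp.comp_aestronglyMeasurable (hint.sub hint₀).aestronglyMeasurable
  have hexp : Integrable (fun x => Real.exp (logLik f x θ - logLik f x θ₀)) μ := by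
    refine ⟨hmeas, ?_⟩
    rw [hasFiniteIntegral_iff_ofReal (ae_of_all _ fun x => (Real.exp_pos _).le)]
    exact hle.trans_lt ENNReal.one_lt_top
  have h1 : ∫ x, Real.exp (logLik f x θ - logLik f x θ₀) ∂μ ≤ 1 := by
    rw [integral_eq_lintegral_of_nonneg_ae (ae_of_all _ fun x => (Real.exp_pos _).le) hmeas]
    exact ENNReal.toReal_le_of_le_ofReal zero_le_one (by simpa using hle)
  -- The inequality `u ≤ exp u - 1` for the log-likelihood ratio `u`, whose exponential has mean at
  -- most one.
  have h2 : ∫ x, (logLik f x θ - logLik f x θ₀) ∂μ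
      ≤ ∫ x, (Real.exp (logLik f x θ - logLik f x θ₀) - 1) ∂μ :=
    integral_mono (hint.sub hint₀) (hexp.sub (integrable_const _)) fun x => by
      have := Real.add_one_le_exp (logLik f x θ - logLik f x θ₀)
      dsimp only
      linarith
  rw [integral_sub hexp (integrable_const _)] at h2
  simp at h2
  linarith

end Lifetime

/-! Consequences of the regularity conditions for the law of one record -/

lemma inner_matOp_pos_of_posDef {d : ℕ} {A : Matrix (Fin d) (Fin d) ℝ} (hA : A.PosDef)
    {v : Param d} (hv : v ≠ 0) : 0 < inner ℝ v (matOp A v) := by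
  rw [Matrix.inner_toEuclideanCLM]
  have : v.ofLp ≠ 0 := fun h => hv (by ext i; simp [h])
  simpa using hA.dotProduct_mulVec_pos this

lemma posDef_of_inner_matOp_pos {d : ℕ} {A : Matrix (Fin d) (Fin d) ℝ} (hA : A.transpose = A)
    (h : ∀ v : Param d, v ≠ 0 → 0 < inner ℝ v (matOp A v)) : A.PosDef := by
  refine Matrix.PosDef.of_dotProduct_mulVec_pos ?_ fun x hx => ?_
  · rw [Matrix.IsHermitian, Matrix.conjTranspose_eq_transpose_of_trivial, hA]
  · have := h (WithLp.toLp 2 x) (fun h0 => hx (by simpa using congrArg WithLp.ofLp h0))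
    rw [Matrix.inner_toEuclideanCLM] at this
    simpa using this

lemma IsCompact.exists_pos_le {T : Type*} [TopologicalSpace T] {S : Set T} (hS : IsCompact S)
    {q : T → ℝ} (hq : ContinuousOn q S) (hpos : ∀ x ∈ S, 0 < q x) :
    ∃ c > 0, ∀ x ∈ S, c ≤ q x := by
  rcases S.eq_empty_or_nonempty with rfl | hne
  · exact ⟨1, one_pos, fun x hx => hx.elim⟩
  · obtain ⟨x, hx, hmin⟩ := hS.exists_isMinOn hne hq
    exact ⟨q x, hpos x hx, fun y hy => hmin hy⟩

section Population

variable {d : ℕ} {f : Param d → ℝ → ℝ} {Θ : Set (Param d)} {θ₀ : Param d} {μ : Measure Obs}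

/-- There is a square integrable envelope for the derivatives of the log-likelihood. -/
lemma exists_smoothBound (hΘ : IsCompact Θ) (hconv : Convex ℝ Θ) (hθ₀ : θ₀ ∈ Θ)
    (hsmooth : SmoothLik f Θ μ) (hhess : HessCondition f Θ μ) (hscore : ScoreCondition f Θ μ) :
    ∃ G : Obs → ℝ, MemLp G 2 μ ∧ ∀ᵐ x ∂μ, SmoothBound Θ (logLik f x) (G x) := by
  obtain ⟨ψ, hψ, hlip⟩ := hhess.lipschitz
  obtain ⟨D, hD⟩ : ∃ D, ∀ θ ∈ Θ, ‖θ - θ₀‖ ≤ D := by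
    obtain ⟨D, hD⟩ := hΘ.isBounded.subset_closedBall θ₀
    exact ⟨D, fun θ hθ => by simpa [dist_eq_norm] using hD hθ⟩
  have hD0 : 0 ≤ D := (norm_nonneg _).trans (hD θ₀ hθ₀)
  -- A bound for all Hessian entries on `Θ`: their values at `θ₀` plus the Lipschitz increment over
  -- a distance at most `D`.
  set a : Obs → ℝ := fun x => ∑ j, ∑ k, |hess f x θ₀ j k| + |ψ x| * D with ha
  have ha0 : ∀ x, 0 ≤ a x := fun x => by positivity
  have haL : MemLp a 2 μ :=
    (memLp_finsetSum _ fun j _ => memLp_finsetSum _ fun k _ => (hhess.memLp θ₀ hθ₀ j k).abs).add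
      (hψ.abs.mul_const D)
  -- The coefficient of `a x` collects `1` for the Hessian, `d` for the Lipschitz constant of the
  -- gradient, and `d * D` for the growth of the gradient away from `θ₀`; `|ψ x|` serves the
  -- Lipschitz constant of the Hessian.
  refine ⟨fun x => ‖score f x θ₀‖ + (1 + d + d * D) * a x + |ψ x|,
    ((hscore.memLp θ₀ hθ₀).norm.add (haL.const_mul _)).add hψ.abs, ?_⟩
  filter_upwards [hlip, hsmooth] with x hx hsm
  have hcd : ∀ θ ∈ Θ, ContDiffAt ℝ 2 (logLik f x) θ := fun θ hθ => (hsm θ hθ).2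
  have hH : ∀ θ ∈ Θ, ∀ j k, |hessian (logLik f x) θ j k| ≤ a x := fun θ hθ j k => by
    have h1 := hx θ hθ θ₀ hθ₀ j k
    have h2 : ψ x * ‖θ - θ₀‖ ≤ |ψ x| * D :=
      mul_le_mul (le_abs_self _) (hD θ hθ) (norm_nonneg _) (abs_nonneg _)
    have h3 : |hess f x θ₀ j k| ≤ ∑ j, ∑ k, |hess f x θ₀ j k| :=
      (Finset.single_le_sum (f := fun k => |hess f x θ₀ j k|) (fun k _ => abs_nonneg _)
        (Finset.mem_univ k)).trans
      (Finset.single_le_sum (f := fun j => ∑ k, |hess f x θ₀ j k|)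
        (fun j _ => Finset.sum_nonneg fun k _ => abs_nonneg _) (Finset.mem_univ j))
    have h4 := abs_sub_abs_le_abs_sub (hess f x θ j k) (hess f x θ₀ j k)
    change |hess f x θ j k| ≤ _
    simp only [ha]
    linarith
  have hlipg : ∀ θ₁ ∈ Θ, ∀ θ₂ ∈ Θ,
      ‖gradient (logLik f x) θ₁ - gradient (logLik f x) θ₂‖ ≤ d * a x * ‖θ₁ - θ₂‖ :=
    fun θ₁ h₁ θ₂ h₂ => norm_gradient_sub_le hconv hcd (ha0 x) hH h₁ h₂
  have hs0 := norm_nonneg (score f x θ₀)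
  have hψ0 := abs_nonneg (ψ x)
  have hd0 : (0 : ℝ) ≤ d := by positivity
  have e1 : 0 ≤ d * a x := mul_nonneg hd0 (ha0 x)
  have e2 : 0 ≤ d * D * a x := mul_nonneg (mul_nonneg hd0 hD0) (ha0 x)
  refine ⟨hcd, fun θ hθ => ?_, fun θ hθ j k => ?_, fun θ₁ h₁ θ₂ h₂ => ?_,
    fun θ₁ h₁ θ₂ h₂ j k => ?_⟩
  · have h1 := hlipg θ hθ θ₀ hθ₀
    have h2 : d * a x * ‖θ - θ₀‖ ≤ d * a x * D := mul_le_mul_of_nonneg_left (hD θ hθ) e1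
    have h3 : ‖gradient (logLik f x) θ‖ ≤ ‖score f x θ₀‖
        + ‖gradient (logLik f x) θ - gradient (logLik f x) θ₀‖ := norm_le_norm_add_norm_sub' _ _
    linarith [ha0 x]
  · have := hH θ hθ j k
    linarith
  · refine (hlipg θ₁ h₁ θ₂ h₂).trans (mul_le_mul_of_nonneg_right ?_ (norm_nonneg _))
    linarith [ha0 x]
  · refine (hx θ₁ h₁ θ₂ h₂ j k).trans (mul_le_mul_of_nonneg_right ?_ (norm_nonneg _))
    linarith [ha0 x, le_abs_self (ψ x)]

variable [IsProbabilityMeasure μ] {G : Obs → ℝ}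

/-- The expected Hessian. -/
def meanHess (f : Param d → ℝ → ℝ) (μ : Measure Obs) (θ : Param d) : Matrix (Fin d) (Fin d) ℝ :=
  Matrix.of fun j k => ∫ x, hess f x θ j k ∂μ

/-- Pointwise definiteness becomes uniform: the quadratic form is continuous and negative on the
compact set of pairs `(θ, v)` with `v` a unit vector, and homogeneity extends the bound to all `v`.
-/
lemma exists_meanHess_le (hΘ : IsCompact Θ) (hhess : HessCondition f Θ μ) (hG : MemLp G 2 μ)
    (hreg : ∀ᵐ x ∂μ, SmoothBound Θ (logLik f x) (G x)) :
    ∃ lam > 0, ∀ θ ∈ Θ, ∀ v, inner ℝ v (matOp (meanHess f μ θ) v) ≤ -lam * ‖v‖ ^ 2 := by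
  have hint : ∀ θ ∈ Θ, ∀ j k, Integrable (fun x => hess f x θ j k) μ := fun θ hθ j k =>
    (hhess.memLp θ hθ j k).integrable (by norm_num)
  have hentry : ∀ j k, ContinuousOn (fun θ => meanHess f μ θ j k) Θ := fun j k => by
    refine (LipschitzOnWith.of_dist_le_mul (K := (∫ x, |G x| ∂μ).toNNReal)
      fun θ hθ θ' hθ' => ?_).continuousOn
    rw [Real.dist_eq, Real.coe_toNNReal _ (integral_nonneg fun _ => abs_nonneg _)]
    simp only [meanHess, Matrix.of_apply]
    rw [← integral_sub (hint θ hθ j k) (hint θ' hθ' j k), ← integral_mul_const, ← Real.norm_eq_abs]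
    refine norm_integral_le_of_norm_le ((hG.abs.integrable (by norm_num)).mul_const _) ?_
    filter_upwards [hreg] with x hx
    rw [dist_eq_norm]
    exact (hx.hessian_lip θ hθ θ' hθ' j k).trans
      (mul_le_mul_of_nonneg_right (le_abs_self _) (norm_nonneg _))
  have hS : IsCompact (Θ ×ˢ Metric.sphere (0 : Param d) 1) := hΘ.prod (isCompact_sphere _ _)
  have hcont : ContinuousOn (fun q : Param d × Param d =>
      -inner ℝ q.2 (matOp (meanHess f μ q.1) q.2)) (Θ ×ˢ Metric.sphere (0 : Param d) 1) := by
    simp only [Matrix.inner_toEuclideanCLM, dotProduct, Matrix.mulVec]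
    refine ContinuousOn.neg (continuousOn_finsetSum _ fun j _ => ContinuousOn.mul (by fun_prop)
      (continuousOn_finsetSum _ fun k _ => ContinuousOn.mul ?_ (by fun_prop)))
    exact (hentry j k).comp continuousOn_fst fun q hq => hq.1
  obtain ⟨lam, hlam, hle⟩ := hS.exists_pos_le hcont (by
    rintro ⟨θ, v⟩ ⟨hθ, hv⟩
    have hv0 : v ≠ 0 := by
      rintro rfl
      simp at hv
    have := inner_matOp_pos_of_posDef (hhess.posDef θ hθ) hv0
    rw [show matOp (-(Matrix.of fun j k => ∫ x, hess f x θ j k ∂μ)) = -matOp (meanHess f μ θ) from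
      map_neg _ _] at this
    simpa using this)
  refine ⟨lam, hlam, fun θ hθ v => ?_⟩
  rcases eq_or_ne v 0 with rfl | hv
  · simp
  have hn : ‖v‖ ≠ 0 := norm_ne_zero_iff.2 hv
  have h := hle (θ, ‖v‖⁻¹ • v) ⟨hθ, by simp [norm_smul, hn]⟩
  simp only [map_smul, inner_smul_left, inner_smul_right, RCLike.conj_to_real] at h
  have h2 := mul_le_mul_of_nonneg_right h (sq_nonneg ‖v‖)
  have h3 : -(‖v‖⁻¹ * (‖v‖⁻¹ * inner ℝ v (matOp (meanHess f μ θ) v))) * ‖v‖ ^ 2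
      = -inner ℝ v (matOp (meanHess f μ θ) v) := by
    field_simp
  linarith

/-- Again compactness; positivity holds because a vanishing first absolute moment would make the
second moment vanish too. First moments are used since a square integrable envelope gives them a
uniform law of large numbers by Chebyshev. The bound serves twice: it keeps the denominator of the
sampling probabilities away from zero and bounds `Λ_{RDS}` from below. -/
lemma exists_le_integral_abs_inner_score (hΘ : IsCompact Θ) (hscore : ScoreCondition f Θ μ)
    (hG : MemLp G 2 μ) (hreg : ∀ᵐ x ∂μ, SmoothBound Θ (logLik f x) (G x)) :
    ∃ c > 0, ∀ q ∈ Metric.sphere (0 : Param d) 1 ×ˢ Θ, c ≤ ∫ x, |inner ℝ q.1 (score f x q.2)| ∂μ := by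
  have hS : IsCompact (Metric.sphere (0 : Param d) 1 ×ˢ Θ) := (isCompact_sphere _ _).prod hΘ
  have hLp : ∀ q ∈ Metric.sphere (0 : Param d) 1 ×ˢ Θ,
      MemLp (fun x => inner ℝ q.1 (score f x q.2)) 2 μ := fun q hq =>
    (hscore.memLp q.2 hq.2).const_inner q.1
  have hLi : ∀ q ∈ Metric.sphere (0 : Param d) 1 ×ˢ Θ,
      Integrable (fun x => |inner ℝ q.1 (score f x q.2)|) μ := fun q hq =>
    (hLp q hq).abs.integrable (by norm_num)
  refine hS.exists_pos_le ?_ ?_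
  · refine (LipschitzOnWith.of_dist_le_mul (K := (∫ x, 2 * |G x| ∂μ).toNNReal)
      fun q hq q' hq' => ?_).continuousOn
    rw [Real.dist_eq, Real.coe_toNNReal _ (integral_nonneg fun _ => by positivity)]
    rw [← integral_sub (hLi q hq) (hLi q' hq'), ← integral_mul_const, ← Real.norm_eq_abs]
    refine norm_integral_le_of_norm_le
      (((hG.abs.integrable (by norm_num)).const_mul 2).mul_const _) ?_
    filter_upwards [hreg] with x hx
    rw [Real.norm_eq_abs]
    refine (abs_abs_sub_abs_le_abs_sub _ _).trans ?_
    have h1 : inner ℝ q.1 (score f x q.2) - inner ℝ q'.1 (score f x q'.2)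
        = inner ℝ (q.1 - q'.1) (score f x q.2) + inner ℝ q'.1 (score f x q.2 - score f x q'.2) := by
      rw [inner_sub_left, inner_sub_right]; ring
    have h2 := abs_real_inner_le_norm (q.1 - q'.1) (score f x q.2)
    have h3 := abs_real_inner_le_norm q'.1 (score f x q.2 - score f x q'.2)
    have hq1 : ‖q'.1‖ = 1 := by simpa using hq'.1
    have d1 : ‖q.1 - q'.1‖ ≤ dist q q' := by rw [← dist_eq_norm]; exact le_max_left _ _
    have d2 : ‖q.2 - q'.2‖ ≤ dist q q' := by rw [← dist_eq_norm]; exact le_max_right _ _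
    have g1 : ‖score f x q.2‖ ≤ |G x| := (hx.norm_gradient_le _ hq.2).trans (le_abs_self _)
    have g2 : ‖score f x q.2 - score f x q'.2‖ ≤ |G x| * ‖q.2 - q'.2‖ :=
      (hx.gradient_lip _ hq.2 _ hq'.2).trans
        (mul_le_mul_of_nonneg_right (le_abs_self _) (norm_nonneg _))
    have k1 : ‖q.1 - q'.1‖ * ‖score f x q.2‖ ≤ dist q q' * |G x| :=
      mul_le_mul d1 g1 (norm_nonneg _) dist_nonneg
    have k2 : |G x| * ‖q.2 - q'.2‖ ≤ |G x| * dist q q' :=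
      mul_le_mul_of_nonneg_left d2 (abs_nonneg _)
    rw [hq1, one_mul] at h3
    rw [h1]
    refine (abs_add_le _ _).trans ?_
    linarith
  · rintro ⟨v, θ⟩ ⟨hv, hθ⟩
    have hv0 : v ≠ 0 := by
      rintro rfl
      simp at hv
    refine (integral_nonneg fun _ => abs_nonneg _).lt_of_ne fun h0 => ?_
    have hae := (integral_eq_zero_iff_of_nonneg (fun _ => abs_nonneg _)
      ((hLp (v, θ) ⟨hv, hθ⟩).abs.integrable (by norm_num))).1 h0.symm
    have hpos := inner_matOp_pos_of_posDef (hscore.posDef θ hθ) hv0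
    have hco : ∀ j, MemLp (fun x => score f x θ j) 2 μ := fun j =>
      (hscore.memLp θ hθ).mono
        ((EuclideanSpace.proj (𝕜 := ℝ) j).continuous.comp_aestronglyMeasurable
          (hscore.memLp θ hθ).aestronglyMeasurable)
        (ae_of_all _ fun x => PiLp.norm_apply_le (score f x θ) j)
    have hint : ∀ j k, Integrable (fun x => score f x θ j * score f x θ k) μ := fun j k =>
      (hco j).integrable_mul (hco k)
    have heq : inner ℝ v (matOp (Matrix.of fun j k => ∫ x, score f x θ j * score f x θ k ∂μ) v)
        = ∫ x, (inner ℝ v (score f x θ)) ^ 2 ∂μ := by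
      have : ∀ x, (inner ℝ v (score f x θ)) ^ 2
          = ∑ j, v j * ∑ k, (score f x θ j * score f x θ k) * v k := fun x => by
        rw [sq, PiLp.inner_apply, Finset.sum_mul_sum]
        refine Finset.sum_congr rfl fun j _ => ?_
        rw [Finset.mul_sum]
        refine Finset.sum_congr rfl fun k _ => ?_
        simp
        ring
      simp only [this]
      rw [integral_finsetSum _ fun j _ =>
        (integrable_finsetSum _ fun k _ => (hint j k).mul_const _).const_mul _]
      rw [Matrix.inner_toEuclideanCLM]
      simp only [dotProduct, Matrix.mulVec, Matrix.of_apply]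
      refine Finset.sum_congr rfl fun j _ => ?_
      rw [integral_const_mul, integral_finsetSum _ fun k _ => (hint j k).mul_const _]
      simp only [integral_mul_const]
    rw [heq, integral_eq_zero_of_ae] at hpos
    · exact lt_irrefl _ hpos
    · filter_upwards [hae] with x hx
      have : inner ℝ v (score f x θ) = 0 := by simpa using hx
      simp [this]

/-- If `θ₀` is an interior maximizer of the expected log-likelihood, the score has mean zero. -/
lemma integral_score_eq_zero (hconv : Convex ℝ Θ) (hθ₀ : θ₀ ∈ interior Θ) (hG : MemLp G 2 μ)
    (hreg : ∀ᵐ x ∂μ, SmoothBound Θ (logLik f x) (G x))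
    (hscore : ScoreCondition f Θ μ)
    (hlik : ∀ θ ∈ Θ, Integrable (fun x => logLik f x θ) μ)
    (hKL : ∀ θ ∈ Θ, ∫ x, (logLik f x θ - logLik f x θ₀) ∂μ ≤ 0) :
    ∫ x, score f x θ₀ ∂μ = 0 := by
  have hθ₀' := interior_subset hθ₀
  have hs : Integrable (fun x => score f x θ₀) μ := (hscore.memLp θ₀ hθ₀').integrable (by norm_num)
  have hG1 : Integrable G μ := hG.integrable (by norm_num)
  set w := ∫ x, score f x θ₀ ∂μ with hw
  -- The mean score `w` is itself the test direction: a small step `t • w` would raise the expected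
  -- log-likelihood by at least `t * ‖w‖ ^ 2` up to order `t ^ 2`, which maximality at `θ₀` forbids
  -- unless `w = 0`.
  have hev : ∀ᶠ t : ℝ in 𝓝[>] 0, θ₀ + t • w ∈ Θ := by
    have : Tendsto (fun t : ℝ => θ₀ + t • w) (𝓝 0) (𝓝 θ₀) := by
      have : Continuous fun t : ℝ => θ₀ + t • w := by fun_prop
      simpa using this.tendsto 0
    exact (this.eventually (mem_interior_iff_mem_nhds.1 hθ₀)).filter_mono nhdsWithin_le_nhds
  have hbound : ∀ᶠ t : ℝ in 𝓝[>] 0, ‖w‖ ^ 2 ≤ (∫ x, G x ∂μ) * ‖w‖ ^ 2 * t := by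
    filter_upwards [hev, self_mem_nhdsWithin] with t ht ht0
    have ht0' : (0 : ℝ) < t := ht0
    have h1 : ∫ x, (t * inner ℝ w (score f x θ₀) - t ^ 2 * ‖w‖ ^ 2 * G x) ∂μ
        ≤ ∫ x, (logLik f x (θ₀ + t • w) - logLik f x θ₀) ∂μ := by
      refine integral_mono_ae (((hs.const_inner w).const_mul t).sub (hG1.const_mul _))
        ((hlik _ ht).sub (hlik _ hθ₀')) ?_
      filter_upwards [hreg] with x hx
      have := hx.taylor_le hconv hθ₀' ht
      rw [add_sub_cancel_left, inner_smul_right, norm_smul, Real.norm_eq_abs, abs_of_pos ht0',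
        real_inner_comm] at this
      change _ * inner ℝ w (gradient (logLik f x) θ₀) - _ ≤ _
      nlinarith
    rw [integral_sub ((hs.const_inner w).const_mul t) (hG1.const_mul _), integral_const_mul,
      integral_const_mul, integral_inner hs, ← hw, real_inner_self_eq_norm_sq] at h1
    have h2 := h1.trans (hKL _ ht)
    refine le_of_mul_le_mul_left ?_ ht0'
    nlinarith
  have hlim : Tendsto (fun t : ℝ => (∫ x, G x ∂μ) * ‖w‖ ^ 2 * t) (𝓝[>] 0) (𝓝 0) := by
    have : Continuous fun t : ℝ => (∫ x, G x ∂μ) * ‖w‖ ^ 2 * t := by fun_prop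
    have h := this.tendsto 0
    rw [mul_zero] at h
    exact h.mono_left nhdsWithin_le_nhds
  have := ge_of_tendsto hlim hbound
  have h0 : ‖w‖ = 0 := by nlinarith [norm_nonneg w]
  exact norm_eq_zero.1 h0

end Population

/-! Data for which the asymptotic expansion holds -/

/-- The properties `p i` have probability tending to one along `l`. -/
def HighProb {ι : Type*} (l : Filter ι) {Ω : ι → Type*} [∀ i, MeasurableSpace (Ω i)]
    (P : ∀ i, Measure (Ω i)) (p : ∀ i, Ω i → Prop) : Prop :=
  Tendsto (fun i => P i {x | ¬ p i x}) l (𝓝 0)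

namespace HighProb

variable {ι : Type*} {l : Filter ι} {Ω : ι → Type*} [∀ i, MeasurableSpace (Ω i)]
  {P : ∀ i, Measure (Ω i)} {p q : ∀ i, Ω i → Prop}

lemma mono (hp : HighProb l P p) (h : ∀ᶠ i in l, ∀ᵐ x ∂P i, p i x → q i x) : HighProb l P q :=
  tendsto_of_tendsto_of_tendsto_of_le_of_le' tendsto_const_nhds hp
    (Eventually.of_forall fun _ => zero_le)
    (h.mono fun _ hi => measure_mono_ae (hi.mono fun _ hx hq hpx => hq (hx hpx)))

/-- Only subadditivity of the outer measure is involved, so the properties need not be measurable.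
-/
lemma and (hp : HighProb l P p) (hq : HighProb l P q) :
    HighProb l P fun i x => p i x ∧ q i x := by
  have h := Tendsto.add hp hq
  rw [add_zero] at h
  refine tendsto_of_tendsto_of_tendsto_of_le_of_le tendsto_const_nhds h (fun _ => zero_le)
    fun i => (measure_mono ?_).trans (measure_union_le _ _)
  intro x hx
  simp only [Set.mem_union, Set.mem_ofPred_eq] at hx ⊢
  tauto

lemma forall_mem_finset {κ : Type*} {p : κ → ∀ i, Ω i → Prop} (s : Finset κ)
    (h : ∀ k ∈ s, HighProb l P (p k)) : HighProb l P fun i x => ∀ k ∈ s, p k i x := by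
  classical
  induction s using Finset.induction_on with
  | empty => simpa [HighProb] using tendsto_const_nhds
  | insert a s _ ih =>
    refine ((h a (Finset.mem_insert_self a s)).and
      (ih fun k hk => h k (Finset.mem_insert_of_mem hk))).mono ?_
    refine Eventually.of_forall fun i => ae_of_all _ fun x hx k hk => ?_
    rcases Finset.mem_insert.1 hk with rfl | hk
    · exact hx.1
    · exact hx.2 k hk

lemma of_le_ofReal_div {ι : Type*} {l : Filter ι} {Ω : ι → Type*} [∀ i, MeasurableSpace (Ω i)]
    {P : ∀ i, Measure (Ω i)} {p : ∀ i, Ω i → Prop} {N : ι → ℕ} (hN : Tendsto N l atTop) {B : ℝ}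
    (h : ∀ i, 0 < N i → P i {x | ¬ p i x} ≤ ENNReal.ofReal (B / N i)) : HighProb l P p := by
  have h1 : Tendsto (fun i => ENNReal.ofReal (B / N i)) l (𝓝 0) := by
    rw [← ENNReal.ofReal_zero]
    exact (ENNReal.continuous_ofReal.tendsto 0).comp
      (tendsto_const_nhds.div_atTop (tendsto_natCast_atTop_atTop.comp hN))
  exact tendsto_of_tendsto_of_tendsto_of_le_of_le' tendsto_const_nhds h1
    (Eventually.of_forall fun _ => zero_le)
    ((hN.eventually (eventually_gt_atTop 0)).mono fun i hi => h i hi)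

end HighProb

/-- Data `x` and an estimate `θh` for which the subsampled likelihood is well behaved. The
truncation levels `κ j` control the tails of the envelope `G`. -/
structure GoodData {d : ℕ} (f : Param d → ℝ → ℝ) (Θ : Set (Param d)) (G : Obs → ℝ)
    (C lam c ρ : ℝ) (κ : ℕ → ℝ) (N : ℕ) {n : ℕ} (x : Fin n → Obs) (θh : Param d) : Prop where
  pos : 0 < n
  smooth : ∀ i, SmoothBound Θ (logLik f (x i)) (G (x i))
  avg_sq : (n : ℝ)⁻¹ * ∑ i, G (x i) ^ 2 ≤ C
  tail : ∀ j ≤ N, (n : ℝ)⁻¹ * ∑ i, (if κ j < G (x i) then G (x i) ^ 2 else 0) ≤ 1 / (j + 1)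
  concave : ∀ θ ∈ Θ, ∀ v,
    inner ℝ v (matOp (hessian (avgObj fun i => logLik f (x i)) θ) v) ≤ -lam * ‖v‖ ^ 2
  score_lower : ∀ θ ∈ Θ, ∀ v, c * ‖v‖ ≤ (n : ℝ)⁻¹ * ∑ i, |inner ℝ v (score f (x i) θ)|
  closedBall_subset : Metric.closedBall θh ρ ⊆ Θ
  gradient_eq_zero : gradient (avgObj fun i => logLik f (x i)) θh = 0

/-- Dominated convergence. The level depends on the law of one record alone; the strict inequality
leaves room for the law of large numbers. -/
lemma exists_tail_level {μ : Measure Obs} {G : Obs → ℝ} (hG : MemLp G 2 μ) (j : ℕ) :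
    ∃ K : ℝ, ∫ x, (if K < G x then G x ^ 2 else 0) ∂μ < 1 / (j + 1) := by
  have hmeas : ∀ K : ℝ, AEStronglyMeasurable (fun x => if K < G x then G x ^ 2 else 0) μ :=
    fun K => by
      have h : Measurable fun u : ℝ => if K < u then u ^ 2 else 0 :=
        Measurable.ite measurableSet_Ioi (by fun_prop) measurable_const
      exact (h.comp_aemeasurable hG.aestronglyMeasurable.aemeasurable).aestronglyMeasurable
  have hlim : Tendsto (fun K : ℕ => ∫ x, (if (K : ℝ) < G x then G x ^ 2 else 0) ∂μ) atTop (𝓝 0) := by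
    have := tendsto_integral_of_dominated_convergence (μ := μ)
      (F := fun (K : ℕ) x => if (K : ℝ) < G x then G x ^ 2 else 0) (f := fun _ => 0)
      (fun x => G x ^ 2) (fun K => hmeas K) hG.integrable_sq
      (fun K => ae_of_all _ fun x => by
        split_ifs
        · simp
        · simpa using sq_nonneg (G x))
      (ae_of_all _ fun x => by
        refine tendsto_const_nhds.congr' ?_
        obtain ⟨N, hN⟩ := exists_nat_ge (G x)
        filter_upwards [eventually_ge_atTop N] with K hK
        have : G x ≤ K := hN.trans (by exact_mod_cast hK)
        rw [if_neg (not_lt.2 this)])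
    simpa using this
  obtain ⟨K, hK⟩ := ((tendsto_order.1 hlim).2 (1 / ((j : ℝ) + 1)) (by positivity)).exists
  exact ⟨K, hK⟩

/-! ### Laws of large numbers for the full data -/

section DataLaw

variable {d : ℕ} {f : Param d → ℝ → ℝ} {Θ : Set (Param d)} {θ₀ : Param d} {μ : Measure Obs}
  [IsProbabilityMeasure μ] {G : Obs → ℝ}

lemma fullLogLik_eq_avgObj {n : ℕ} (x : Fin n → Obs) :
    fullLogLik f x = avgObj fun i => logLik f (x i) := by
  ext θ
  simp [fullLogLik, avgObj, Finset.mul_sum]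

lemma ae_forall_pi {p : Obs → Prop} (h : ∀ᵐ x ∂μ, p x) (n : ℕ) :
    ∀ᵐ x ∂(Measure.pi fun _ : Fin n => μ), ∀ i, p (x i) :=
  ae_all_iff.2 fun i => (measurePreserving_eval (fun _ : Fin n => μ) i).quasiMeasurePreserving.ae h

/-- Uniform weak law of large numbers for the Hessians. -/
lemma highProb_hessian (hΘ : IsCompact Θ) (hG : MemLp G 2 μ)
    (hreg : ∀ᵐ x ∂μ, SmoothBound Θ (logLik f x) (G x)) (hhess : HessCondition f Θ μ)
    {η : ℝ} (hη : 0 < η) :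
    HighProb atTop (fun n : ℕ => Measure.pi fun _ : Fin n => μ) fun n x =>
      ∀ θ ∈ Θ, ∀ j k, |(n : ℝ)⁻¹ * ∑ i, hess f (x i) θ j k - meanHess f μ θ j k| ≤ η := by
  obtain ⟨B, hB⟩ := exists_measure_uniform_avg_le hΘ
    (integral_nonneg fun x => sq_nonneg (G x) : 0 ≤ ∫ x, G x ^ 2 ∂μ) hη
  have key : ∀ q ∈ (Finset.univ : Finset (Fin d × Fin d)),
      HighProb atTop (fun n : ℕ => Measure.pi fun _ : Fin n => μ) fun n x =>
        ∀ θ ∈ Θ, |(n : ℝ)⁻¹ * ∑ i, hess f (x i) θ q.1 q.2 - meanHess f μ θ q.1 q.2| ≤ η := by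
    intro q _
    refine HighProb.of_le_ofReal_div tendsto_id (B := B) fun n hn => ?_
    refine le_trans (measure_mono ?_) (hB μ (fun x θ => hess f x θ q.1 q.2) G hG le_rfl
      (fun θ hθ => (hhess.memLp θ hθ q.1 q.2).aestronglyMeasurable)
      (hreg.mono fun x hx => ⟨fun θ hθ => hx.abs_hessian_le θ hθ _ _, fun θ₁ h₁ θ₂ h₂ => ?_⟩) n hn)
    · intro x hx
      simpa [meanHess] using hx
    · rw [dist_eq_norm]
      exact hx.hessian_lip θ₁ h₁ θ₂ h₂ _ _
  exact (HighProb.forall_mem_finset _ key).mono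
    (Eventually.of_forall fun n => ae_of_all _ fun x hx θ hθ j k =>
      hx (j, k) (Finset.mem_univ _) θ hθ)

/-- Uniform weak law of large numbers for the absolute linear forms of the scores. -/
lemma highProb_abs_inner_score (hΘ : IsCompact Θ) (hG : MemLp G 2 μ)
    (hreg : ∀ᵐ x ∂μ, SmoothBound Θ (logLik f x) (G x)) (hscore : ScoreCondition f Θ μ)
    {η : ℝ} (hη : 0 < η) :
    HighProb atTop (fun n : ℕ => Measure.pi fun _ : Fin n => μ) fun n x =>
      ∀ q ∈ Metric.sphere (0 : Param d) 1 ×ˢ Θ,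
        |(n : ℝ)⁻¹ * ∑ i, |inner ℝ q.1 (score f (x i) q.2)|
          - ∫ x, |inner ℝ q.1 (score f x q.2)| ∂μ| ≤ η := by
  have hS : IsCompact (Metric.sphere (0 : Param d) 1 ×ˢ Θ) := (isCompact_sphere _ _).prod hΘ
  obtain ⟨B, hB⟩ := exists_measure_uniform_avg_le hS
    (integral_nonneg fun x => sq_nonneg (2 * G x) : 0 ≤ ∫ x, (2 * G x) ^ 2 ∂μ) hη
  refine HighProb.of_le_ofReal_div tendsto_id (B := B) fun n hn => ?_
  refine le_trans (measure_mono ?_) (hB μ (fun x q => |inner ℝ q.1 (score f x q.2)|)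
    (fun x => 2 * G x) (hG.const_mul 2) le_rfl
    (fun q hq => ((hscore.memLp q.2 hq.2).const_inner q.1).abs.aestronglyMeasurable)
    (hreg.mono fun x hx => ⟨fun q hq => ?_, fun q hq q' hq' => ?_⟩) n hn)
  · intro x hx
    simpa only [Set.mem_ofPred_eq, not_forall, exists_prop, not_le] using hx
  · have hq1 : ‖q.1‖ = 1 := by simpa using hq.1
    have h1 := abs_real_inner_le_norm q.1 (score f x q.2)
    have h2 : ‖score f x q.2‖ ≤ G x := hx.norm_gradient_le _ hq.2
    rw [hq1, one_mul] at h1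
    rw [abs_abs]
    linarith [norm_nonneg (score f x q.2)]
  · refine (abs_abs_sub_abs_le_abs_sub _ _).trans ?_
    have h1 : inner ℝ q.1 (score f x q.2) - inner ℝ q'.1 (score f x q'.2)
        = inner ℝ (q.1 - q'.1) (score f x q.2) + inner ℝ q'.1 (score f x q.2 - score f x q'.2) := by
      rw [inner_sub_left, inner_sub_right]; ring
    have h2 := abs_real_inner_le_norm (q.1 - q'.1) (score f x q.2)
    have h3 := abs_real_inner_le_norm q'.1 (score f x q.2 - score f x q'.2)
    have hq1 : ‖q'.1‖ = 1 := by simpa using hq'.1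
    have d1 : ‖q.1 - q'.1‖ ≤ dist q q' := by rw [← dist_eq_norm]; exact le_max_left _ _
    have d2 : ‖q.2 - q'.2‖ ≤ dist q q' := by rw [← dist_eq_norm]; exact le_max_right _ _
    have g1 : ‖score f x q.2‖ ≤ G x := hx.norm_gradient_le _ hq.2
    have g2 : ‖score f x q.2 - score f x q'.2‖ ≤ G x * ‖q.2 - q'.2‖ :=
      hx.gradient_lip _ hq.2 _ hq'.2
    have hG0 : 0 ≤ G x := (norm_nonneg _).trans g1
    have k1 : ‖q.1 - q'.1‖ * ‖score f x q.2‖ ≤ dist q q' * G x :=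
      mul_le_mul d1 g1 (norm_nonneg _) dist_nonneg
    have k2 : G x * ‖q.2 - q'.2‖ ≤ G x * dist q q' := mul_le_mul_of_nonneg_left d2 hG0
    rw [hq1, one_mul] at h3
    rw [h1]
    refine (abs_add_le _ _).trans ?_
    linarith

/-- Data are good with probability tending to one. -/
lemma exists_highProb_goodData (hd : 0 < d) (hΘ : IsCompact Θ) (hconv : Convex ℝ Θ)
    (hθ₀ : θ₀ ∈ interior Θ) (hsmooth : SmoothLik f Θ μ)
    (hhess : HessCondition f Θ μ) (hscore : ScoreCondition f Θ μ)
    (hlik : ∀ θ ∈ Θ, Integrable (fun x => logLik f x θ) μ)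
    (hKL : ∀ θ ∈ Θ, ∫ x, (logLik f x θ - logLik f x θ₀) ∂μ ≤ 0)
    (θhat : (n : ℕ) → (Fin n → Obs) → Param d)
    (hhat : ∀ n, ∀ᵐ x ∂(Measure.pi fun _ : Fin n => μ),
      IsArgmax Θ (fullLogLik f x) (θhat n x)) :
    ∃ (G : Obs → ℝ) (C lam c ρ : ℝ) (κ : ℕ → ℝ), 0 < C ∧ 0 < lam ∧ 0 < c ∧ 0 < ρ ∧
      ∀ N, HighProb atTop (fun n : ℕ => Measure.pi fun _ : Fin n => μ) fun n x =>
        GoodData f Θ G C lam c ρ κ N x (θhat n x) := by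
  have hθ₀' := interior_subset hθ₀
  obtain ⟨G, hG, hreg⟩ := exists_smoothBound hΘ hconv hθ₀' hsmooth hhess hscore
  obtain ⟨lam, hlam, hmean⟩ := exists_meanHess_le hΘ hhess hG hreg
  obtain ⟨c, hc, hlow⟩ := exists_le_integral_abs_inner_score hΘ hscore hG hreg
  have hs0 := integral_score_eq_zero hconv hθ₀ hG hreg hscore hlik hKL
  choose κ hκ using exists_tail_level (μ := μ) hG
  obtain ⟨ρ, hρ, hball⟩ : ∃ ρ > 0, Metric.closedBall θ₀ (2 * ρ) ⊆ Θ := by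
    obtain ⟨e, he, hb⟩ := Metric.nhds_basis_closedBall.mem_iff.1 (mem_interior_iff_mem_nhds.1 hθ₀)
    exact ⟨e / 2, by positivity, by rwa [mul_div_cancel₀ _ two_ne_zero]⟩
  have hG2 : 0 ≤ ∫ x, G x ^ 2 ∂μ := integral_nonneg fun x => sq_nonneg _
  -- The population constants are relaxed by `1` or by a factor `2`, so that their empirical
  -- versions hold with probability tending to one.
  refine ⟨G, ∫ x, G x ^ 2 ∂μ + 1, lam / 2, c / 2, ρ, κ, by linarith, by positivity, by positivity,
    hρ, fun N => ?_⟩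
  have h1 : HighProb atTop (fun n : ℕ => Measure.pi fun _ : Fin n => μ) fun n x =>
      (n : ℝ)⁻¹ * ∑ i, G (x i) ^ 2 ≤ ∫ x, G x ^ 2 ∂μ + 1 := by
    simpa [HighProb] using tendsto_measure_avg_gt (Q := μ) hG.integrable_sq
      (fun x => sq_nonneg (G x)) (lt_add_one (∫ x, G x ^ 2 ∂μ))
  have h2 : HighProb atTop (fun n : ℕ => Measure.pi fun _ : Fin n => μ) fun n x =>
      ∀ j ∈ Finset.range (N + 1),
        (n : ℝ)⁻¹ * ∑ i, (if κ j < G (x i) then G (x i) ^ 2 else 0) ≤ 1 / (j + 1) := by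
    refine HighProb.forall_mem_finset _ fun j _ => ?_
    have hint : Integrable (fun x => if κ j < G x then G x ^ 2 else 0) μ := by
      have h : Measurable fun u : ℝ => if κ j < u then u ^ 2 else 0 :=
        Measurable.ite measurableSet_Ioi (by fun_prop) measurable_const
      refine hG.integrable_sq.mono
        (h.comp_aemeasurable hG.aestronglyMeasurable.aemeasurable).aestronglyMeasurable
        (ae_of_all _ fun x => ?_)
      split_ifs
      · exact le_rfl
      · simpa using sq_nonneg (G x)
    have := tendsto_measure_avg_gt (Q := μ) hint
      (fun x => by split_ifs <;> positivity) (hκ j)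
    simpa only [HighProb, not_le] using this
  have h3 := highProb_hessian hΘ hG hreg hhess (η := lam / (2 * d)) (by positivity)
  have h4 := highProb_abs_inner_score hΘ hG hreg hscore (half_pos hc)
  -- With concavity constant `lam / 2`, a score average of norm at most `ρ * lam / 4` at `θ₀` puts
  -- `θ̂` within `ρ` of `θ₀`, so the `ρ`-ball about `θ̂` stays in the `2ρ`-ball about `θ₀`.
  have h5 : HighProb atTop (fun n : ℕ => Measure.pi fun _ : Fin n => μ) fun n x =>
      ‖(n : ℝ)⁻¹ • ∑ i, score f (x i) θ₀‖ ≤ ρ * lam / 4 := by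
    refine HighProb.of_le_ofReal_div tendsto_id
      (B := d ^ 2 * (∫ x, G x ^ 2 ∂μ) / (ρ * lam / 4) ^ 2) fun n hn => ?_
    have := measure_norm_avg_ge_le (Q := μ) hG le_rfl (hscore.memLp θ₀ hθ₀').aestronglyMeasurable
      (hreg.mono fun x hx => hx.norm_gradient_le θ₀ hθ₀') hs0 hn
      (show 0 < ρ * lam / 4 by positivity)
    simp only [not_le]
    refine this.trans (le_of_eq ?_)
    congr 1
    simp only [id]
    field_simp
  refine ((((h1.and h2).and h3).and h4).and h5).mono ?_
  filter_upwards [eventually_gt_atTop 0] with n hn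
  filter_upwards [ae_forall_pi hreg n, hhat n] with x hx hmax
  rintro ⟨⟨⟨⟨g1, g2⟩, g3⟩, g4⟩, g5⟩
  have hconc : ∀ θ ∈ Θ, ∀ v,
      inner ℝ v (matOp (hessian (avgObj fun i => logLik f (x i)) θ) v)
        ≤ -(lam / 2) * ‖v‖ ^ 2 := by
    intro θ hθ v
    refine inner_matOp_le_of_abs_sub_le hd (hmean θ hθ) (fun j k => ?_) v
    rw [hessian_avgObj hx hθ, Matrix.sum_apply]
    simp only [Matrix.smul_apply, smul_eq_mul, ← Finset.mul_sum]
    exact g3 θ hθ j k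
  have hclose : ‖θhat n x - θ₀‖ ≤ ρ := by
    rw [fullLogLik_eq_avgObj] at hmax
    have := hmax.norm_sub_le hconv
      (fun θ hθ => contDiffAt_weightedSum _ fun i => (hx i).contDiffAt θ hθ)
      (half_pos hlam) hconc hθ₀'
    have hgrad : gradient (avgObj fun i => logLik f (x i)) θ₀
        = (n : ℝ)⁻¹ • ∑ i, score f (x i) θ₀ := by
      rw [gradient_avgObj hx hθ₀', Finset.smul_sum]; rfl
    change ‖θhat n x - θ₀‖ ≤ 2 / (lam / 2) * ‖gradient (avgObj fun i => logLik f (x i)) θ₀‖ at this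
    rw [hgrad] at this
    calc _ ≤ _ := this
      _ ≤ 2 / (lam / 2) * (ρ * lam / 4) := by gcongr
      _ = ρ := by field_simp; norm_num
  have hsub : Metric.closedBall (θhat n x) ρ ⊆ Θ := by
    refine (Metric.closedBall_subset_closedBall' ?_).trans hball
    rw [dist_eq_norm]
    linarith
  refine ⟨hn, hx, g1, fun j hj => g2 j (Finset.mem_range.2 (by omega)), hconc, fun θ hθ v => ?_,
    hsub, ?_⟩
  · rcases eq_or_ne v 0 with rfl | hv
    · simp
    have hv' : ‖v‖ ≠ 0 := norm_ne_zero_iff.2 hv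
    have hmem : (‖v‖⁻¹ • v, θ) ∈ Metric.sphere (0 : Param d) 1 ×ˢ Θ :=
      ⟨by simp [norm_smul, hv'], hθ⟩
    have e1 := (abs_le.1 (g4 _ hmem)).1
    have e2 := hlow _ hmem
    simp only [inner_smul_left, RCLike.conj_to_real, abs_mul, abs_inv, abs_norm,
      ← Finset.mul_sum] at e1 e2
    have e3 : c / 2 ≤ (n : ℝ)⁻¹ * (‖v‖⁻¹ * ∑ i, |inner ℝ v (score f (x i) θ)|) := by linarith
    have e4 := mul_le_mul_of_nonneg_right e3 (norm_nonneg v)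
    calc c / 2 * ‖v‖ ≤ _ := e4
      _ = _ := by field_simp
  · rw [fullLogLik_eq_avgObj] at hmax
    exact hmax.gradient_eq_zero (Filter.mem_of_superset (Metric.closedBall_mem_nhds _ hρ) hsub)

end DataLaw

/-! The standardizing matrix -/

section Matrices

variable {d : ℕ}

lemma transpose_invSqrt (V : Matrix (Fin d) (Fin d) ℝ) : (invSqrt V).transpose = invSqrt V := by
  have h : IsSelfAdjoint (invSqrt V) := cfc_predicate _ V
  have h2 : (invSqrt V).conjTranspose = invSqrt V := h
  rwa [Matrix.conjTranspose_eq_transpose_of_trivial] at h2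

/-- Functional calculus for `s^{-1/2} * s * s^{-1/2} = 1`. Positive definiteness keeps the spectrum
away from zero, where this identity fails. -/
lemma invSqrt_mul_mul_invSqrt {V : Matrix (Fin d) (Fin d) ℝ} (hV : V.PosDef) :
    invSqrt V * V * invSqrt V = 1 := by
  have hsa : IsSelfAdjoint V := hV.isHermitian
  have hpos : ∀ s ∈ spectrum ℝ V, 0 < s := fun s hs => by
    obtain ⟨i, rfl⟩ := hV.isHermitian.spectrum_real_eq_range_eigenvalues ▸ hs
    exact hV.eigenvalues_pos i
  have hc : ContinuousOn (fun s : ℝ => (Real.sqrt s)⁻¹) (spectrum ℝ V) :=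
    ContinuousOn.inv₀ (by fun_prop) fun s hs => (Real.sqrt_pos.2 (hpos s hs)).ne'
  have hid : ContinuousOn (fun s : ℝ => s) (spectrum ℝ V) := continuousOn_id
  have h1 : V = cfc (fun s : ℝ => s) V := (cfc_id' ℝ V hsa).symm
  calc invSqrt V * V * invSqrt V
      = cfc (fun s : ℝ => (Real.sqrt s)⁻¹) V * cfc (fun s : ℝ => s) V
        * cfc (fun s : ℝ => (Real.sqrt s)⁻¹) V := by rw [← h1]; rfl
    _ = cfc (fun s : ℝ => (Real.sqrt s)⁻¹ * s * (Real.sqrt s)⁻¹) V := by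
        rw [← cfc_mul _ _ V hc hid, ← cfc_mul (fun s : ℝ => (Real.sqrt s)⁻¹ * s) _ V (hc.mul hid) hc]
    _ = cfc (fun _ : ℝ => (1 : ℝ)) V := by
        refine cfc_congr fun s hs => ?_
        have h2 := Real.sqrt_pos.2 (hpos s hs)
        have h3 := Real.mul_self_sqrt (hpos s hs).le
        field_simp
        linarith
    _ = 1 := cfc_const_one ℝ V hsa

lemma matOp_mul_apply (A B : Matrix (Fin d) (Fin d) ℝ) (v : Param d) :
    matOp (A * B) v = matOp A (matOp B v) := by
  rw [matOp, map_mul]; rfl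

lemma inner_matOp_comm {A : Matrix (Fin d) (Fin d) ℝ} (hA : A.transpose = A) (u v : Param d) :
    inner ℝ (matOp A u) v = inner ℝ u (matOp A v) := by
  rw [real_inner_comm, Matrix.inner_toEuclideanCLM, Matrix.inner_toEuclideanCLM,
    Matrix.dotProduct_mulVec, ← Matrix.mulVec_transpose, hA, dotProduct_comm]

lemma matOp_inv_apply {M : Matrix (Fin d) (Fin d) ℝ} (hM : IsUnit M.det) (v : Param d) :
    matOp M⁻¹ (matOp M v) = v := by
  rw [← matOp_mul_apply, Matrix.nonsing_inv_mul _ hM, matOp, map_one]; rfl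

lemma inner_matOp_sum_vecMulVec {ι : Type*} [Fintype ι] (a : ℝ) (w : ι → ℝ) (s : ι → Param d)
    (v : Param d) :
    inner ℝ v (matOp (a • ∑ i, w i • Matrix.vecMulVec (s i) (s i)) v)
      = a * ∑ i, w i * (inner ℝ v (s i)) ^ 2 := by
  rw [Matrix.inner_toEuclideanCLM, Matrix.smul_mulVec, dotProduct_smul, smul_eq_mul,
    Matrix.sum_mulVec, dotProduct_sum]
  congr 1
  refine Finset.sum_congr rfl fun i _ => ?_
  rw [Matrix.smul_mulVec, dotProduct_smul, smul_eq_mul, Matrix.vecMulVec_mulVec]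
  have h1 : inner ℝ v (s i) = v.ofLp ⬝ᵥ (s i).ofLp := by
    rw [EuclideanSpace.inner_eq_star_dotProduct, dotProduct_comm]
    simp
  rw [h1, sq]
  simp [dotProduct_comm (s i).ofLp v.ofLp]

end Matrices

/-- A quotient is Lipschitz while its denominator stays above `c`. Here `b` stands for the norm of
one score and `a` for the average of these norms, as in the sampling probabilities. -/
lemma abs_mul_inv_sub_mul_inv_le {a₁ a₂ b₁ b₂ c g D δ : ℝ} (hc : 0 < c) (h₁ : c ≤ a₁)
    (h₂ : c ≤ a₂) (hb : |b₁ - b₂| ≤ g * δ) (ha : |a₁ - a₂| ≤ D * δ) (hb0 : 0 ≤ b₂) (hbg : b₂ ≤ g) :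
    |b₁ * a₁⁻¹ - b₂ * a₂⁻¹| ≤ (c⁻¹ + D * (c⁻¹) ^ 2) * δ * g := by
  have ha₁ := hc.trans_le h₁
  have ha₂ := hc.trans_le h₂
  have hi₁ : a₁⁻¹ ≤ c⁻¹ := inv_anti₀ hc h₁
  have hi₂ : a₂⁻¹ ≤ c⁻¹ := inv_anti₀ hc h₂
  have e : b₁ * a₁⁻¹ - b₂ * a₂⁻¹ = (b₁ - b₂) * a₁⁻¹ + b₂ * ((a₂ - a₁) * (a₁⁻¹ * a₂⁻¹)) := by
    field_simp
    ring
  have k1 : |(b₁ - b₂) * a₁⁻¹| ≤ g * δ * c⁻¹ := by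
    rw [abs_mul, abs_of_pos (inv_pos.2 ha₁)]
    exact mul_le_mul hb hi₁ (by positivity) ((abs_nonneg _).trans hb)
  have k2 : |b₂ * ((a₂ - a₁) * (a₁⁻¹ * a₂⁻¹))| ≤ g * (D * δ * (c⁻¹ * c⁻¹)) := by
    rw [abs_mul, abs_mul, abs_of_nonneg hb0, abs_sub_comm,
      abs_of_pos (mul_pos (inv_pos.2 ha₁) (inv_pos.2 ha₂))]
    have h3 : a₁⁻¹ * a₂⁻¹ ≤ c⁻¹ * c⁻¹ := mul_le_mul hi₁ hi₂ (by positivity) (by positivity)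
    have h4 : |a₁ - a₂| * (a₁⁻¹ * a₂⁻¹) ≤ D * δ * (c⁻¹ * c⁻¹) :=
      mul_le_mul ha h3 (by positivity) ((abs_nonneg _).trans ha)
    exact mul_le_mul hbg h4 (by positivity) (hb0.trans hbg)
  rw [e]
  refine (abs_add_le _ _).trans ((add_le_add k1 k2).trans (le_of_eq ?_))
  ring

lemma abs_inv_sub_inv_le {a b q : ℝ} (ha : 0 < a) (hb : 0 < b) (haq : a⁻¹ ≤ q) (hbq : b⁻¹ ≤ q) :
    |a⁻¹ - b⁻¹| ≤ q ^ 2 * |a - b| := by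
  have e : a⁻¹ - b⁻¹ = a⁻¹ * b⁻¹ * (b - a) := by field_simp
  have ha' := inv_pos.2 ha
  have hb' := inv_pos.2 hb
  rw [e, abs_mul, abs_of_pos (mul_pos ha' hb'), abs_sub_comm]
  refine mul_le_mul_of_nonneg_right ?_ (abs_nonneg _)
  rw [sq]
  exact mul_le_mul haq hbq hb'.le (ha'.le.trans haq)

/-! ### Nonasymptotic consequences of good data -/

section GoodData

variable {d : ℕ} {f : Param d → ℝ → ℝ} {Θ : Set (Param d)} {G : Obs → ℝ} {C lam c ρ : ℝ}
  {κ : ℕ → ℝ} {N n : ℕ} {x : Fin n → Obs} {θh : Param d} {ξ : ℝ}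

lemma exists_norm_eq_one (hd : 0 < d) : ∃ v : Param d, ‖v‖ = 1 :=
  ⟨EuclideanSpace.single ⟨0, hd⟩ 1, by simp⟩

namespace GoodData

lemma mem (h : GoodData f Θ G C lam c ρ κ N x θh) (hρ : 0 < ρ) : θh ∈ Θ :=
  h.closedBall_subset (Metric.mem_closedBall_self hρ.le)

lemma cast_pos (h : GoodData f Θ G C lam c ρ κ N x θh) : (0 : ℝ) < n := by
  exact_mod_cast h.pos

lemma le_avg_norm_score (h : GoodData f Θ G C lam c ρ κ N x θh) (hd : 0 < d) {θ : Param d}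
    (hθ : θ ∈ Θ) : c ≤ (n : ℝ)⁻¹ * ∑ i, ‖score f (x i) θ‖ := by
  have hn := h.cast_pos
  obtain ⟨v, hv⟩ := exists_norm_eq_one hd
  have h1 := h.score_lower θ hθ v
  rw [hv, mul_one] at h1
  refine h1.trans (mul_le_mul_of_nonneg_left (Finset.sum_le_sum fun i _ => ?_) (by positivity))
  simpa [hv] using abs_real_inner_le_norm v (score f (x i) θ)

lemma sum_norm_score_pos (h : GoodData f Θ G C lam c ρ κ N x θh) (hd : 0 < d) (hc : 0 < c)
    {θ : Param d} (hθ : θ ∈ Θ) : 0 < ∑ i, ‖score f (x i) θ‖ := by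
  have hn := h.cast_pos
  exact pos_of_mul_pos_right (hc.trans_le (h.le_avg_norm_score hd hθ)) (by positivity)

lemma isMixedProb (h : GoodData f Θ G C lam c ρ κ N x θh) (hd : 0 < d) (hc : 0 < c)
    (hξ : ξ ≤ 1) {θ : Param d} (hθ : θ ∈ Θ) : IsMixedProb ξ (piMix f ξ x θ) where
  le i := by
    rw [piMix, piOpt]
    have : 0 ≤ (1 - ξ) * (‖score f (x i) θ‖ / ∑ j, ‖score f (x j) θ‖) :=
      mul_nonneg (by linarith) (by positivity)
    linarith
  sum_eq_one := by
    have hn := h.cast_pos.ne'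
    have hs := (h.sum_norm_score_pos hd hc hθ).ne'
    simp only [piMix, piOpt, Finset.sum_add_distrib, ← Finset.mul_sum, ← Finset.sum_div]
    rw [div_self hs]
    simp
    field_simp
    ring

lemma avg_envelope_le (h : GoodData f Θ G C lam c ρ κ N x θh) :
    (n : ℝ)⁻¹ * ∑ i, G (x i) ≤ C + 1 := by
  have hn := h.cast_pos
  have h1 : (n : ℝ)⁻¹ * ∑ i, G (x i) ≤ (n : ℝ)⁻¹ * ∑ i, (G (x i) ^ 2 + 1) := by
    refine mul_le_mul_of_nonneg_left (Finset.sum_le_sum fun i _ => ?_) (by positivity)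
    nlinarith [sq_nonneg (G (x i) - 1)]
  rw [Finset.sum_add_distrib, mul_add] at h1
  have h2 : (n : ℝ)⁻¹ * ∑ _i : Fin n, (1 : ℝ) = 1 := by
    simp [hn.ne']
  linarith [h.avg_sq]

lemma avgHess_eq (h : GoodData f Θ G C lam c ρ κ N x θh) (hρ : 0 < ρ) :
    avgHess f x θh = hessian (avgObj fun i => logLik f (x i)) θh := by
  rw [hessian_avgObj h.smooth (h.mem hρ), avgHess, Finset.smul_sum]
  rfl

lemma transpose_avgHess (h : GoodData f Θ G C lam c ρ κ N x θh) (hρ : 0 < ρ) :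
    (avgHess f x θh).transpose = avgHess f x θh := by
  rw [h.avgHess_eq hρ]
  exact hessian_transpose (contDiffAt_weightedSum _ fun i => (h.smooth i).contDiffAt _ (h.mem hρ))

lemma posDef_neg_avgHess (h : GoodData f Θ G C lam c ρ κ N x θh) (hρ : 0 < ρ) (hlam : 0 < lam) :
    (-(avgHess f x θh)).PosDef := by
  refine posDef_of_inner_matOp_pos (by rw [Matrix.transpose_neg, h.transpose_avgHess hρ])
    fun v hv => ?_
  have h1 := h.concave θh (h.mem hρ) v
  rw [← h.avgHess_eq hρ] at h1
  rw [show matOp (-(avgHess f x θh)) = -matOp (avgHess f x θh) from map_neg _ _,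
    _root_.neg_apply, inner_neg_right]
  have h2 : 0 < lam * ‖v‖ ^ 2 := by
    have := norm_pos_iff.2 hv
    positivity
  linarith

lemma isUnit_det_avgHess (h : GoodData f Θ G C lam c ρ κ N x θh) (hρ : 0 < ρ) (hlam : 0 < lam) :
    IsUnit (avgHess f x θh).det := by
  have := (h.posDef_neg_avgHess hρ hlam).isUnit.neg
  rw [neg_neg] at this
  exact (Matrix.isUnit_iff_isUnit_det _).1 this

lemma inner_lambdaRDS (h : GoodData f Θ G C lam c ρ κ N x θh) (v : Param d) :
    inner ℝ v (matOp (lambdaRDS f ξ x θh) v)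
      = (n : ℝ)⁻¹ * ∑ i, (n * piMix f ξ x θh i)⁻¹ * (inner ℝ v (score f (x i) θh)) ^ 2 := by
  have hn := h.cast_pos.ne'
  rw [lambdaRDS, inner_matOp_sum_vecMulVec, Finset.mul_sum, Finset.mul_sum]
  refine Finset.sum_congr rfl fun i _ => ?_
  rw [mul_inv]
  field_simp

lemma transpose_lambdaRDS : (lambdaRDS f ξ x θh).transpose = lambdaRDS f ξ x θh := by
  simp [lambdaRDS, Matrix.transpose_smul, Matrix.transpose_sum, Matrix.transpose_vecMulVec]

/-- Cauchy-Schwarz with weights `n * p i`, whose sum is `n`, bounds the squared first absolute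
moment of the scores by the weighted second moment. -/
lemma le_inner_lambdaRDS (h : GoodData f Θ G C lam c ρ κ N x θh) (hd : 0 < d) (hρ : 0 < ρ)
    (hc : 0 < c) (hξ : 0 < ξ) (hξ1 : ξ ≤ 1) (v : Param d) :
    (c * ‖v‖) ^ 2 ≤ inner ℝ v (matOp (lambdaRDS f ξ x θh) v) := by
  have hn := h.cast_pos
  have hp := h.isMixedProb hd hc hξ1 (h.mem hρ)
  set p := piMix f ξ x θh with hpdef
  have h1 := h.score_lower θh (h.mem hρ) v
  rw [h.inner_lambdaRDS]
  refine (pow_le_pow_left₀ (by positivity) h1 2).trans ?_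
  have hCS := Finset.sum_mul_sq_le_sq_mul_sq Finset.univ
    (fun i => Real.sqrt (n * p i)) (fun i => |inner ℝ v (score f (x i) θh)| / Real.sqrt (n * p i))
  have e1 : ∀ i, Real.sqrt (n * p i) * (|inner ℝ v (score f (x i) θh)| / Real.sqrt (n * p i))
      = |inner ℝ v (score f (x i) θh)| := fun i => by
    have := Real.sqrt_pos.2 (hp.mul_pos hξ i)
    field_simp
  have e2 : ∑ i, Real.sqrt (n * p i) ^ 2 = n := by
    have : ∀ i, Real.sqrt (n * p i) ^ 2 = n * p i := fun i =>
      Real.sq_sqrt (hp.mul_pos hξ i).le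
    simp only [this, ← Finset.mul_sum, hp.sum_eq_one, mul_one]
  have e3 : ∀ i, (|inner ℝ v (score f (x i) θh)| / Real.sqrt (n * p i)) ^ 2
      = (n * p i)⁻¹ * (inner ℝ v (score f (x i) θh)) ^ 2 := fun i => by
    rw [div_pow, sq_abs, Real.sq_sqrt (hp.mul_pos hξ i).le, div_eq_inv_mul]
  simp only [e1, e2, e3] at hCS
  rw [mul_pow]
  calc _ ≤ ((n : ℝ)⁻¹) ^ 2 *
        (n * ∑ i, (n * p i)⁻¹ * (inner ℝ v (score f (x i) θh)) ^ 2) := by gcongr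
    _ = (n : ℝ)⁻¹ * ∑ i, (n * p i)⁻¹ * (inner ℝ v (score f (x i) θh)) ^ 2 := by field_simp

lemma posDef_lambdaRDS (h : GoodData f Θ G C lam c ρ κ N x θh) (hd : 0 < d) (hρ : 0 < ρ)
    (hc : 0 < c) (hξ : 0 < ξ) (hξ1 : ξ ≤ 1) : (lambdaRDS f ξ x θh).PosDef := by
  refine posDef_of_inner_matOp_pos transpose_lambdaRDS fun v hv => ?_
  have := norm_pos_iff.2 hv
  exact lt_of_lt_of_le (by positivity) (h.le_inner_lambdaRDS hd hρ hc hξ hξ1 v)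

lemma transpose_inv_avgHess (h : GoodData f Θ G C lam c ρ κ N x θh) (hρ : 0 < ρ) :
    ((avgHess f x θh)⁻¹).transpose = (avgHess f x θh)⁻¹ := by
  rw [Matrix.transpose_nonsing_inv, h.transpose_avgHess hρ]

lemma posDef_covRDS (h : GoodData f Θ G C lam c ρ κ N x θh) (hd : 0 < d) (hρ : 0 < ρ)
    (hlam : 0 < lam) (hc : 0 < c) (hξ : 0 < ξ) (hξ1 : ξ ≤ 1) : (covRDS f ξ x θh).PosDef := by
  have hM := h.isUnit_det_avgHess hρ hlam
  have ht := h.transpose_inv_avgHess hρ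
  have hΛ := h.posDef_lambdaRDS hd hρ hc hξ hξ1
  have hinj : Function.Injective (Matrix.mulVec (avgHess f x θh)⁻¹) :=
    Matrix.mulVec_injective_of_isUnit
      ((Matrix.isUnit_iff_isUnit_det _).2 (Matrix.isUnit_nonsing_inv_det _ hM))
  have := hΛ.conjTranspose_mul_mul_same hinj
  rwa [Matrix.conjTranspose_eq_transpose_of_trivial, ht] at this

/-- The direction `M⁻¹ V^{-1/2} t`. -/
abbrev _root_.dirRDS (f : Param d → ℝ → ℝ) (ξ : ℝ) {n : ℕ} (x : Fin n → Obs) (θh t : Param d) :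
    Param d :=
  matOp (avgHess f x θh)⁻¹ (matOp (invSqrt (covRDS f ξ x θh)) t)

/-- By symmetry the left side is the form of `V^{-1/2} M⁻¹ Λ M⁻¹ V^{-1/2} = 1` at `t`. It is the
variance in direction `t` of the leading term with weights computed at `θ̂`. -/
lemma inner_lambdaRDS_dir (h : GoodData f Θ G C lam c ρ κ N x θh) (hd : 0 < d) (hρ : 0 < ρ)
    (hlam : 0 < lam) (hc : 0 < c) (hξ : 0 < ξ) (hξ1 : ξ ≤ 1) (t : Param d) :
    inner ℝ (dirRDS f ξ x θh t) (matOp (lambdaRDS f ξ x θh) (dirRDS f ξ x θh t)) = ‖t‖ ^ 2 := by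
  have hV := invSqrt_mul_mul_invSqrt (h.posDef_covRDS hd hρ hlam hc hξ hξ1)
  rw [inner_matOp_comm (h.transpose_inv_avgHess hρ), inner_matOp_comm (transpose_invSqrt _),
    ← matOp_mul_apply, ← matOp_mul_apply, ← matOp_mul_apply, ← matOp_mul_apply]
  have : invSqrt (covRDS f ξ x θh) * ((avgHess f x θh)⁻¹ *
      (lambdaRDS f ξ x θh * ((avgHess f x θh)⁻¹ * invSqrt (covRDS f ξ x θh)))) = 1 := by
    rw [← hV]
    conv_rhs => rw [mul_assoc]; arg 2; arg 1; rw [covRDS]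
    simp only [mul_assoc]
  simp only [← mul_assoc] at this ⊢
  rw [this, matOp, map_one]
  exact real_inner_self_eq_norm_sq t

/-- The unit variance identity against the lower bound for `Λ_{RDS}`; `M⁻¹` and `V^{-1/2}` need not
be estimated separately. -/
lemma norm_dir_le (h : GoodData f Θ G C lam c ρ κ N x θh) (hd : 0 < d) (hρ : 0 < ρ)
    (hlam : 0 < lam) (hc : 0 < c) (hξ : 0 < ξ) (hξ1 : ξ ≤ 1) (t : Param d) :
    ‖dirRDS f ξ x θh t‖ ≤ c⁻¹ * ‖t‖ := by
  have h1 := h.le_inner_lambdaRDS hd hρ hc hξ hξ1 (dirRDS f ξ x θh t)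
  rw [h.inner_lambdaRDS_dir hd hρ hlam hc hξ hξ1] at h1
  have h2 := (pow_le_pow_iff_left₀ (by positivity) (norm_nonneg t) two_ne_zero).1 h1
  rwa [le_inv_mul_iff₀ hc]

lemma inner_invSqrt_inv (h : GoodData f Θ G C lam c ρ κ N x θh) (hρ : 0 < ρ) (t v : Param d) :
    inner ℝ (matOp (invSqrt (covRDS f ξ x θh)) (matOp (avgHess f x θh)⁻¹ v)) t
      = inner ℝ v (dirRDS f ξ x θh t) := by
  rw [inner_matOp_comm (transpose_invSqrt _), inner_matOp_comm (h.transpose_inv_avgHess hρ)]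

/-- `V^{-1/2} M⁻¹` is the adjoint of `t ↦ dirRDS f ξ x θh t`, so it inherits its operator bound;
this controls the remainder. -/
lemma norm_invSqrt_inv_le (h : GoodData f Θ G C lam c ρ κ N x θh) (hd : 0 < d) (hρ : 0 < ρ)
    (hlam : 0 < lam) (hc : 0 < c) (hξ : 0 < ξ) (hξ1 : ξ ≤ 1) (v : Param d) :
    ‖matOp (invSqrt (covRDS f ξ x θh)) (matOp (avgHess f x θh)⁻¹ v)‖ ≤ c⁻¹ * ‖v‖ := by
  set z := matOp (invSqrt (covRDS f ξ x θh)) (matOp (avgHess f x θh)⁻¹ v) with hz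
  have h1 : inner ℝ z z = inner ℝ v (dirRDS f ξ x θh z) := by
    conv_lhs => rw [hz]
    exact h.inner_invSqrt_inv hρ z v
  rw [real_inner_self_eq_norm_sq] at h1
  have h2 := real_inner_le_norm v (dirRDS f ξ x θh z)
  have h3 := h.norm_dir_le hd hρ hlam hc hξ hξ1 z
  rcases (norm_nonneg z).eq_or_lt with h0 | h0
  · rw [← h0]; positivity
  · refine le_of_mul_le_mul_right ?_ h0
    nlinarith [mul_le_mul_of_nonneg_left h3 (norm_nonneg v)]

/-- The weights depend continuously on the point at which they are computed. -/
lemma abs_weight_sub_le (h : GoodData f Θ G C lam c ρ κ N x θh) (hd : 0 < d)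
    (hc : 0 < c) (hξ : 0 < ξ) (hξ1 : ξ ≤ 1) {θ₁ θ₂ : Param d} (h₁ : θ₁ ∈ Θ)
    (h₂ : θ₂ ∈ Θ) (i : Fin n) :
    |(n * piMix f ξ x θ₁ i)⁻¹ - (n * piMix f ξ x θ₂ i)⁻¹|
      ≤ (ξ⁻¹) ^ 2 * ((c⁻¹ + (C + 1) * (c⁻¹) ^ 2) * ‖θ₁ - θ₂‖ * G (x i)) := by
  have hn := h.cast_pos
  have hp₁ := h.isMixedProb hd hc hξ1 h₁
  have hp₂ := h.isMixedProb hd hc hξ1 h₂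
  have form : ∀ θ, n * piMix f ξ x θ i
      = (1 - ξ) * (‖score f (x i) θ‖ * ((n : ℝ)⁻¹ * ∑ j, ‖score f (x j) θ‖)⁻¹) + ξ := fun θ => by
    rw [piMix, piOpt, mul_inv, inv_inv, mul_add, mul_div_cancel₀ _ hn.ne']
    ring
  have hlip : ∀ i, |‖score f (x i) θ₁‖ - ‖score f (x i) θ₂‖| ≤ G (x i) * ‖θ₁ - θ₂‖ := fun i =>
    (abs_norm_sub_norm_le _ _).trans ((h.smooth i).gradient_lip θ₁ h₁ θ₂ h₂)
  have ha : |(n : ℝ)⁻¹ * ∑ j, ‖score f (x j) θ₁‖ - (n : ℝ)⁻¹ * ∑ j, ‖score f (x j) θ₂‖|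
      ≤ (C + 1) * ‖θ₁ - θ₂‖ := by
    rw [← mul_sub, ← Finset.sum_sub_distrib, abs_mul, abs_of_pos (inv_pos.2 hn)]
    calc _ ≤ (n : ℝ)⁻¹ * ∑ i, G (x i) * ‖θ₁ - θ₂‖ := by
          refine mul_le_mul_of_nonneg_left ?_ (by positivity)
          exact (Finset.abs_sum_le_sum_abs _ _).trans (Finset.sum_le_sum fun i _ => hlip i)
      _ = ((n : ℝ)⁻¹ * ∑ i, G (x i)) * ‖θ₁ - θ₂‖ := by rw [← Finset.sum_mul, mul_assoc]
      _ ≤ _ := mul_le_mul_of_nonneg_right h.avg_envelope_le (norm_nonneg _)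
  refine (abs_inv_sub_inv_le (hp₁.mul_pos hξ i) (hp₂.mul_pos hξ i) (hp₁.inv_le hξ i)
    (hp₂.inv_le hξ i)).trans (mul_le_mul_of_nonneg_left ?_ (sq_nonneg _))
  rw [form, form, add_sub_add_right_eq_sub, ← mul_sub, abs_mul, abs_of_nonneg (by linarith)]
  refine (mul_le_of_le_one_left (abs_nonneg _) (by linarith)).trans ?_
  exact abs_mul_inv_sub_mul_inv_le hc (h.le_avg_norm_score hd h₁) (h.le_avg_norm_score hd h₂)
    (hlip i) ha (norm_nonneg _) ((h.smooth i).norm_gradient_le θ₂ h₂)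

end GoodData

end GoodData

/-! Lindeberg's bound for characteristic functions -/

lemma norm_pow_sub_pow_le_mul {a b : ℂ} (ha : ‖a‖ ≤ 1) (hb : ‖b‖ ≤ 1) (r : ℕ) :
    ‖a ^ r - b ^ r‖ ≤ r * ‖a - b‖ := by
  induction r with
  | zero => simp
  | succ r ih =>
    have e : a ^ (r + 1) - b ^ (r + 1) = (a ^ r - b ^ r) * a + b ^ r * (a - b) := by ring
    rw [e]
    refine (norm_add_le _ _).trans ?_
    rw [norm_mul, norm_mul, norm_pow]
    have h1 : ‖a ^ r - b ^ r‖ * ‖a‖ ≤ r * ‖a - b‖ :=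
      (mul_le_of_le_one_right (norm_nonneg _) ha).trans ih
    have h2 : ‖b‖ ^ r * ‖a - b‖ ≤ ‖a - b‖ :=
      mul_le_of_le_one_left (norm_nonneg _) (pow_le_one₀ (norm_nonneg _) hb)
    push_cast
    linarith

lemma norm_cexp_sub_taylor_le_cube {u : ℝ} (hu : |u| ≤ 1) :
    ‖Complex.exp (u * Complex.I) - (1 + u * Complex.I - u ^ 2 / 2)‖ ≤ |u| ^ 3 := by
  have hn : ‖(u : ℂ) * Complex.I‖ = |u| := by simp
  have h := Complex.exp_bound (x := (u : ℂ) * Complex.I) (by rw [hn]; exact hu)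
    (n := 3) (by norm_num)
  have e : ∑ m ∈ Finset.range 3, ((u : ℂ) * Complex.I) ^ m / (m.factorial : ℂ)
      = 1 + u * Complex.I - u ^ 2 / 2 := by
    simp [Finset.sum_range_succ, mul_pow, Nat.factorial]
    ring
  rw [e, hn] at h
  refine h.trans (mul_le_of_le_one_right (by positivity) ?_)
  norm_num [Nat.factorial]

/-- The crude bound for large `u`, complementing the cubic one for small `u`; Lindeberg's argument
uses each on one side of a truncation level. -/
lemma norm_cexp_sub_taylor_le_sq (u : ℝ) :
    ‖Complex.exp (u * Complex.I) - (1 + u * Complex.I - u ^ 2 / 2)‖ ≤ 3 * u ^ 2 := by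
  have hn : ‖(u : ℂ) * Complex.I‖ = |u| := by simp
  have hsq : ‖(u : ℂ) ^ 2 / 2‖ = u ^ 2 / 2 := by simp
  have h1 : ‖Complex.exp (u * Complex.I) - 1 - u * Complex.I‖ ≤ 2 * u ^ 2 := by
    rcases le_or_gt |u| 1 with hu | hu
    · have := Complex.norm_exp_sub_one_sub_id_le (x := (u : ℂ) * Complex.I) (by rw [hn]; exact hu)
      rw [hn, sq_abs] at this
      linarith [sq_nonneg u]
    · have h2 : ‖Complex.exp (u * Complex.I) - 1‖ ≤ |u| := by
        have := Real.norm_exp_I_mul_ofReal_sub_one_le (x := u)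
        rwa [mul_comm, Real.norm_eq_abs] at this
      have h3 := norm_sub_le (Complex.exp (u * Complex.I) - 1) (u * Complex.I)
      rw [hn] at h3
      have h4 : |u| ≤ u ^ 2 := by rw [← sq_abs]; nlinarith
      linarith
  have e : Complex.exp (u * Complex.I) - (1 + u * Complex.I - u ^ 2 / 2)
      = (Complex.exp (u * Complex.I) - 1 - u * Complex.I) + u ^ 2 / 2 := by ring
  rw [e]
  refine (norm_add_le _ _).trans ?_
  rw [hsq]
  linarith [sq_nonneg u]

lemma abs_exp_neg_sub_exp_neg_le {a b : ℝ} (ha : 0 ≤ a) (hb : 0 ≤ b) :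
    |Real.exp (-a) - Real.exp (-b)| ≤ |a - b| := by
  wlog h : a ≤ b generalizing a b
  · rw [abs_sub_comm, abs_sub_comm a]
    exact this hb ha (not_le.1 h).le
  have h1 : Real.exp (-b) = Real.exp (-a) * Real.exp (a - b) := by rw [← Real.exp_add]; ring_nf
  have h2 := Real.add_one_le_exp (a - b)
  have h3 : Real.exp (-a) ≤ 1 := Real.exp_le_one_iff.2 (by linarith)
  have h4 := Real.exp_pos (-a)
  have h5 : Real.exp (-b) ≤ Real.exp (-a) := Real.exp_le_exp.2 (by linarith)
  rw [abs_of_nonneg (by linarith), abs_sub_comm, abs_of_nonneg (by linarith), h1]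
  nlinarith

section Lindeberg

variable {X : Type*} [MeasurableSpace X] {Q : Measure X} [IsProbabilityMeasure Q]

/-- Centring removes the linear term. Where `|y| ≤ K` the cubic remainder is at most `K * q * (q *
y) ^ 2`; elsewhere the quadratic bound gives the tail `τ`. -/
lemma norm_integral_cexp_sub_le {y : X → ℝ} (hy : MemLp y 2 Q) (h0 : ∫ i, y i ∂Q = 0)
    {S τ K : ℝ} (hS : ∫ i, y i ^ 2 ∂Q ≤ S)
    (hτ : ∫ i, (if K < |y i| then y i ^ 2 else 0) ∂Q ≤ τ) (hK : 0 ≤ K) {q : ℝ} (hq : 0 < q)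
    (hKq : K * q ≤ 1) :
    ‖∫ i, Complex.exp ((q * y i : ℝ) * Complex.I) ∂Q
        - ((1 - q ^ 2 * (∫ i, y i ^ 2 ∂Q) / 2 : ℝ) : ℂ)‖
      ≤ q ^ 2 * (K * q * S + 3 * τ) := by
  have hy1 : Integrable y Q := hy.integrable (by norm_num)
  have hy2 : Integrable (fun i => y i ^ 2) Q := hy.integrable_sq
  have hm : Measurable fun u : ℝ => if K < |u| then u ^ 2 else 0 :=
    Measurable.ite (measurableSet_lt measurable_const (by fun_prop)) (by fun_prop) measurable_const
  have hy3 : Integrable (fun i => if K < |y i| then y i ^ 2 else 0) Q := by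
    refine hy2.mono (hm.comp_aemeasurable hy.aestronglyMeasurable.aemeasurable).aestronglyMeasurable
      (ae_of_all _ fun i => ?_)
    split_ifs
    · exact le_rfl
    · simpa using sq_nonneg (y i)
  have hmeas : AEStronglyMeasurable (fun i => Complex.exp ((q * y i : ℝ) * Complex.I)) Q := by
    have hc : Continuous fun u : ℝ => Complex.exp ((q * u : ℝ) * Complex.I) := by fun_prop
    exact hc.comp_aestronglyMeasurable hy.aestronglyMeasurable
  have hexp : Integrable (fun i => Complex.exp ((q * y i : ℝ) * Complex.I)) Q := by
    refine Integrable.of_bound hmeas 1 (ae_of_all _ fun i => ?_)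
    rw [Complex.norm_exp_ofReal_mul_I]
  have hlin : Integrable (fun i => ((q * y i : ℝ) : ℂ) * Complex.I) Q :=
    ((hy1.const_mul q).ofReal).mul_const _
  have hquad : Integrable (fun i => (((q * y i : ℝ) : ℂ)) ^ 2 / 2) Q := by
    have h : Integrable (fun i => ((q ^ 2 / 2 * y i ^ 2 : ℝ) : ℂ)) Q :=
      (hy2.const_mul (q ^ 2 / 2)).ofReal
    refine h.congr (ae_of_all _ fun i => ?_)
    push_cast
    ring
  have hT : Integrable
      (fun i => 1 + ((q * y i : ℝ) : ℂ) * Complex.I - (((q * y i : ℝ) : ℂ)) ^ 2 / 2) Q :=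
    ((integrable_const _).add hlin).sub hquad
  have eT : ∫ i, (1 + ((q * y i : ℝ) : ℂ) * Complex.I - (((q * y i : ℝ) : ℂ)) ^ 2 / 2) ∂Q
      = ((1 - q ^ 2 * (∫ i, y i ^ 2 ∂Q) / 2 : ℝ) : ℂ) := by
    have h1lin : Integrable (fun i => 1 + ((q * y i : ℝ) : ℂ) * Complex.I) Q :=
      (integrable_const _).add hlin
    rw [integral_sub h1lin hquad, integral_add (integrable_const _) hlin,
      integral_mul_const, integral_complex_ofReal, integral_const_mul, h0]
    have : ∫ i, (((q * y i : ℝ) : ℂ)) ^ 2 / 2 ∂Q = ((q ^ 2 * (∫ i, y i ^ 2 ∂Q) / 2 : ℝ) : ℂ) := by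
      have e : ∀ i, (((q * y i : ℝ) : ℂ)) ^ 2 / 2 = ((q ^ 2 / 2 * y i ^ 2 : ℝ) : ℂ) := fun i => by
        push_cast
        ring
      simp only [e]
      rw [integral_complex_ofReal, integral_const_mul]
      congr 1
      ring
    rw [this]
    simp
  rw [← eT, ← integral_sub hexp hT]
  have hbound : ∀ i, ‖Complex.exp ((q * y i : ℝ) * Complex.I)
      - (1 + ((q * y i : ℝ) : ℂ) * Complex.I - (((q * y i : ℝ) : ℂ)) ^ 2 / 2)‖
      ≤ q ^ 2 * (K * q * y i ^ 2 + 3 * (if K < |y i| then y i ^ 2 else 0)) := fun i => by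
    split_ifs with h
    · refine (norm_cexp_sub_taylor_le_sq (q * y i)).trans ?_
      have : 0 ≤ K * q * y i ^ 2 := by positivity
      nlinarith [sq_nonneg q]
    · have h' := not_lt.1 h
      have h1 : |q * y i| ≤ q * K := by
        rw [abs_mul, abs_of_pos hq]
        gcongr
      refine (norm_cexp_sub_taylor_le_cube (h1.trans (by linarith))).trans ?_
      calc |q * y i| ^ 3 = |q * y i| * (q * y i) ^ 2 := by rw [pow_succ', sq_abs]
        _ ≤ q * K * (q * y i) ^ 2 := by gcongr
        _ = _ := by ring
  refine (norm_integral_le_of_norm_le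
    (((hy2.const_mul (K * q)).add (hy3.const_mul 3)).const_mul (q ^ 2)) (ae_of_all _ hbound)).trans ?_
  rw [integral_const_mul]
  have e2 : ∫ i, ((fun i => K * q * y i ^ 2) + fun i => 3 * (if K < |y i| then y i ^ 2 else 0)) i ∂Q
      = K * q * ∫ i, y i ^ 2 ∂Q + 3 * ∫ i, (if K < |y i| then y i ^ 2 else 0) ∂Q := by
    rw [integral_add' (hy2.const_mul (K * q)) (hy3.const_mul 3), integral_const_mul,
      integral_const_mul]
  rw [e2]
  gcongr

/-- Lindeberg's bound for the characteristic function of a standardized sum. -/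
lemma norm_integral_cexp_pow_sub_le {y : X → ℝ} (hy : MemLp y 2 Q) (h0 : ∫ i, y i ∂Q = 0)
    {S τ K : ℝ} (hS : ∫ i, y i ^ 2 ∂Q ≤ S)
    (hτ : ∫ i, (if K < |y i| then y i ^ 2 else 0) ∂Q ≤ τ) (hK : 0 ≤ K) {r : ℕ} (hr : 0 < r)
    (hKr : K ≤ Real.sqrt r) (hSr : S ≤ r) :
    ‖(∫ i, Complex.exp (((Real.sqrt r)⁻¹ * y i : ℝ) * Complex.I) ∂Q) ^ r
        - (Real.exp (-((∫ i, y i ^ 2 ∂Q) / 2)) : ℝ)‖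
      ≤ K * S / Real.sqrt r + 3 * τ + S ^ 2 / r := by
  have hr' : (0 : ℝ) < r := by exact_mod_cast hr
  have hsr : 0 < Real.sqrt r := Real.sqrt_pos.2 hr'
  set q := (Real.sqrt r)⁻¹ with hq
  have hq2 : q ^ 2 = (r : ℝ)⁻¹ := by rw [hq, inv_pow, Real.sq_sqrt hr'.le]
  set v := ∫ i, y i ^ 2 ∂Q with hv
  have hv0 : 0 ≤ v := integral_nonneg fun i => sq_nonneg _
  have hKq : K * q ≤ 1 := by
    rw [hq, ← div_eq_mul_inv, div_le_one hsr]
    exact hKr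
  have h1 := norm_integral_cexp_sub_le hy h0 hS hτ hK (inv_pos.2 hsr) hKq
  rw [← hq, ← hv] at h1
  -- The Gaussian limit is `b ^ r`, so comparing `r`-th powers costs `r` times the error of one
  -- factor; the second order error of `b`, at most `(S / r) ^ 2`, becomes `S ^ 2 / r`.
  set b : ℝ := Real.exp (-(v / (2 * r))) with hb
  have hb1 : b ≤ 1 := Real.exp_le_one_iff.2 (by
    have : 0 ≤ v / (2 * r) := by positivity
    linarith)
  have hbr : (Real.exp (-(v / 2)) : ℂ) = (b : ℂ) ^ r := by
    rw [← Complex.ofReal_pow, hb, ← Real.exp_nat_mul]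
    congr 3
    field_simp
  have h2 : |(1 - q ^ 2 * v / 2) - b| ≤ (v / (2 * r)) ^ 2 := by
    have := Real.abs_exp_sub_one_sub_id_le (x := -(v / (2 * r))) (by
      rw [abs_neg, abs_of_nonneg (by positivity), div_le_one (by positivity)]
      linarith)
    rw [abs_sub_comm, hb, hq2]
    have e : Real.exp (-(v / (2 * r))) - (1 - (r : ℝ)⁻¹ * v / 2)
        = Real.exp (-(v / (2 * r))) - 1 - -(v / (2 * r)) := by
      field_simp
      ring
    rw [e]
    simpa using this
  have ha1 : ‖∫ i, Complex.exp ((q * y i : ℝ) * Complex.I) ∂Q‖ ≤ 1 := by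
    refine (norm_integral_le_integral_norm _).trans (le_of_eq ?_)
    simp only [Complex.norm_exp_ofReal_mul_I]
    simp
  have hbn : ‖(b : ℂ)‖ ≤ 1 := by
    rw [Complex.norm_real, Real.norm_eq_abs, abs_of_pos (Real.exp_pos _)]
    exact hb1
  rw [show ((Real.exp (-(v / 2)) : ℝ) : ℂ) = (b : ℂ) ^ r from hbr]
  refine (norm_pow_sub_pow_le_mul ha1 hbn r).trans ?_
  have h3 : ‖∫ i, Complex.exp ((q * y i : ℝ) * Complex.I) ∂Q - b‖
      ≤ q ^ 2 * (K * q * S + 3 * τ) + (v / (2 * r)) ^ 2 := by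
    have h4 : ‖((1 - q ^ 2 * v / 2 : ℝ) : ℂ) - (b : ℂ)‖ ≤ (v / (2 * r)) ^ 2 := by
      rw [← Complex.ofReal_sub, Complex.norm_real, Real.norm_eq_abs]
      exact h2
    have h5 := norm_sub_le_norm_sub_add_norm_sub
      (∫ i, Complex.exp ((q * y i : ℝ) * Complex.I) ∂Q) ((1 - q ^ 2 * v / 2 : ℝ) : ℂ) (b : ℂ)
    linarith
  have h6 : (v / (2 * r)) ^ 2 ≤ (S / r) ^ 2 := by
    refine pow_le_pow_left₀ (by positivity) ?_ 2
    rw [div_le_div_iff₀ (by positivity) hr']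
    nlinarith
  calc _ ≤ (r : ℝ) * (q ^ 2 * (K * q * S + 3 * τ) + (S / r) ^ 2) := by
        refine mul_le_mul_of_nonneg_left ?_ hr'.le
        linarith
    _ = _ := by
        rw [hq2, hq]
        field_simp

end Lindeberg

/-! Conditional characteristic function of the leading term -/

/-- The leading term of `√r V^{-1/2} (θ̃ - θ̂)`. -/
def linRDS {d : ℕ} (f : Param d → ℝ → ℝ) (ξ : ℝ) {n r : ℕ} (x : Fin n → Obs) (θh θp : Param d)
    (K : Fin r → Fin n) : Param d :=
  -(Real.sqrt r • matOp (invSqrt (covRDS f ξ x θh)) (matOp (avgHess f x θh)⁻¹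
    (gradient (subObj (piMix f ξ x θp) (fun i => logLik f (x i)) K) θh)))

namespace GoodData

variable {d : ℕ} {f : Param d → ℝ → ℝ} {Θ : Set (Param d)} {G : Obs → ℝ} {C lam c ρ : ℝ}
  {κ : ℕ → ℝ} {N n : ℕ} {x : Fin n → Obs} {θh : Param d} {ξ : ℝ}

lemma inner_linRDS (h : GoodData f Θ G C lam c ρ κ N x θh) (hρ : 0 < ρ) {r : ℕ} (hr : 0 < r)
    (θp : Param d) (K : Fin r → Fin n) (t : Param d) :
    inner ℝ (linRDS f ξ x θh θp K) t = ∑ k, (Real.sqrt r)⁻¹ *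
      (-((n * piMix f ξ x θp (K k))⁻¹ * inner ℝ (score f (x (K k)) θh) (dirRDS f ξ x θh t))) := by
  have hr' : (0 : ℝ) < r := by exact_mod_cast hr
  have hsr := Real.sqrt_pos.2 hr'
  rw [linRDS, inner_neg_left, inner_smul_left, h.inner_invSqrt_inv hρ,
    gradient_subObj h.smooth (h.mem hρ), inner_smul_left, sum_inner, ← Finset.mul_sum,
    Finset.sum_neg_distrib]
  simp only [inner_smul_left, RCLike.conj_to_real]
  have e : Real.sqrt r * (r : ℝ)⁻¹ = (Real.sqrt r)⁻¹ := by
    rw [← div_eq_mul_inv, Real.sqrt_div_self]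
  rw [← mul_assoc, e, mul_neg]
  rfl

lemma integral_cexp_inner_linRDS (h : GoodData f Θ G C lam c ρ κ N x θh) (hρ : 0 < ρ) {r : ℕ}
    (hr : 0 < r) (θp t : Param d) [IsProbabilityMeasure (drawLaw (piMix f ξ x θp))] :
    ∫ K, Complex.exp ((inner ℝ (linRDS f ξ x θh θp K) t : ℝ) * Complex.I)
        ∂(drawsLaw r (piMix f ξ x θp))
      = (∫ i, Complex.exp (((Real.sqrt r)⁻¹ *
          (-((n * piMix f ξ x θp i)⁻¹ * inner ℝ (score f (x i) θh) (dirRDS f ξ x θh t))) : ℝ)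
            * Complex.I) ∂(drawLaw (piMix f ξ x θp))) ^ r := by
  have e := integral_fintype_prod_eq_pow (ι := Fin r) (𝕜 := ℂ) (μ := drawLaw (piMix f ξ x θp))
    (fun i => Complex.exp (((Real.sqrt r)⁻¹ *
          (-((n * piMix f ξ x θp i)⁻¹ * inner ℝ (score f (x i) θh) (dirRDS f ξ x θh t))) : ℝ)
            * Complex.I))
  rw [Fintype.card_fin] at e
  rw [← e, drawsLaw]
  refine integral_congr_ae (ae_of_all _ fun K => ?_)
  dsimp only
  rw [h.inner_linRDS hρ hr, ← Complex.exp_sum, Complex.ofReal_sum, Finset.sum_mul]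

/-- The variance of the leading term is close to one in every direction. -/
lemma abs_avg_sub_le (h : GoodData f Θ G C lam c ρ κ N x θh) (hd : 0 < d) (hρ : 0 < ρ)
    (hlam : 0 < lam) (hc : 0 < c) (hC : 0 < C) (hξ : 0 < ξ) (hξ1 : ξ ≤ 1) {θp : Param d}
    (hθp : θp ∈ Θ) {δ : ℝ} (hδ : ‖θp - θh‖ ≤ δ) {j : ℕ} (hj : j ≤ N) (t : Param d) :
    |(n : ℝ)⁻¹ * ∑ i, (n * piMix f ξ x θp i)⁻¹ *
        (inner ℝ (score f (x i) θh) (dirRDS f ξ x θh t)) ^ 2 - ‖t‖ ^ 2|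
      ≤ (c⁻¹ * ‖t‖) ^ 2 * (ξ⁻¹ * (1 / (j + 1))
        + (ξ⁻¹) ^ 2 * (c⁻¹ + (C + 1) * (c⁻¹) ^ 2) * δ * |κ j| * C) := by
  have hn := h.cast_pos
  have hθh := h.mem hρ
  have hp := h.isMixedProb hd hc hξ1 hθp
  have hp' := h.isMixedProb hd hc hξ1 hθh
  set u := dirRDS f ξ x θh t with hu
  have hunorm : ‖u‖ ≤ c⁻¹ * ‖t‖ := h.norm_dir_le hd hρ hlam hc hξ hξ1 t
  set D := c⁻¹ + (C + 1) * (c⁻¹) ^ 2 with hD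
  have hD0 : 0 ≤ D := by positivity
  have hδ0 : 0 ≤ δ := (norm_nonneg _).trans hδ
  have hG : ∀ i, 0 ≤ G (x i) := fun i => (h.smooth i).nonneg ⟨θh, hθh⟩
  have hvar : (n : ℝ)⁻¹ * ∑ i, (n * piMix f ξ x θh i)⁻¹ *
      (inner ℝ (score f (x i) θh) u) ^ 2 = ‖t‖ ^ 2 := by
    rw [← h.inner_lambdaRDS_dir hd hρ hlam hc hξ hξ1 t, h.inner_lambdaRDS]
    simp only [real_inner_comm, hu]
  rw [← hvar, ← mul_sub, ← Finset.sum_sub_distrib, abs_mul, abs_of_pos (inv_pos.2 hn)]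
  have hterm : ∀ i, |(n * piMix f ξ x θp i)⁻¹ * (inner ℝ (score f (x i) θh) u) ^ 2
      - (n * piMix f ξ x θh i)⁻¹ * (inner ℝ (score f (x i) θh) u) ^ 2|
      ≤ (c⁻¹ * ‖t‖) ^ 2 * (ξ⁻¹ * (if κ j < G (x i) then G (x i) ^ 2 else 0)
        + (ξ⁻¹) ^ 2 * D * δ * |κ j| * G (x i) ^ 2) := by
    intro i
    rw [← sub_mul, abs_mul, abs_of_nonneg (sq_nonneg (inner ℝ (score f (x i) θh) u))]
    have h1 : (inner ℝ (score f (x i) θh) u) ^ 2 ≤ (c⁻¹ * ‖t‖) ^ 2 * G (x i) ^ 2 := by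
      rw [← sq_abs, ← mul_pow]
      refine pow_le_pow_left₀ (abs_nonneg _) ?_ 2
      refine (abs_real_inner_le_norm _ _).trans ?_
      rw [mul_comm]
      exact mul_le_mul hunorm ((h.smooth i).norm_gradient_le θh hθh) (norm_nonneg _) (by positivity)
    have h2 : |(n * piMix f ξ x θp i)⁻¹ - (n * piMix f ξ x θh i)⁻¹| ≤ ξ⁻¹ :=
      abs_sub_le_of_nonneg_of_le (inv_nonneg.2 (hp.mul_pos hξ i).le) (hp.inv_le hξ i)
        (inv_nonneg.2 (hp'.mul_pos hξ i).le) (hp'.inv_le hξ i)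
    have h3 : |(n * piMix f ξ x θp i)⁻¹ - (n * piMix f ξ x θh i)⁻¹|
        ≤ (ξ⁻¹) ^ 2 * D * δ * G (x i) := by
      refine (h.abs_weight_sub_le hd hc hξ hξ1 hθp hθh i).trans ?_
      have := hG i
      calc _ ≤ (ξ⁻¹) ^ 2 * (D * δ * G (x i)) := by gcongr
        _ = _ := by ring
    have h4 : |(n * piMix f ξ x θp i)⁻¹ - (n * piMix f ξ x θh i)⁻¹| * G (x i) ^ 2
        ≤ ξ⁻¹ * (if κ j < G (x i) then G (x i) ^ 2 else 0)
          + (ξ⁻¹) ^ 2 * D * δ * |κ j| * G (x i) ^ 2 := by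
      -- For `G` above `κ j` the weights differ by at most `ξ⁻¹`, and the tail condition takes over.
      -- Below it one factor `G` of the Lipschitz bound is replaced by `|κ j|`, which avoids a third
      -- moment of `G`.
      split_ifs with hκ
      · have k1 := mul_le_mul_of_nonneg_right h2 (sq_nonneg (G (x i)))
        have k2 : 0 ≤ (ξ⁻¹) ^ 2 * D * δ * |κ j| * G (x i) ^ 2 := by positivity
        linarith
      · have k1 : G (x i) ≤ |κ j| := (not_lt.1 hκ).trans (le_abs_self _)
        have k2 : (ξ⁻¹) ^ 2 * D * δ * G (x i) ≤ (ξ⁻¹) ^ 2 * D * δ * |κ j| := by gcongr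
        have k3 := mul_le_mul_of_nonneg_right (h3.trans k2) (sq_nonneg (G (x i)))
        linarith
    calc _ ≤ |(n * piMix f ξ x θp i)⁻¹ - (n * piMix f ξ x θh i)⁻¹|
          * ((c⁻¹ * ‖t‖) ^ 2 * G (x i) ^ 2) := by gcongr
      _ = (c⁻¹ * ‖t‖) ^ 2 * (|(n * piMix f ξ x θp i)⁻¹ - (n * piMix f ξ x θh i)⁻¹|
          * G (x i) ^ 2) := by ring
      _ ≤ _ := by gcongr
  have h5 := h.tail j hj
  have h6 := h.avg_sq
  calc _ ≤ (n : ℝ)⁻¹ * ∑ i, (c⁻¹ * ‖t‖) ^ 2 *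
        (ξ⁻¹ * (if κ j < G (x i) then G (x i) ^ 2 else 0)
          + (ξ⁻¹) ^ 2 * D * δ * |κ j| * G (x i) ^ 2) := by
        refine mul_le_mul_of_nonneg_left ?_ (by positivity)
        exact (Finset.abs_sum_le_sum_abs _ _).trans (Finset.sum_le_sum fun i _ => hterm i)
    _ = (c⁻¹ * ‖t‖) ^ 2 * (ξ⁻¹ * ((n : ℝ)⁻¹ * ∑ i, (if κ j < G (x i) then G (x i) ^ 2 else 0))
          + (ξ⁻¹) ^ 2 * D * δ * |κ j| * ((n : ℝ)⁻¹ * ∑ i, G (x i) ^ 2)) := by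
        rw [← Finset.mul_sum, Finset.sum_add_distrib, ← Finset.mul_sum, ← Finset.mul_sum]
        ring
    _ ≤ _ := by gcongr

/-- An explicit bound for the characteristic function of the leading term. -/
lemma norm_integral_cexp_linRDS_sub_le (h : GoodData f Θ G C lam c ρ κ N x θh) (hd : 0 < d)
    (hρ : 0 < ρ) (hlam : 0 < lam) (hc : 0 < c) (hC : 0 < C) (hξ : 0 < ξ) (hξ1 : ξ ≤ 1)
    {θp : Param d} (hθp : θp ∈ Θ) {δ : ℝ} (hδ : ‖θp - θh‖ ≤ δ) {j : ℕ} (hj : j ≤ N) (t : Param d)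
    {r : ℕ} (hr : 0 < r) (hKr : ξ⁻¹ * (c⁻¹ * ‖t‖) * |κ j| ≤ Real.sqrt r)
    (hSr : ξ⁻¹ * ((c⁻¹ * ‖t‖) ^ 2 * C) ≤ r) :
    ‖∫ K, Complex.exp ((inner ℝ (linRDS f ξ x θh θp K) t : ℝ) * Complex.I)
        ∂(drawsLaw r (piMix f ξ x θp)) - (Real.exp (-(‖t‖ ^ 2 / 2)) : ℝ)‖
      ≤ ξ⁻¹ * (c⁻¹ * ‖t‖) * |κ j| * (ξ⁻¹ * ((c⁻¹ * ‖t‖) ^ 2 * C)) / Real.sqrt r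
        + 3 * (ξ⁻¹ * ((c⁻¹ * ‖t‖) ^ 2 * (1 / (j + 1)))) + (ξ⁻¹ * ((c⁻¹ * ‖t‖) ^ 2 * C)) ^ 2 / r
        + (c⁻¹ * ‖t‖) ^ 2 * (ξ⁻¹ * (1 / (j + 1))
          + (ξ⁻¹) ^ 2 * (c⁻¹ + (C + 1) * (c⁻¹) ^ 2) * δ * |κ j| * C) / 2 := by
  have hn := h.cast_pos
  have hθh := h.mem hρ
  have hp := h.isMixedProb hd hc hξ1 hθp
  have hpr := hp.isProbabilityMeasure hξ
  set u := dirRDS f ξ x θh t with hu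
  have hunorm : ‖u‖ ≤ c⁻¹ * ‖t‖ := h.norm_dir_le hd hρ hlam hc hξ hξ1 t
  have hG : ∀ i, 0 ≤ G (x i) := fun i => (h.smooth i).nonneg ⟨θh, hθh⟩
  set U := c⁻¹ * ‖t‖ with hU
  have hU0 : 0 ≤ U := by positivity
  set y : Fin n → ℝ := fun i => -((n * piMix f ξ x θp i)⁻¹ * inner ℝ (score f (x i) θh) u) with hy
  have hin : ∀ i, |inner ℝ (score f (x i) θh) u| ≤ U * G (x i) := fun i => by
    refine (abs_real_inner_le_norm _ _).trans ?_
    rw [mul_comm]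
    exact mul_le_mul hunorm ((h.smooth i).norm_gradient_le θh hθh) (norm_nonneg _) hU0
  have hyabs : ∀ i, |y i| ≤ ξ⁻¹ * U * G (x i) := fun i => by
    rw [hy]
    dsimp only
    rw [abs_neg, abs_mul, abs_of_pos (inv_pos.2 (hp.mul_pos hξ i)), mul_assoc]
    exact mul_le_mul (hp.inv_le hξ i) (hin i) (abs_nonneg _) (inv_nonneg.2 hξ.le)
  have hpy : ∀ i, piMix f ξ x θp i * y i ^ 2
      = (n : ℝ)⁻¹ * ((n * piMix f ξ x θp i)⁻¹ * (inner ℝ (score f (x i) θh) u) ^ 2) := fun i => by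
    rw [← hp.mul_inv hξ i]
    simp only [hy]
    ring
  have hpyle : ∀ i, piMix f ξ x θp i * y i ^ 2 ≤ (n : ℝ)⁻¹ * (ξ⁻¹ * (U ^ 2 * G (x i) ^ 2)) :=
    fun i => by
      rw [hpy, ← sq_abs (inner ℝ (score f (x i) θh) u), ← mul_pow]
      have := hp.inv_le hξ i
      have := hin i
      gcongr
  -- Centring is exact even though the probabilities come from the pilot: weighting is unbiased and
  -- the full gradient vanishes at `θ̂`.
  have h0 : ∫ i, y i ∂(drawLaw (piMix f ξ x θp)) = 0 := by
    have e : ∀ i, y i = (n * piMix f ξ x θp i)⁻¹ • (-inner ℝ (score f (x i) θh) u) := fun i => by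
      simp [hy]
    simp only [e]
    rw [hp.integral_weighted hξ]
    have hg := h.gradient_eq_zero
    rw [gradient_avgObj h.smooth hθh] at hg
    have := congrArg (fun w => inner ℝ w u) hg
    simp only [sum_inner, inner_smul_left, inner_zero_left, RCLike.conj_to_real] at this
    simp only [smul_eq_mul, mul_neg, Finset.sum_neg_distrib, neg_eq_zero]
    exact this
  have hvar : ∫ i, y i ^ 2 ∂(drawLaw (piMix f ξ x θp))
      = (n : ℝ)⁻¹ * ∑ i, (n * piMix f ξ x θp i)⁻¹ * (inner ℝ (score f (x i) θh) u) ^ 2 := by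
    rw [integral_drawLaw fun i => (hp.pos hξ i).le, Finset.mul_sum]
    exact Finset.sum_congr rfl fun i _ => by rw [smul_eq_mul, hpy]
  have hS : ∫ i, y i ^ 2 ∂(drawLaw (piMix f ξ x θp)) ≤ ξ⁻¹ * (U ^ 2 * C) := by
    rw [integral_drawLaw fun i => (hp.pos hξ i).le]
    calc _ ≤ ∑ i, (n : ℝ)⁻¹ * (ξ⁻¹ * (U ^ 2 * G (x i) ^ 2)) :=
          Finset.sum_le_sum fun i _ => by rw [smul_eq_mul]; exact hpyle i
      _ = ξ⁻¹ * (U ^ 2 * ((n : ℝ)⁻¹ * ∑ i, G (x i) ^ 2)) := by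
          simp only [Finset.mul_sum]
          exact Finset.sum_congr rfl fun i _ => by ring
      _ ≤ _ := by
          have := h.avg_sq
          gcongr
  -- As `|y i| ≤ ξ⁻¹ * U * G (x i)`, a value of `|y i|` beyond this level forces `κ j < G (x i)`, so
  -- the tail condition on the data supplies the Lindeberg condition.
  have hτ : ∫ i, (if ξ⁻¹ * U * |κ j| < |y i| then y i ^ 2 else 0) ∂(drawLaw (piMix f ξ x θp))
      ≤ ξ⁻¹ * (U ^ 2 * (1 / (j + 1))) := by
    rw [integral_drawLaw fun i => (hp.pos hξ i).le]
    calc _ ≤ ∑ i, (n : ℝ)⁻¹ * (ξ⁻¹ * (U ^ 2 * (if κ j < G (x i) then G (x i) ^ 2 else 0))) := by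
          refine Finset.sum_le_sum fun i _ => ?_
          by_cases hκ : κ j < G (x i)
          · rw [if_pos hκ]
            refine le_trans ?_ (hpyle i)
            rw [smul_eq_mul]
            refine mul_le_mul_of_nonneg_left ?_ (hp.pos hξ i).le
            split_ifs
            · exact le_rfl
            · positivity
          · have : ¬ ξ⁻¹ * U * |κ j| < |y i| := by
              refine not_lt.2 ((hyabs i).trans ?_)
              have := (not_lt.1 hκ).trans (le_abs_self _)
              gcongr
            rw [if_neg hκ, if_neg this]
            simp
      _ = ξ⁻¹ * (U ^ 2 * ((n : ℝ)⁻¹ * ∑ i, (if κ j < G (x i) then G (x i) ^ 2 else 0))) := by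
          simp only [Finset.mul_sum]
          exact Finset.sum_congr rfl fun i _ => by ring
      _ ≤ _ := by
          have := h.tail j hj
          gcongr
  have hmain := norm_integral_cexp_pow_sub_le (Q := drawLaw (piMix f ξ x θp)) (y := y)
    MemLp.of_discrete h0 hS hτ (by positivity) hr hKr hSr
  have hsub := h.abs_avg_sub_le hd hρ hlam hc hC hξ hξ1 hθp hδ hj t
  rw [← hu, ← hvar, ← hU] at hsub
  rw [h.integral_cexp_inner_linRDS hρ hr]
  have hexp : ‖((Real.exp (-((∫ i, y i ^ 2 ∂(drawLaw (piMix f ξ x θp))) / 2)) : ℝ) : ℂ)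
      - (Real.exp (-(‖t‖ ^ 2 / 2)) : ℝ)‖
      ≤ U ^ 2 * (ξ⁻¹ * (1 / (j + 1))
          + (ξ⁻¹) ^ 2 * (c⁻¹ + (C + 1) * (c⁻¹) ^ 2) * δ * |κ j| * C) / 2 := by
    rw [← Complex.ofReal_sub, Complex.norm_real, Real.norm_eq_abs]
    refine (abs_exp_neg_sub_exp_neg_le
      (div_nonneg (integral_nonneg fun i => sq_nonneg _) zero_le_two) (by positivity)).trans ?_
    rw [← sub_div, abs_div, abs_two]
    gcongr
  exact (norm_sub_le_norm_sub_add_norm_sub _ _ _).trans (add_le_add hmain hexp)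

end GoodData

/-- Along good data the characteristic function of the leading term is close to the Gaussian one. -/
lemma exists_norm_integral_cexp_linRDS_le {d : ℕ} {f : Param d → ℝ → ℝ} {Θ : Set (Param d)}
    {G : Obs → ℝ} {C lam c ρ : ℝ} {κ : ℕ → ℝ} {ξ : ℝ} (hd : 0 < d)
    (hρ : 0 < ρ) (hlam : 0 < lam) (hc : 0 < c) (hC : 0 < C) (hξ : 0 < ξ) (hξ1 : ξ ≤ 1)
    (t : Param d) {ε : ℝ} (hε : 0 < ε) :
    ∃ N₀ : ℕ, ∀ {N n r : ℕ} {x : Fin n → Obs} {θh θp : Param d}, N₀ ≤ N → N ≤ r →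
      GoodData f Θ G C lam c ρ κ N x θh → θp ∈ Θ → ‖θp - θh‖ ≤ 1 / (N + 1) →
      ‖∫ K, Complex.exp ((inner ℝ (linRDS f ξ x θh θp K) t : ℝ) * Complex.I)
        ∂(drawsLaw r (piMix f ξ x θp)) - (Real.exp (-(‖t‖ ^ 2 / 2)) : ℝ)‖ ≤ ε := by
  set U := c⁻¹ * ‖t‖ with hU
  have hU0 : 0 ≤ U := by positivity
  set S := ξ⁻¹ * (U ^ 2 * C) with hS
  -- The tail terms carry the coefficients `3` and `1 / 2`, covered by `4`. Once `j` is fixed, `κ j`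
  -- is a constant and every other term vanishes as `N` grows.
  have hj : ∃ j : ℕ, 4 * (ξ⁻¹ * U ^ 2) * (1 / ((j : ℝ) + 1)) < ε / 2 := by
    have : Tendsto (fun j : ℕ => 4 * (ξ⁻¹ * U ^ 2) * (1 / ((j : ℝ) + 1))) atTop (𝓝 0) := by
      simpa using (tendsto_one_div_add_atTop_nhds_zero_nat (𝕜 := ℝ)).const_mul (4 * (ξ⁻¹ * U ^ 2))
    exact ((tendsto_order.1 this).2 _ (half_pos hε)).exists
  obtain ⟨j, hj⟩ := hj
  set E := ξ⁻¹ * U * |κ j| with hE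
  have hE0 : 0 ≤ E := by positivity
  have hS0 : 0 ≤ S := by positivity
  set B := U ^ 2 * ((ξ⁻¹) ^ 2 * (c⁻¹ + (C + 1) * (c⁻¹) ^ 2) * |κ j| * C) with hB
  have hB0 : 0 ≤ B := by positivity
  have hsqrt : Tendsto (fun N : ℕ => Real.sqrt N) atTop atTop :=
    Real.tendsto_sqrt_atTop.comp tendsto_natCast_atTop_atTop
  have hlim : Tendsto (fun N : ℕ => E * S / Real.sqrt N + S ^ 2 / N + B * (1 / ((N : ℝ) + 1)))
      atTop (𝓝 0) := by
    have h1 : Tendsto (fun N : ℕ => E * S / Real.sqrt N) atTop (𝓝 0) :=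
      tendsto_const_nhds.div_atTop hsqrt
    have h2 : Tendsto (fun N : ℕ => S ^ 2 / (N : ℝ)) atTop (𝓝 0) :=
      tendsto_const_nhds.div_atTop tendsto_natCast_atTop_atTop
    have h3 : Tendsto (fun N : ℕ => B * (1 / ((N : ℝ) + 1))) atTop (𝓝 0) := by
      simpa using (tendsto_one_div_add_atTop_nhds_zero_nat (𝕜 := ℝ)).const_mul B
    simpa using (h1.add h2).add h3
  have hev := ((tendsto_order.1 hlim).2 _ (half_pos hε)).and
    ((hsqrt.eventually_ge_atTop E).and ((tendsto_natCast_atTop_atTop.eventually_ge_atTop S).and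
      ((eventually_ge_atTop j).and (eventually_gt_atTop 0))))
  obtain ⟨N₀, hN₀⟩ := eventually_atTop.1 hev
  refine ⟨N₀, fun {N n r x θh θp} hN hNr h hθp hδ => ?_⟩
  obtain ⟨e1, e2, e3, e4, e5⟩ := hN₀ N hN
  have hNr' : (N : ℝ) ≤ r := by exact_mod_cast hNr
  have hN0 : (0 : ℝ) < N := by exact_mod_cast e5
  have hsN : 0 < Real.sqrt N := Real.sqrt_pos.2 hN0
  have hsr : Real.sqrt N ≤ Real.sqrt r := Real.sqrt_le_sqrt hNr'
  have := h.norm_integral_cexp_linRDS_sub_le hd hρ hlam hc hC hξ hξ1 hθp hδ e4 t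
    (e5.trans_le hNr) (e2.trans hsr) (e3.trans hNr')
  rw [← hU, ← hS, ← hE] at this
  have k1 : E * S / Real.sqrt r ≤ E * S / Real.sqrt N := by gcongr
  have k2 : S ^ 2 / r ≤ S ^ 2 / (N : ℝ) := by gcongr
  have k3 : U ^ 2 * (ξ⁻¹ * (1 / (j + 1))
          + (ξ⁻¹) ^ 2 * (c⁻¹ + (C + 1) * (c⁻¹) ^ 2) * (1 / ((N : ℝ) + 1)) * |κ j| * C) / 2
      = (ξ⁻¹ * U ^ 2) * (1 / (j + 1)) / 2 + B * (1 / ((N : ℝ) + 1)) / 2 := by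
    rw [hB]; ring
  have k4 : 3 * (ξ⁻¹ * (U ^ 2 * (1 / ((j : ℝ) + 1)))) = 3 * (ξ⁻¹ * U ^ 2) * (1 / (j + 1)) := by ring
  have k5 : 0 ≤ (ξ⁻¹ * U ^ 2) * (1 / ((j : ℝ) + 1)) := by positivity
  have k6 : 0 ≤ B * (1 / ((N : ℝ) + 1)) := by positivity
  rw [k3, k4] at this
  linarith

/-! Conditional asymptotic normality -/

section Expansion

variable {d : ℕ} {f : Param d → ℝ → ℝ} {Θ : Set (Param d)} {G : Obs → ℝ} {C lam c ρ : ℝ}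
  {κ : ℕ → ℝ} {ξ : ℝ}

/-- The estimation error is the leading term plus a remainder, for subsamples at which the
Hessian and the gradient of the objective are under control. -/
lemma GoodData.norm_sub_linRDS_le {N n r : ℕ} {x : Fin n → Obs} {θh θp : Param d}
    (h : GoodData f Θ G C lam c ρ κ N x θh) (hd : 0 < d) (hconv : Convex ℝ Θ)
    (hρ : 0 < ρ) (hlam : 0 < lam) (hc : 0 < c) (hC : 0 < C) (hξ : 0 < ξ) (hξ1 : ξ ≤ 1)
    (hr : 0 < r) {K : Fin r → Fin n} {θ : Param d}
    (hθ : IsArgmax Θ (subObj (piMix f ξ x θp) (fun i => logLik f (x i)) K) θ)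
    {η b : ℝ} (hη : η ≤ lam / (2 * d)) (hη0 : 0 ≤ η)
    (hHess : ∀ θ ∈ Θ, ∀ j k, |hessian (subObj (piMix f ξ x θp) (fun i => logLik f (x i)) K) θ j k
      - hessian (avgObj fun i => logLik f (x i)) θ j k| ≤ η)
    (hgrad : ‖gradient (subObj (piMix f ξ x θp) (fun i => logLik f (x i)) K) θh‖
      ≤ b / Real.sqrt r)
    (hm : 4 / lam * b / Real.sqrt r < ρ) :
    ‖Real.sqrt r • matOp (invSqrt (covRDS f ξ x θh)) (θ - θh) - linRDS f ξ x θh θp K‖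
      ≤ c⁻¹ * (d * (η + (C + 1) * (4 / lam * b / Real.sqrt r))) * (4 / lam * b) := by
  have hr' : (0 : ℝ) < r := by exact_mod_cast hr
  have hsr := Real.sqrt_pos.2 hr'
  have hθh := h.mem hρ
  have hn := h.cast_pos
  set m := 4 / lam * b / Real.sqrt r with hmdef
  set sub := subObj (piMix f ξ x θp) (fun i => logLik f (x i)) K with hsub
  set A := invSqrt (covRDS f ξ x θh) with hA
  set M := avgHess f x θh with hM
  have hcd : ∀ θ ∈ Θ, ContDiffAt ℝ 2 sub θ := fun θ hθ =>
    contDiffAt_weightedSum _ fun k => (h.smooth (K k)).contDiffAt θ hθ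
  have hΔ : ‖θ - θh‖ ≤ m := by
    have := hθ.norm_sub_le hconv hcd (lam := lam / 2) (by positivity)
      (fun θ' hθ' v => inner_matOp_le_of_abs_sub_le hd (h.concave θ' hθ')
        (fun j k => (hHess θ' hθ' j k).trans hη) v) hθh
    calc _ ≤ _ := this
      _ ≤ 2 / (lam / 2) * (b / Real.sqrt r) := by gcongr
      _ = m := by rw [hmdef]; field_simp; ring
  have hm0 : 0 ≤ m := (norm_nonneg _).trans hΔ
  -- Being within `m < ρ` of `θ̂`, the maximizer is interior to `Θ`, which is what yields the
  -- equation `gradient = 0`.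
  have hnhds : Θ ∈ 𝓝 θ := by
    refine Filter.mem_of_superset (Metric.isOpen_ball.mem_nhds ?_)
      (Metric.ball_subset_closedBall.trans h.closedBall_subset)
    rw [Metric.mem_ball, dist_eq_norm]
    exact hΔ.trans_lt hm
  have hg0 := hθ.gradient_eq_zero hnhds
  have havg : SmoothBound Θ (avgObj fun i => logLik f (x i)) (∑ i, (n : ℝ)⁻¹ * G (x i)) :=
    SmoothBound.weightedSum _ (fun _ => inv_nonneg.2 hn.le) h.smooth
  have hGle : ∑ i, (n : ℝ)⁻¹ * G (x i) ≤ C + 1 := by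
    rw [← Finset.mul_sum]
    exact h.avg_envelope_le
  have hR := norm_gradient_sub_sub_le hconv hcd (M := M) hθh hθ.1
    (a := η + (C + 1) * m) (by positivity) (fun θ' hθ' hle j k => by
      have h1 := hHess θ' hθ' j k
      have h2 := havg.hessian_lip θ' hθ' θh hθh j k
      rw [← h.avgHess_eq hρ] at h2
      have h3 : (∑ i, (n : ℝ)⁻¹ * G (x i)) * ‖θ' - θh‖ ≤ (C + 1) * m :=
        mul_le_mul hGle (hle.trans hΔ) (norm_nonneg _) (by positivity)
      have h4 := abs_sub_le (hessian sub θ' j k)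
        (hessian (avgObj fun i => logLik f (x i)) θ' j k) (M j k)
      linarith)
  rw [hg0, zero_sub] at hR
  -- Writing `θ - θ̂` as `M⁻¹ M (θ - θ̂)` turns the difference into `V^{-1/2} M⁻¹` applied to the
  -- linearization error of the gradient.
  have e : Real.sqrt r • matOp A (θ - θh) - linRDS f ξ x θh θp K
      = -(Real.sqrt r • matOp A (matOp M⁻¹ (-gradient sub θh - matOp M (θ - θh)))) := by
    have e' : ∀ u v, matOp A (matOp M⁻¹ (-u - matOp M v)) = -matOp A (matOp M⁻¹ u) - matOp A v := by
      intro u v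
      rw [map_sub (matOp M⁻¹), matOp_inv_apply (h.isUnit_det_avgHess hρ hlam), map_neg, map_sub,
        map_neg]
    rw [e', linRDS, smul_sub, smul_neg]
    simp only [hA, hM, hsub]
    abel
  rw [e, norm_neg, norm_smul, Real.norm_eq_abs, abs_of_pos hsr]
  have h5 := h.norm_invSqrt_inv_le hd hρ hlam hc hξ hξ1 (-gradient sub θh - matOp M (θ - θh))
  have hsm : Real.sqrt r * m = 4 / lam * b := by rw [hmdef]; field_simp
  calc _ ≤ Real.sqrt r * (c⁻¹ * (d * (η + (C + 1) * m) * ‖θ - θh‖)) := by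
        refine mul_le_mul_of_nonneg_left (h5.trans ?_) hsr.le
        exact mul_le_mul_of_nonneg_left hR (inv_nonneg.2 hc.le)
    _ ≤ Real.sqrt r * (c⁻¹ * (d * (η + (C + 1) * m) * m)) := by gcongr
    _ = c⁻¹ * (d * (η + (C + 1) * m)) * (Real.sqrt r * m) := by ring
    _ = _ := by rw [hsm]

/-- The remainder is negligible in conditional probability. -/
lemma exists_drawsLaw_remainder_le (hd : 0 < d) (hΘ : IsCompact Θ) (hconv : Convex ℝ Θ)
    (hρ : 0 < ρ) (hlam : 0 < lam) (hc : 0 < c) (hC : 0 < C) (hξ : 0 < ξ) (hξ1 : ξ ≤ 1)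
    {ε : ℝ} (hε : 0 < ε) :
    ∃ R : ℕ, ∀ {N n r : ℕ} {x : Fin n → Obs} {θh θp : Param d}, R ≤ r →
      GoodData f Θ G C lam c ρ κ N x θh → θp ∈ Θ → ∀ est : (Fin r → Fin n) → Param d,
      (∀ K, IsArgmax Θ (subObj (piMix f ξ x θp) (fun i => logLik f (x i)) K) (est K)) →
      drawsLaw r (piMix f ξ x θp) {K | ε < ‖Real.sqrt r • matOp (invSqrt (covRDS f ξ x θh))
        (est K - θh) - linRDS f ξ x θh θp K‖} ≤ ENNReal.ofReal ε := by
  -- By Chebyshev the gradient at `θ̂` exceeds `b / √r` with probability at most `ε / 2`, uniformly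
  -- in `r`.
  obtain ⟨b, hb, hbε⟩ : ∃ b > 0, d ^ 2 * (ξ⁻¹ * C) / b ^ 2 ≤ ε / 2 := by
    refine ⟨Real.sqrt (d ^ 2 * (ξ⁻¹ * C) / (ε / 2)), by positivity, ?_⟩
    rw [Real.sq_sqrt (by positivity), div_div_cancel₀ (by positivity)]
  -- The first entry preserves strong concavity of the subsample objective; the second keeps the
  -- Hessian part of the remainder below `ε / 2`.
  set η := min (lam / (2 * d)) (ε / 2 / (c⁻¹ * d * (4 / lam * b))) with hη
  have hη0 : 0 < η := lt_min (by positivity) (by positivity)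
  obtain ⟨B, hB⟩ := exists_drawsLaw_hessian_le (d := d) hΘ hC.le hξ hη0
  have hsqrt : Tendsto (fun N : ℕ => Real.sqrt N) atTop atTop :=
    Real.tendsto_sqrt_atTop.comp tendsto_natCast_atTop_atTop
  have h1 : Tendsto (fun r : ℕ => B / (r : ℝ)) atTop (𝓝 0) :=
    tendsto_const_nhds.div_atTop tendsto_natCast_atTop_atTop
  have h2 : Tendsto (fun r : ℕ => 4 / lam * b / Real.sqrt r) atTop (𝓝 0) :=
    tendsto_const_nhds.div_atTop hsqrt
  have h3 : Tendsto (fun r : ℕ => c⁻¹ * d * (C + 1) * (4 / lam * b) * (4 / lam * b / Real.sqrt r))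
      atTop (𝓝 0) := by
    simpa using h2.const_mul (c⁻¹ * d * (C + 1) * (4 / lam * b))
  obtain ⟨R, hR⟩ := eventually_atTop.1 (((tendsto_order.1 h1).2 _ (half_pos hε)).and
    (((tendsto_order.1 h2).2 _ hρ).and (((tendsto_order.1 h3).2 _ (half_pos hε)).and
      (eventually_gt_atTop 0))))
  refine ⟨R, fun {N n r x θh θp} hRr h hθp est hest => ?_⟩
  obtain ⟨e1, e2, e3, hr⟩ := hR r hRr
  have hr' : (0 : ℝ) < r := by exact_mod_cast hr
  have hsr := Real.sqrt_pos.2 hr'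
  have hp := h.isMixedProb hd hc hξ1 hθp
  have hsub : {K : Fin r → Fin n | ε < ‖Real.sqrt r • matOp (invSqrt (covRDS f ξ x θh))
        (est K - θh) - linRDS f ξ x θh θp K‖} ⊆
      {K | ∃ θ ∈ Θ, ∃ j k, η < |hessian (subObj (piMix f ξ x θp) (fun i => logLik f (x i)) K) θ j k
        - hessian (avgObj fun i => logLik f (x i)) θ j k|}
      ∪ {K | b / Real.sqrt r
        < ‖gradient (subObj (piMix f ξ x θp) (fun i => logLik f (x i)) K) θh‖} := by
    intro K hK
    by_contra hcon
    simp only [Set.mem_union, Set.mem_ofPred_eq, not_or, not_exists, not_and, not_lt] at hcon hK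
    have h4 := h.norm_sub_linRDS_le hd hconv hρ hlam hc hC hξ hξ1 hr (hest K)
      (min_le_left _ _) hη0.le (fun θ hθ j k => hcon.1 θ hθ j k) hcon.2 e2
    have h5 : c⁻¹ * d * (4 / lam * b) * η ≤ ε / 2 := by
      have : η ≤ ε / 2 / (c⁻¹ * d * (4 / lam * b)) := min_le_right _ _
      rwa [le_div_iff₀' (by positivity)] at this
    have h6 : c⁻¹ * (d * (η + (C + 1) * (4 / lam * b / Real.sqrt r))) * (4 / lam * b)
        = c⁻¹ * d * (4 / lam * b) * η
          + c⁻¹ * d * (C + 1) * (4 / lam * b) * (4 / lam * b / Real.sqrt r) := by ring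
    linarith
  refine (measure_mono hsub).trans ((measure_union_le _ _).trans ?_)
  rw [show ε = ε / 2 + ε / 2 by ring, ENNReal.ofReal_add (by positivity) (by positivity)]
  gcongr
  · exact (hB hp h.smooth h.avg_sq r hr).trans (ENNReal.ofReal_le_ofReal e1.le)
  · refine (drawsLaw_gradient_le hξ (div_pos hb hsr) hp h.smooth h.avg_sq (h.mem hρ)
      h.gradient_eq_zero hr).trans (ENNReal.ofReal_le_ofReal (le_trans (le_of_eq ?_) hbε))
    rw [div_pow, Real.sq_sqrt hr'.le]
    field_simp

end Expansion

/-! ### Characteristic functions and weak approximation of the conditional law -/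

lemma norm_cexp_sub_cexp_le (a b : ℝ) :
    ‖Complex.exp (a * Complex.I) - Complex.exp (b * Complex.I)‖ ≤ |a - b| := by
  have e : Complex.exp (a * Complex.I) - Complex.exp (b * Complex.I)
      = Complex.exp (b * Complex.I) * (Complex.exp (Complex.I * ((a - b : ℝ) : ℂ)) - 1) := by
    rw [mul_sub, ← Complex.exp_add, mul_one]
    congr 2
    push_cast
    ring
  rw [e, norm_mul, Complex.norm_exp_ofReal_mul_I, one_mul]
  exact Real.norm_exp_I_mul_ofReal_sub_one_le

/-- Characteristic functions of variables which are close in probability are close. -/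
lemma norm_integral_cexp_inner_sub_le {d : ℕ} {X : Type*} [Finite X] [MeasurableSpace X]
    [MeasurableSingletonClass X] {P : Measure X} [IsProbabilityMeasure P] (Z L : X → Param d)
    (t : Param d) {ε : ℝ} (hε : 0 ≤ ε) (hP : P {K | ε < ‖Z K - L K‖} ≤ ENNReal.ofReal ε) :
    ‖∫ K, Complex.exp ((inner ℝ (Z K) t : ℝ) * Complex.I) ∂P
      - ∫ K, Complex.exp ((inner ℝ (L K) t : ℝ) * Complex.I) ∂P‖ ≤ (‖t‖ + 2) * ε := by
  rw [← integral_sub Integrable.of_finite Integrable.of_finite]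
  have hbound : ∀ K, ‖Complex.exp ((inner ℝ (Z K) t : ℝ) * Complex.I)
      - Complex.exp ((inner ℝ (L K) t : ℝ) * Complex.I)‖
      ≤ ‖t‖ * ε + {K | ε < ‖Z K - L K‖}.indicator (fun _ => 2) K := fun K => by
    by_cases hK : ε < ‖Z K - L K‖
    · rw [Set.indicator_of_mem (by exact hK)]
      refine (norm_sub_le _ _).trans ?_
      rw [Complex.norm_exp_ofReal_mul_I, Complex.norm_exp_ofReal_mul_I]
      have : 0 ≤ ‖t‖ * ε := by positivity
      linarith
    · rw [Set.indicator_of_notMem (by exact hK), add_zero]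
      refine (norm_cexp_sub_cexp_le _ _).trans ?_
      rw [← inner_sub_left]
      refine (abs_real_inner_le_norm _ _).trans ?_
      rw [mul_comm]
      exact mul_le_mul_of_nonneg_left (not_lt.1 hK) (norm_nonneg _)
  have hset : MeasurableSet {K | ε < ‖Z K - L K‖} := Set.Finite.measurableSet (Set.toFinite _)
  refine (norm_integral_le_of_norm_le Integrable.of_finite (ae_of_all _ hbound)).trans ?_
  rw [integral_add (integrable_const _) Integrable.of_finite, integral_indicator_const _ hset]
  have h2 : P.real {K | ε < ‖Z K - L K‖} ≤ ε := ENNReal.toReal_le_of_le_ofReal hε hP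
  simp only [integral_const, probReal_univ, smul_eq_mul, one_mul]
  linarith

section Limit

variable {d : ℕ} {f : Param d → ℝ → ℝ} {Θ : Set (Param d)} {G : Obs → ℝ} {C lam c ρ : ℝ}
  {κ : ℕ → ℝ} {ξ : ℝ}

lemma exists_norm_charFun_condLawRDS_le (hd : 0 < d) (hΘ : IsCompact Θ) (hconv : Convex ℝ Θ)
    (hρ : 0 < ρ) (hlam : 0 < lam) (hc : 0 < c) (hC : 0 < C) (hξ : 0 < ξ) (hξ1 : ξ ≤ 1)
    (t : Param d) {ε : ℝ} (hε : 0 < ε) :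
    ∃ N₀ : ℕ, ∀ {N n r : ℕ} {x : Fin n → Obs} {θh θp : Param d}, N₀ ≤ N → N ≤ r →
      GoodData f Θ G C lam c ρ κ N x θh → θp ∈ Θ → ‖θp - θh‖ ≤ 1 / (N + 1) →
      ∀ est : (Fin r → Fin n) → Param d,
      (∀ K, IsArgmax Θ (subObj (piMix f ξ x θp) (fun i => logLik f (x i)) K) (est K)) →
      ‖charFun (condLawRDS f ξ x θh θp est) t - charFun (stdGaussian (Param d)) t‖ ≤ ε := by
  obtain ⟨N₁, h₁⟩ := exists_norm_integral_cexp_linRDS_le (f := f) (Θ := Θ) (G := G) (κ := κ)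
    hd hρ hlam hc hC hξ hξ1 t (half_pos hε)
  set ε' := ε / 2 / (‖t‖ + 2) with hε'
  have hε'0 : 0 < ε' := by positivity
  obtain ⟨R, h₂⟩ := exists_drawsLaw_remainder_le (f := f) (G := G) (κ := κ) hd hΘ hconv hρ hlam hc
    hC hξ hξ1 hε'0
  refine ⟨max N₁ R, fun {N n r x θh θp} hN hNr h hθp hδ est hest => ?_⟩
  have hp := h.isMixedProb hd hc hξ1 hθp
  have hpr := hp.isProbabilityMeasure hξ
  have : IsProbabilityMeasure (drawsLaw r (piMix f ξ x θp)) := by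
    unfold drawsLaw; infer_instance
  have e1 := h₁ (le_of_max_le_left hN) hNr h hθp hδ
  have e2 := norm_integral_cexp_inner_sub_le (P := drawsLaw r (piMix f ξ x θp))
    (fun K => Real.sqrt r • matOp (invSqrt (covRDS f ξ x θh)) (est K - θh))
    (linRDS f ξ x θh θp) t hε'0.le (h₂ ((le_of_max_le_right hN).trans hNr) h hθp est hest)
  have e3 : (‖t‖ + 2) * ε' = ε / 2 := by rw [hε']; field_simp
  rw [e3] at e2
  rw [condLawRDS, charFun_apply, integral_map (measurable_of_finite _).aemeasurable
    (by fun_prop), charFun_stdGaussian]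
  have e4 : Complex.exp (-(‖t‖ : ℂ) ^ 2 / 2) = ((Real.exp (-(‖t‖ ^ 2 / 2)) : ℝ) : ℂ) := by
    push_cast
    ring_nf
  rw [e4]
  refine (norm_sub_le_norm_sub_add_norm_sub _ _ _).trans ((add_le_add e2 e1).trans ?_)
  linarith

/-- Along good data the conditional law is weakly close to the standard Gaussian law. -/
lemma exists_abs_integral_condLawRDS_le (hd : 0 < d) (hΘ : IsCompact Θ) (hconv : Convex ℝ Θ)
    (hρ : 0 < ρ) (hlam : 0 < lam) (hc : 0 < c) (hC : 0 < C) (hξ : 0 < ξ) (hξ1 : ξ ≤ 1)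
    (g : Param d →ᵇ ℝ) {ε : ℝ} (hε : 0 < ε) :
    ∃ N : ℕ, ∀ {n r : ℕ} {x : Fin n → Obs} {θh θp : Param d}, N ≤ r →
      GoodData f Θ G C lam c ρ κ N x θh → θp ∈ Θ → ‖θp - θh‖ ≤ 1 / (N + 1) →
      ∀ est : (Fin r → Fin n) → Param d,
      (∀ K, IsArgmax Θ (subObj (piMix f ξ x θp) (fun i => logLik f (x i)) K) (est K)) →
      |∫ y, g y ∂(condLawRDS f ξ x θh θp est) - ∫ y, g y ∂(stdGaussian (Param d))| ≤ ε := by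
  -- A counterexample for every `N` gives a sequence of good data with all error parameters tending
  -- to zero. Its characteristic functions converge, so Lévy's theorem contradicts the failure for
  -- `g`. This makes `N` uniform over the data without any metric for weak convergence.
  by_contra hcon
  push Not at hcon
  choose n r x θh θp hr hgood hθp hδ est hest hbad using hcon
  have hprob : ∀ N, IsProbabilityMeasure (condLawRDS f ξ (x N) (θh N) (θp N) (est N)) := fun N => by
    have := ((hgood N).isMixedProb hd hc hξ1 (hθp N)).isProbabilityMeasure hξ
    have : IsProbabilityMeasure (drawsLaw (r N) (piMix f ξ (x N) (θp N))) := by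
      unfold drawsLaw; infer_instance
    exact Measure.isProbabilityMeasure_map (measurable_of_finite _).aemeasurable
  set P : ℕ → ProbabilityMeasure (Param d) := fun N =>
    ⟨condLawRDS f ξ (x N) (θh N) (θp N) (est N), hprob N⟩ with hP
  have hlim : Tendsto P atTop (𝓝 ⟨stdGaussian (Param d), inferInstance⟩) := by
    refine ProbabilityMeasure.tendsto_of_tendsto_charFun fun t => ?_
    rw [Metric.tendsto_atTop]
    intro e he
    obtain ⟨N₀, hN₀⟩ := exists_norm_charFun_condLawRDS_le (f := f) (G := G) (κ := κ) hd hΘ hconv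
      hρ hlam hc hC hξ hξ1 t (half_pos he)
    refine ⟨N₀, fun N hN => ?_⟩
    rw [dist_eq_norm]
    exact (hN₀ hN (hr N) (hgood N) (hθp N) (hδ N) (est N) (hest N)).trans_lt (half_lt_self he)
  have h2 := (ProbabilityMeasure.tendsto_iff_forall_integral_tendsto.1 hlim) g
  obtain ⟨N, hN⟩ := (Metric.tendsto_atTop.1 h2 ε hε)
  have h3 := hN N le_rfl
  rw [Real.dist_eq] at h3
  exact absurd h3 (not_lt.2 (hbad N).le)

end Limit

/-! The joint law of the data and the pilot subsample -/

/-- If units were almost never observed, conditioning would give the zero measure and a zero mean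
Hessian, which is not definite when `d > 0`. -/
lemma isProbabilityMeasure_obsLaw {d : ℕ} (hd : 0 < d) {f : Param d → ℝ → ℝ} {Θ : Set (Param d)}
    {θ₀ : Param d} (hθ₀ : θ₀ ∈ Θ) (hf : IsLifetimeDensity (f θ₀)) {ν : Measure (EReal × ℝ)}
    [IsProbabilityMeasure ν] (hhess : HessCondition f Θ (obsLaw (f θ₀) ν)) :
    IsProbabilityMeasure (obsLaw (f θ₀) ν) := by
  have := hf.isProbabilityMeasure
  by_cases h0 : ((lifetimeLaw (f θ₀)).prod ν) {z : ℝ × EReal × ℝ | z.2.2 < z.1} = 0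
  · exfalso
    have hz : obsLaw (f θ₀) ν = 0 := by
      rw [obsLaw, cond_eq_zero_of_meas_eq_zero h0, Measure.map_zero]
    obtain ⟨v, hv⟩ := exists_norm_eq_one hd
    have hv0 : v ≠ 0 := fun h => by simp [h] at hv
    have := inner_matOp_pos_of_posDef (hhess.posDef θ₀ hθ₀) hv0
    simp only [hz, integral_zero_measure] at this
    have hM : -(Matrix.of fun _ _ => 0 : Matrix (Fin d) (Fin d) ℝ) = 0 := by
      ext i j
      simp
    rw [hM, show matOp (0 : Matrix (Fin d) (Fin d) ℝ) = 0 from map_zero _] at this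
    simp at this
  · have := cond_isProbabilityMeasure h0
    exact Measure.isProbabilityMeasure_map measurable_record.aemeasurable

/-- A measurable set of the product is bounded by its sections outside an exceptional set. -/
lemma prod_measure_le {X Y : Type*} [MeasurableSpace X] [MeasurableSpace Y] {μ : Measure X}
    [IsProbabilityMeasure μ] {κ : Measure Y} [IsProbabilityMeasure κ] {W : Set (X × Y)}
    (hW : MeasurableSet W) {q : X → Prop} {b : ENNReal}
    (h : ∀ x, q x → κ {y | (x, y) ∈ W} ≤ b) : (μ.prod κ) W ≤ μ {x | ¬ q x} + b := by
  -- The exceptional set need not be measurable, so a measurable hull of equal measure replaces it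
  -- under the integral.
  set S := toMeasurable μ {x | ¬ q x} with hS
  rw [Measure.prod_apply hW]
  calc ∫⁻ x, κ (Prod.mk x ⁻¹' W) ∂μ ≤ ∫⁻ x, (S.indicator (fun _ => 1) x + b) ∂μ := by
        refine lintegral_mono fun x => ?_
        by_cases hx : x ∈ S
        · rw [Set.indicator_of_mem hx]
          exact prob_le_one.trans le_self_add
        · rw [Set.indicator_of_notMem hx, zero_add]
          exact h x (by_contra fun hq => hx (subset_toMeasurable μ _ hq))
    _ = μ {x | ¬ q x} + b := by
        rw [lintegral_add_right _ measurable_const, lintegral_indicator_const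
          (measurableSet_toMeasurable _ _), measure_toMeasurable]
        simp

lemma IsArgmax.const_mul {d : ℕ} {Θ : Set (Param d)} {h h' : Param d → ℝ} {θ : Param d}
    (hθ : IsArgmax Θ h θ) {a : ℝ} (ha : 0 ≤ a) (hh : ∀ θ, h' θ = a * h θ) : IsArgmax Θ h' θ := by
  refine ⟨hθ.1, fun θ' hθ' => ?_⟩
  change h' θ' ≤ h' θ
  rw [hh, hh]
  exact mul_le_mul_of_nonneg_left (hθ.2 hθ') ha

section Likelihood

variable {d n r : ℕ} (f : Param d → ℝ → ℝ) (x : Fin n → Obs) (K : Fin r → Fin n) (θ : Param d)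

lemma subObj_uniform_eq_pilotLogLik (hn : 0 < n) :
    subObj (fun _ => (n : ℝ)⁻¹) (fun i => logLik f (x i)) K θ = pilotLogLik f x K θ := by
  have : (n : ℝ) ≠ 0 := by exact_mod_cast hn.ne'
  simp [subObj, pilotLogLik, this, Finset.mul_sum]

lemma subObj_piMix_eq_weightedLogLik (ξ : ℝ) (θp : Param d) :
    subObj (piMix f ξ x θp) (fun i => logLik f (x i)) K θ
      = (n : ℝ)⁻¹ * weightedLogLik f ξ x θp K θ := by
  simp only [subObj, weightedLogLik, Finset.mul_sum]
  refine Finset.sum_congr rfl fun k _ => ?_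
  rw [mul_inv]
  ring

end Likelihood

lemma isProbabilityMeasure_drawsLaw_uniform {n : ℕ} (hn : 0 < n) (m : ℕ) :
    IsProbabilityMeasure (drawsLaw m fun _ : Fin n => (n : ℝ)⁻¹) := by
  have := (isMixedProb_uniform le_rfl hn).isProbabilityMeasure one_pos
  unfold drawsLaw
  infer_instance

lemma dataPilotLaw_fst_preimage_le {g : ℝ → ℝ} {ν : Measure (EReal × ℝ)} {n : ℕ} (hn : 0 < n) (r₀ : ℕ) (S : Set (Fin n → Obs)) :
    dataPilotLaw g ν n r₀ {z | z.1 ∈ S} ≤ dataLaw g ν n S := by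
  have := isProbabilityMeasure_drawsLaw_uniform hn r₀
  have e : {z : (Fin n → Obs) × (Fin r₀ → Fin n) | z.1 ∈ S} = S ×ˢ Set.univ := by
    ext z
    simp
  rw [dataPilotLaw, e, Measure.prod_prod, measure_univ, mul_one]

section PilotLaw

variable {d : ℕ} {f : Param d → ℝ → ℝ} {Θ : Set (Param d)} {G : Obs → ℝ} {C lam c ρ : ℝ}
  {κ : ℕ → ℝ} {g : ℝ → ℝ} {ν : Measure (EReal × ℝ)} [IsProbabilityMeasure (obsLaw g ν)]
  {θhat : (n : ℕ) → (Fin n → Obs) → Param d}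
  {θpilot : (n r₀ : ℕ) → (Fin n → Obs) → (Fin r₀ → Fin n) → Param d}

/-- The pilot estimate is close to the full-data estimate outside an event of small probability,
whatever the relation between the sample sizes. -/
lemma exists_dataPilotLaw_pilot_le (hd : 0 < d) (hΘ : IsCompact Θ) (hconv : Convex ℝ Θ)
    (hρ : 0 < ρ) (hlam : 0 < lam) (hC : 0 < C) (hhat_meas : ∀ n, Measurable (θhat n))
    (hpilot_meas : ∀ n r₀ J, Measurable fun x => θpilot n r₀ x J) (N : ℕ) {ε : ℝ} (hε : 0 < ε) :
    ∃ B : ℝ, ∀ n r₀ : ℕ, 0 < n → 0 < r₀ → ∀ q : (Fin n → Obs) → Prop,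
      (∀ x, q x → GoodData f Θ G C lam c ρ κ N x (θhat n x) ∧
        ∀ J, IsArgmax Θ (pilotLogLik f x J) (θpilot n r₀ x J)) →
      dataPilotLaw g ν n r₀ {z | ε < ‖θpilot n r₀ z.1 z.2 - θhat n z.1‖}
        ≤ dataLaw g ν n {x | ¬ q x} + ENNReal.ofReal (B / r₀) := by
  -- Uniform sampling is the case `ξ = 1`. The constant is fixed before `n`, so the pilot is close
  -- to `θ̂` however `r₀` compares with `n`.
  obtain ⟨B, hB⟩ := exists_drawsLaw_argmax_le (d := d) hd hΘ hconv hC.le one_pos hlam hε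
  refine ⟨B, fun n r₀ hn hr₀ q hq => ?_⟩
  have := isProbabilityMeasure_drawsLaw_uniform hn r₀
  have : IsProbabilityMeasure (dataLaw g ν n) := by unfold dataLaw; infer_instance
  have hm : Measurable fun z : (Fin n → Obs) × (Fin r₀ → Fin n) => θpilot n r₀ z.1 z.2 :=
    measurable_from_prod_countable_left fun J => hpilot_meas n r₀ J
  refine prod_measure_le (measurableSet_lt measurable_const
    (hm.sub ((hhat_meas n).comp measurable_fst)).norm) fun x hx => ?_
  obtain ⟨h, hJ⟩ := hq x hx
  exact hB (isMixedProb_uniform le_rfl hn) h.smooth h.avg_sq h.concave (h.mem hρ)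
    h.gradient_eq_zero r₀ hr₀ (θpilot n r₀ x) fun J =>
      (hJ J).const_mul zero_le_one fun θ => by rw [subObj_uniform_eq_pilotLogLik f x J θ hn, one_mul]

end PilotLaw

end

/-! ### Assembly of the theorem -/

theorem proposition1 {d : ℕ} (hd : 0 < d)
    -- the parametric lifetime model, the parameter space and the true parameter
    (f : Param d → ℝ → ℝ) (Θ : Set (Param d)) (θ₀ : Param d)
    (hf : ∀ θ ∈ Θ, IsLifetimeDensity (f θ))
    (hΘ : IsCompact Θ) (hconv : Convex ℝ Θ) (hθ₀ : θ₀ ∈ interior Θ)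
    -- the joint law of censoring and truncation times
    (ν : Measure (EReal × ℝ)) [IsProbabilityMeasure ν]
    (hν : ∀ᵐ z ∂ν, (z.2 : EReal) ≤ z.1)
    -- regularity of the log-likelihood
    (hsmooth : SmoothLik f Θ (obsLaw (f θ₀) ν))
    (hmoment : ∀ θ ∈ Θ, MemLp (fun x => logLik f x θ) 2 (obsLaw (f θ₀) ν))
    (hhess : HessCondition f Θ (obsLaw (f θ₀) ν))
    (hscore : ScoreCondition f Θ (obsLaw (f θ₀) ν))
    -- the full-data maximum likelihood estimator
    (θhat : (n : ℕ) → (Fin n → Obs) → Param d)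
    (hhat_meas : ∀ n, Measurable (θhat n))
    (hhat : ∀ n, ∀ᵐ x ∂(dataLaw (f θ₀) ν n), IsArgmax Θ (fullLogLik f x) (θhat n x))
    (hunique : Tendsto (fun n => dataLaw (f θ₀) ν n {x | ¬ ∃! θ, IsArgmax Θ (fullLogLik f x) θ})
      atTop (𝓝 0))
    (hfourth : FourthMomentCondition f Θ (dataLaw (f θ₀) ν) θhat)
    -- the pilot estimator, from a uniform subsample
    (θpilot : (n r₀ : ℕ) → (Fin n → Obs) → (Fin r₀ → Fin n) → Param d)
    (hpilot_meas : ∀ n r₀ J, Measurable fun x => θpilot n r₀ x J)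
    (hpilot : ∀ n r₀, ∀ᵐ x ∂(dataLaw (f θ₀) ν n), ∀ J,
      IsArgmax Θ (pilotLogLik f x J) (θpilot n r₀ x J))
    -- the weighted estimator, from a subsample drawn with the mixed probabilities
    (ξ : ℝ) (hξ : ξ ∈ Set.Ioo (0 : ℝ) 1)
    (θRDS : (n r : ℕ) → (Fin n → Obs) → Param d → (Fin r → Fin n) → Param d)
    (hRDS_meas : ∀ n r K, Measurable fun z : (Fin n → Obs) × Param d => θRDS n r z.1 z.2 K)
    (hRDS : ∀ n r, ∀ᵐ x ∂(dataLaw (f θ₀) ν n), ∀ θp ∈ Θ, ∀ K,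
      IsArgmax Θ (weightedLogLik f ξ x θp K) (θRDS n r x θp K)) :
    -- the matrices are nonsingular with probability tending to one
    Tendsto (fun n => dataLaw (f θ₀) ν n
        {x | ¬ ((-(avgHess f x (θhat n x))).PosDef ∧ (lambdaRDS f ξ x (θhat n x)).PosDef)})
      atTop (𝓝 0) ∧
    -- the conditional law converges weakly to `N(0, I)`, in probability, as `r₀, r, n → ∞`
    ∀ g : Param d →ᵇ ℝ, ∀ ε > 0,
      Tendsto (fun m : ℕ × ℕ × ℕ =>
        dataPilotLaw (f θ₀) ν m.2.2 m.1
          {z | ε < |∫ y, g y ∂(condLawRDS f ξ z.1 (θhat m.2.2 z.1) (θpilot m.2.2 m.1 z.1 z.2)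
                (θRDS m.2.2 m.2.1 z.1 (θpilot m.2.2 m.1 z.1 z.2)))
              - ∫ y, g y ∂(stdGaussian (Param d))|})
        atTop (𝓝 0) := by
  have hθ₀' := interior_subset hθ₀
  have := isProbabilityMeasure_obsLaw hd hθ₀' (hf θ₀ hθ₀') hhess
  have hint : ∀ θ ∈ Θ, Integrable (fun x => logLik f x θ) (obsLaw (f θ₀) ν) := fun θ hθ =>
    (hmoment θ hθ).integrable one_le_two
  obtain ⟨G, C, lam, c, ρ, κ, hC, hlam, hc, hρ, hgood⟩ := exists_highProb_goodData hd hΘ hconv hθ₀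
    hsmooth hhess hscore hint (fun θ hθ => integral_logLik_le hν (hf θ hθ) (hf θ₀ hθ₀')
      (hsmooth.mono fun x hx => ⟨(hx θ hθ).1, (hx θ₀ hθ₀').1⟩) (hint θ hθ) (hint θ₀ hθ₀'))
    θhat hhat
  refine ⟨(hgood 0).mono (Eventually.of_forall fun n => ae_of_all _ fun x h =>
    ⟨h.posDef_neg_avgHess hρ hlam, h.posDef_lambdaRDS hd hρ hc hξ.1 hξ.2.le⟩), fun g ε hε => ?_⟩
  -- The test function and `ε` determine one `N`, which sets the tail levels required of the data,
  -- the least `r`, and the required precision of the pilot.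
  obtain ⟨N, hN⟩ := exists_abs_integral_condLawRDS_le (f := f) (G := G) (κ := κ) hd hΘ hconv hρ
    hlam hc hC hξ.1 hξ.2.le g hε
  obtain ⟨B, hB⟩ := exists_dataPilotLaw_pilot_le (f := f) (G := G) (c := c) (κ := κ) (g := f θ₀)
    (ν := ν) hd hΘ hconv hρ hlam hC hhat_meas hpilot_meas N
    (ε := 1 / ((N : ℝ) + 1)) (by positivity)
  have hn : Tendsto (fun m : ℕ × ℕ × ℕ => m.2.2) atTop atTop := by
    simp only [← prod_atTop_atTop_eq]
    exact tendsto_snd.comp tendsto_snd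
  have hr : Tendsto (fun m : ℕ × ℕ × ℕ => m.2.1) atTop atTop := by
    simp only [← prod_atTop_atTop_eq]
    exact tendsto_fst.comp tendsto_snd
  have hr₀ : Tendsto (fun m : ℕ × ℕ × ℕ => m.1) atTop atTop := by
    simp only [← prod_atTop_atTop_eq]
    exact tendsto_fst
  have h1 := (hgood N).comp hn
  have h2 : Tendsto (fun m : ℕ × ℕ × ℕ => ENNReal.ofReal (B / m.1)) atTop (𝓝 0) := by
    rw [← ENNReal.ofReal_zero]
    exact (ENNReal.continuous_ofReal.tendsto 0).comp
      (tendsto_const_nhds.div_atTop (tendsto_natCast_atTop_atTop.comp hr₀))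
  -- Bad data are counted twice: once as an exceptional event of their own and once inside the bound
  -- for the pilot.
  have h3 := h1.add (h1.add h2)
  simp only [add_zero] at h3
  refine tendsto_of_tendsto_of_tendsto_of_le_of_le' tendsto_const_nhds h3
    (Eventually.of_forall fun _ => zero_le) ?_
  filter_upwards [hn.eventually_gt_atTop 0, hr₀.eventually_gt_atTop 0,
    hr.eventually_ge_atTop N] with ⟨r₀, r, n⟩ hn hr₀ hr
  dsimp only [Function.comp_apply] at hn hr₀ hr ⊢
  set q : (Fin n → Obs) → Prop := fun x => GoodData f Θ G C lam c ρ κ N x (θhat n x) ∧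
    (∀ J, IsArgmax Θ (pilotLogLik f x J) (θpilot n r₀ x J)) ∧
    ∀ θp ∈ Θ, ∀ K, IsArgmax Θ (weightedLogLik f ξ x θp K) (θRDS n r x θp K) with hq
  have hqle : dataLaw (f θ₀) ν n {x | ¬ q x}
      ≤ dataLaw (f θ₀) ν n {x | ¬ GoodData f Θ G C lam c ρ κ N x (θhat n x)} := by
    refine measure_mono_ae ?_
    filter_upwards [hpilot n r₀, hRDS n r] with x hx₁ hx₂ hx h
    exact hx ⟨h, hx₁, hx₂⟩
  have hsub : {z : (Fin n → Obs) × (Fin r₀ → Fin n) | ε <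
      |∫ y, g y ∂(condLawRDS f ξ z.1 (θhat n z.1) (θpilot n r₀ z.1 z.2)
        (θRDS n r z.1 (θpilot n r₀ z.1 z.2))) - ∫ y, g y ∂(stdGaussian (Param d))|} ⊆
      {z | z.1 ∈ {x | ¬ q x}} ∪
        {z | 1 / ((N : ℝ) + 1) < ‖θpilot n r₀ z.1 z.2 - θhat n z.1‖} := by
    rintro ⟨x, J⟩ hz
    by_contra hcon
    rw [Set.mem_union, not_or] at hcon
    have hx : q x := not_not.1 hcon.1
    -- Off both exceptional events the weak approximation applies. The maximizers agree because
    -- `weightedLogLik` and `subObj` differ only by the factor `n⁻¹`.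
    have hle : ‖θpilot n r₀ x J - θhat n x‖ ≤ 1 / ((N : ℝ) + 1) := not_lt.1 hcon.2
    have h := hN hr hx.1 (hx.2.1 J).1 hle (θRDS n r x (θpilot n r₀ x J)) fun K =>
      (hx.2.2 _ (hx.2.1 J).1 K).const_mul (inv_nonneg.2 (Nat.cast_nonneg n))
        fun θ => subObj_piMix_eq_weightedLogLik f x K θ ξ _
    exact absurd h (not_le.2 hz)
  have hpil := hB n r₀ hn hr₀ q fun x hx => ⟨hx.1, hx.2.1⟩
  have hfst := dataPilotLaw_fst_preimage_le (g := f θ₀) (ν := ν) hn r₀ {x | ¬ q x}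
  refine (measure_mono hsub).trans ((measure_union_le _ _).trans ?_)
  exact add_le_add (hfst.trans hqle) (hpil.trans (add_le_add hqle le_rfl))
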